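/- For $k\ge 2$ and $a,b\in\mathbb N$ let $A_a(k,b)$ be defined by $A_0(k,b)=k^b$, $A_{a+1}(k,0)=A_a^k(k,\cdot)(0)$ and $A_{a+1}(k,b+1)=A_a^k(k,\cdot)(A_{a+1}(k,b))$, where $A_a^k(k,\cdot)$ is the $k$-fold iterate of $x\mapsto A_a(k,x)$. Every $c>0$ has a unique $k$-normal form $c=A_a(k,b)\cdot m+n$ with $A_a(k,0)\le c<A_{a+1}(k,0)$, $A_a(k,b)\le c<A_a(k,b+1)$ and $n<A_a(k,b)$. Define the base change by $0[k\leftarrow k+1]=0$ and, if $c>0$ has the $k$-normal form $A_a(k,b)\cdot m+n$, by $$c[k\leftarrow k+1]=A_a(k+1,\,b[k\leftarrow k+1])\cdot m+n[k\leftarrow k+1].$$ For $\ell\in\mathbb N$ let $b_0(\ell)=\ell$, $b_{k+1}(\ell)=b_k(\ell)[k+2\leftarrow k+3]-1$ if $b_k(\ell)>0$, and $b_{k+1}(\ell)=0$ if $b_k(\ell)=0$. **Theorem.** For every $\ell\in\mathbb N$ there is a $k\in\mathbb N$ with $b_k(\ell)=0$. Moreover, the arithmetical sentence expressing $\forall \ell\,\exists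 k\; b_k(\ell)=0$ (obtained by the standard coding of recursive definitions through codes of finite sets) is provable in $\mathsf{PA}+\mathrm{TI}(\varepsilon_\omega)$, that is, in first-order logic from the axioms of Peano arithmetic together with the schema of transfinite induction, for all arithmetical formulas with parameters, along the ordinals below $\varepsilon_\omega$. Here $\varepsilon_\xi$ enumerates the fixed points of $\xi\mapsto\omega^\xi$, and the ordinals below $\varepsilon_\omega$ are represented in arithmetic by codes of their Cantor normal forms built from $0$, $+$, $\xi\mapsto\omega^\xi$ and $\varepsilon_0,\varepsilon_1,\varepsilon_2,\dots$ -/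

import Mathlib

/-! ## The Goodstein process -/

namespace AckGoodstein

/-- The Ackermann function `A_a(k,b)` with base `k`, written `ackermann k a b`. -/
def ackermann (k : ℕ) : ℕ → ℕ → ℕ
  | 0, b => k ^ b
  | a + 1, 0 => (fun x => ackermann k a x)^[k] 0
  | a + 1, b + 1 => (fun x => ackermann k a x)^[k] (ackermann k (a + 1) b)

/-- `c` has the `k`-normal form `A_a(k,b) * m + n`. -/
structure IsNF (k c a b m n : ℕ) : Prop where
  eq : c = ackermann k a b * m + n
  le_left : ackermann k a 0 ≤ c
  lt_left : c < ackermann k (a + 1) 0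
  le_right : ackermann k a b ≤ c
  lt_right : c < ackermann k a (b + 1)
  lt_rem : n < ackermann k a b

theorem lt_iterate_of_lt {f : ℕ → ℕ} (hf : ∀ x, x < f x) {i : ℕ} (hi : 0 < i) (x : ℕ) :
    x < f^[i] x := by
  obtain ⟨j, rfl⟩ := Nat.exists_eq_succ_of_ne_zero hi.ne'
  clear hi
  induction j with
  | zero => simpa using hf x
  | succ j ih =>
    rw [Function.iterate_succ_apply']
    exact ih.trans (hf _)

theorem lt_ackermann {k : ℕ} (hk : 2 ≤ k) (a b : ℕ) : b < ackermann k a b := by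
  induction a generalizing b with
  | zero => rw [ackermann]; exact Nat.lt_pow_self (by omega)
  | succ a iha =>
    induction b with
    | zero => rw [ackermann]; exact lt_iterate_of_lt iha (by omega) _
    | succ b ihb =>
      rw [ackermann]
      exact (Nat.succ_le_of_lt ihb).trans_lt (lt_iterate_of_lt iha (by omega) _)

theorem IsNF.lt {k c a b m n : ℕ} (hk : 2 ≤ k) (h : IsNF k c a b m n) : b < c ∧ n < c :=
  ⟨(lt_ackermann hk a b).trans_le h.le_right, h.lt_rem.trans_le h.le_right⟩

theorem ackermann_lt_ackermann_succ_right {k : ℕ} (hk : 2 ≤ k) (a b : ℕ) :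
    ackermann k a b < ackermann k a (b + 1) := by
  cases a with
  | zero => simp only [ackermann]; exact Nat.pow_lt_pow_right (by omega) (by omega)
  | succ a =>
    conv_rhs => rw [ackermann]
    exact lt_iterate_of_lt (lt_ackermann hk a) (by omega) _

theorem ackermann_strictMono_right {k : ℕ} (hk : 2 ≤ k) (a : ℕ) : StrictMono (ackermann k a) :=
  strictMono_nat_of_lt_succ (ackermann_lt_ackermann_succ_right hk a)

theorem ackermann_zero_lt_ackermann_zero_succ {k : ℕ} (hk : 2 ≤ k) (a : ℕ) :
    ackermann k a 0 < ackermann k (a + 1) 0 := by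
  obtain ⟨j, rfl⟩ : ∃ j, k = j + 1 + 1 := ⟨k - 2, by omega⟩
  rw [ackermann.eq_2, Function.iterate_succ_apply]
  exact lt_iterate_of_lt (lt_ackermann hk a) (by omega) _

theorem ackermann_zero_strictMono {k : ℕ} (hk : 2 ≤ k) : StrictMono fun a => ackermann k a 0 :=
  strictMono_nat_of_lt_succ (ackermann_zero_lt_ackermann_zero_succ hk)

/-- A strictly monotone sequence with `f 0 ≤ c` has a unique `i` with `f i ≤ c < f (i + 1)`. -/
theorem existsUnique_bracket {f : ℕ → ℕ} (hf : StrictMono f) {c : ℕ} (h0 : f 0 ≤ c) :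
    ∃! i, f i ≤ c ∧ c < f (i + 1) := by
  have hex : ∃ i, c < f (i + 1) := ⟨c, lt_of_lt_of_le (Nat.lt_succ_self c) (hf.id_le (c + 1))⟩
  refine ⟨Nat.find hex, ⟨?_, Nat.find_spec hex⟩, ?_⟩
  · rcases Nat.eq_zero_or_pos (Nat.find hex) with h | h
    · rw [h]; exact h0
    · obtain ⟨j, hj⟩ := Nat.exists_eq_succ_of_ne_zero h.ne'
      have := Nat.find_min hex (m := j) (by omega)
      rw [hj]; exact not_lt.mp this
  · rintro i ⟨h1, h2⟩
    refine le_antisymm ?_ (Nat.find_min' hex h2)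
    have := hf.lt_iff_lt.mp (h1.trans_lt (Nat.find_spec hex))
    omega

/-- Existence and uniqueness of normal forms: the recursion on normal forms is meaningful. -/
theorem existsUnique_isNF {k c : ℕ} (hk : 2 ≤ k) (hc : 0 < c) :
    ∃! p : ℕ × ℕ × ℕ × ℕ, IsNF k c p.1 p.2.1 p.2.2.1 p.2.2.2 := by
  obtain ⟨a, ⟨ha1, ha2⟩, hau⟩ := existsUnique_bracket (ackermann_zero_strictMono hk) (c := c)
    (by rw [ackermann, pow_zero]; exact hc)
  obtain ⟨b, ⟨hb1, hb2⟩, hbu⟩ :=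
    existsUnique_bracket (ackermann_strictMono_right hk a) (c := c) ha1
  have hpos : 0 < ackermann k a b := (Nat.zero_le b).trans_lt (lt_ackermann hk a b)
  refine ⟨(a, b, c / ackermann k a b, c % ackermann k a b),
    ⟨(Nat.div_add_mod c _).symm, ha1, ha2, hb1, hb2, Nat.mod_lt _ hpos⟩, ?_⟩
  rintro ⟨a', b', m', n'⟩ h
  obtain rfl : a' = a := hau a' ⟨h.le_left, h.lt_left⟩
  obtain rfl : b' = b := hbu b' ⟨h.le_right, h.lt_right⟩
  have he : c = n' + ackermann k a' b' * m' := by rw [h.eq, add_comm]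
  have h1 : c / ackermann k a' b' = m' := by
    rw [he, Nat.add_mul_div_left _ _ hpos, Nat.div_eq_of_lt h.lt_rem, zero_add]
  have h2 : c % ackermann k a' b' = n' := by
    rw [he, Nat.add_mul_mod_self_left, Nat.mod_eq_of_lt h.lt_rem]
  simp only [h1, h2]

open Classical in
/-- The base change `c[k ← k+1]` for `k ≥ 2`: the arguments `b` and `n` of the normal form are
rewritten recursively, the index `a` is not. (For `k < 2` the value is the junk value `0`.) -/
noncomputable def baseChange (k : ℕ) (c : ℕ) : ℕ :=
  if h : 2 ≤ k ∧ ∃ p : ℕ × ℕ × ℕ × ℕ, IsNF k c p.1 p.2.1 p.2.2.1 p.2.2.2 then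
    ackermann (k + 1) h.2.choose.1 (baseChange k h.2.choose.2.1) * h.2.choose.2.2.1
      + baseChange k h.2.choose.2.2.2
  else 0
termination_by c
decreasing_by
  · exact (h.2.choose_spec.lt h.1).1
  · exact (h.2.choose_spec.lt h.1).2

theorem baseChange_zero (k : ℕ) : baseChange k 0 = 0 := by
  rw [baseChange, dif_neg]
  rintro ⟨hk, p, hp⟩
  exact absurd (hp.lt hk).1 (Nat.not_lt_zero _)

theorem baseChange_of_isNF {k c a b m n : ℕ} (hk : 2 ≤ k) (h : IsNF k c a b m n) :
    baseChange k c = ackermann (k + 1) a (baseChange k b) * m + baseChange k n := by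
  have hc : 0 < c := (Nat.zero_le b).trans_lt (h.lt hk).1
  have hex : 2 ≤ k ∧ ∃ p : ℕ × ℕ × ℕ × ℕ, IsNF k c p.1 p.2.1 p.2.2.1 p.2.2.2 :=
    ⟨hk, (a, b, m, n), h⟩
  have hp : hex.2.choose = (a, b, m, n) :=
    (existsUnique_isNF hk hc).unique hex.2.choose_spec h
  rw [baseChange, dif_pos hex, hp]

/-- The Goodstein process: `goodstein ℓ k` is `b_k(ℓ)`. -/
noncomputable def goodstein (ℓ : ℕ) : ℕ → ℕ
  | 0 => ℓ
  | k + 1 => if goodstein ℓ k = 0 then 0 else baseChange (k + 2) (goodstein ℓ k) - 1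

end AckGoodstein

/-! ## Provability in first-order logic with equality -/

namespace FirstOrder.Language

universe u v

variable {L : Language.{u, v}}

/-- Instantiation of the outermost bound variable by a term. Bound variables are de Bruijn levels,
so that this variable is `&0`; the other ones are renumbered. -/
def BoundedFormula.inst {α : Type} (t : L.Term α) :
    ∀ {n : ℕ}, L.BoundedFormula α (n + 1) → L.BoundedFormula α n
  | _, .falsum => .falsum
  | _, .equal t₁ t₂ => .equal (instTerm t t₁) (instTerm t t₂)
  | _, .rel R ts => .rel R fun i => instTerm t (ts i)
  | _, .imp φ ψ => .imp (inst t φ) (inst t ψ)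
  | _, .all φ => .all (inst t φ)
where
  /-- Instantiation of the variable `&0` in a term. -/
  instTerm (t : L.Term α) {n : ℕ} (s : L.Term (α ⊕ Fin (n + 1))) : L.Term (α ⊕ Fin n) :=
    s.subst (Sum.elim (fun x => Term.var (Sum.inl x))
      (Fin.cases (t.relabel Sum.inl) fun i => Term.var (Sum.inr i)))

/-- Renaming of the free variables `0, 1, 2, …` to `1, 2, 3, …`, so that `0` becomes fresh. -/
def BoundedFormula.shift {n : ℕ} (φ : L.BoundedFormula ℕ n) : L.BoundedFormula ℕ n :=
  φ.subst fun x => Term.var (x + 1)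

/-- Natural deduction for classical first-order logic with equality. The free variables are the
natural numbers; `⊥`, `=`, the relation symbols, `→` and `∀` are the primitive logical symbols. -/
inductive Derives : Set (L.Formula ℕ) → L.Formula ℕ → Prop
  | assume {Γ φ} : φ ∈ Γ → Derives Γ φ
  | impI {Γ φ ψ} : Derives (insert φ Γ) ψ → Derives Γ (φ.imp ψ)
  | impE {Γ φ ψ} : Derives Γ (φ.imp ψ) → Derives Γ φ → Derives Γ ψ
  | byContra {Γ φ} : Derives (insert φ.not Γ) ⊥ → Derives Γ φ
  | allI {Γ} {φ : L.BoundedFormula ℕ 1} :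
      Derives (BoundedFormula.shift '' Γ) (φ.shift.inst (Term.var 0)) → Derives Γ φ.all
  | allE {Γ} {φ : L.BoundedFormula ℕ 1} (t : L.Term ℕ) : Derives Γ φ.all → Derives Γ (φ.inst t)
  | eqRefl {Γ} (t : L.Term ℕ) : Derives Γ (t.equal t)
  | eqSubst {Γ} {φ : L.BoundedFormula ℕ 1} {t s : L.Term ℕ} :
      Derives Γ (t.equal s) → Derives Γ (φ.inst t) → Derives Γ (φ.inst s)

/-- `T.Proves σ`: the sentence `σ` is derivable from the axioms of the theory `T`. -/
def Theory.Proves (T : L.Theory) (σ : L.Sentence) : Prop :=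
  Derives ((fun τ : L.Sentence => τ.subst (β := ℕ) Empty.elim) '' T) (σ.subst Empty.elim)

/-- Existential quantification over the last `m` of `n + m` free variables. -/
def exLast {n : ℕ} (m : ℕ) (φ : L.Formula (Fin (n + m))) : L.Formula (Fin n) :=
  BoundedFormula.exs (BoundedFormula.relabel (n := m) (finSumFinEquiv (m := n) (n := m)).symm φ)

/-- Universal quantification over the last `m` of `n + m` free variables. -/
def allLast {n : ℕ} (m : ℕ) (φ : L.Formula (Fin (n + m))) : L.Formula (Fin n) :=
  BoundedFormula.alls (BoundedFormula.relabel (n := m) (finSumFinEquiv (m := n) (n := m)).symm φ)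

/-- Universal closure of a formula. -/
def univClosure {n : ℕ} (φ : L.Formula (Fin n)) : L.Sentence :=
  BoundedFormula.alls
    (BoundedFormula.relabel (n := n) (fun i : Fin n => (Sum.inr i : Empty ⊕ Fin n)) φ)

end FirstOrder.Language

/-! ## Peano arithmetic -/

namespace PeanoArithmetic

open FirstOrder Language

/-- The function symbols `0, S, +, ·`. -/
inductive ArithFunc : ℕ → Type
  | zero : ArithFunc 0
  | succ : ArithFunc 1
  | add : ArithFunc 2
  | mul : ArithFunc 2

/-- The language of Peano arithmetic. -/
def arith : Language := ⟨ArithFunc, fun _ => Empty⟩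

instance {α : Type} : Zero (arith.Term α) := ⟨Constants.term (L := arith) ArithFunc.zero⟩
instance {α : Type} : Add (arith.Term α) := ⟨Functions.apply₂ (L := arith) ArithFunc.add⟩
instance {α : Type} : Mul (arith.Term α) := ⟨Functions.apply₂ (L := arith) ArithFunc.mul⟩

/-- The term `S t`. -/
def S {α : Type} (t : arith.Term α) : arith.Term α :=
  Functions.apply₁ (L := arith) ArithFunc.succ t

/-- The variable `i`. -/
def x {n : ℕ} (i : Fin n) : arith.Term (Fin n) := Term.var i

/-- The formula `t = s`. -/
def eq {n : ℕ} (t s : arith.Term (Fin n)) : arith.Formula (Fin n) := Term.equal t s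

/-- Induction for `φ(p₀,…,pₙ₋₁,y)` in the variable `y`:
`∀ p, φ(p,0) → (∀ y, φ(p,y) → φ(p,S y)) → ∀ y, φ(p,y)`. -/
def induction {n : ℕ} (φ : arith.Formula (Fin (n + 1))) : arith.Sentence :=
  univClosure
    ((φ.subst (Fin.snoc x 0)).imp
      ((allLast 1 (φ.imp (φ.subst (Fin.snoc (fun i => x i.castSucc) (S (x (Fin.last n))))))).imp
        (allLast 1 φ)))

/-- The axioms of Peano arithmetic. -/
inductive PA : arith.Sentence → Prop
  | succ_ne_zero : PA (univClosure (n := 1) (eq (S (x 0)) 0).not)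
  | succ_inj : PA (univClosure (n := 2) ((eq (S (x 0)) (S (x 1))).imp (eq (x 0) (x 1))))
  | add_zero : PA (univClosure (n := 1) (eq (x 0 + 0) (x 0)))
  | add_succ : PA (univClosure (n := 2) (eq (x 0 + S (x 1)) (S (x 0 + x 1))))
  | mul_zero : PA (univClosure (n := 1) (eq (x 0 * 0) 0))
  | mul_succ : PA (univClosure (n := 2) (eq (x 0 * S (x 1)) (x 0 * x 1 + x 0)))
  | induction {n : ℕ} (φ : arith.Formula (Fin (n + 1))) : PA (induction φ)

/-! ### Coding of finite sets and recursive definitions in arithmetic -/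

section Coding

variable {n : ℕ}

/-- `t ≤ s` -/
def le (t s : arith.Term (Fin n)) : arith.Formula (Fin n) :=
  BoundedFormula.subst (exLast 1 (eq (x 0 + x 2) (x 1)) : arith.Formula (Fin 2)) ![t, s]

/-- `t < s` -/
def lt (t s : arith.Term (Fin n)) : arith.Formula (Fin n) := le (S t) s

/-- The pairing function `⟨t, s⟩ = (t + s)² + t`, which is injective on the natural numbers. -/
def pair (t s : arith.Term (Fin n)) : arith.Term (Fin n) := (t + s) * (t + s) + t

/-- `t` belongs to the finite set with code `(c, d, N)`:
`t < N` and `(t + 1) d + 1` divides `c`. Every finite set of natural numbers has a code. -/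
def mem (t c d N : arith.Term (Fin n)) : arith.Formula (Fin n) :=
  BoundedFormula.subst (lt (x 0) (x 3) ⊓ exLast 1 (eq (x 1) (x 4 * S (S (x 0) * x 2))) :
    arith.Formula (Fin 4)) ![t, c, d, N]

/-- For a formula `J(t, c, d, N)`, read as: `t` is justified by the elements of the finite set
`(c, d, N)`, the formula saying that `t` lies in a finite set all of whose elements are justified
by elements of this set. -/
def derivable (J : arith.Formula (Fin 4)) (t : arith.Term (Fin n)) : arith.Formula (Fin n) :=
  BoundedFormula.subst (exLast 3 (mem (x 0) (x 1) (x 2) (x 3) ⊓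
    allLast 1 ((mem (x 4) (x 1) (x 2) (x 3)).imp (J.subst ![x 4, x 1, x 2, x 3]))) :
      arith.Formula (Fin 1)) ![t]

/-- In the context of a formula `J` as above: `t` belongs to the finite set. -/
def known (t : arith.Term (Fin (4 + n))) : arith.Formula (Fin (4 + n)) :=
  mem t (x (Fin.castAdd n 1)) (x (Fin.castAdd n 2)) (x (Fin.castAdd n 3))

end Coding

/-! ### The Goodstein process in arithmetic -/

section Goodstein

variable {n : ℕ}

/-- Code of the fact `A_a(k,b) = v`. -/
def ackFact (k a b v : arith.Term (Fin n)) : arith.Term (Fin n) :=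
  pair 0 (pair k (pair a (pair b v)))

/-- Code of the fact `A_a^i(k,·)(u) = v`. -/
def iterFact (k a i u v : arith.Term (Fin n)) : arith.Term (Fin n) :=
  pair (S 0) (pair k (pair a (pair i (pair u v))))

/-- The recursion clauses of the functions `A_a(k,b)` and `A_a^i(k,·)(u)`. -/
def ackStep : arith.Formula (Fin 4) :=
  -- `A_0(k,0) = 1`
  exLast 1 (eq (x 0) (ackFact (x 4) 0 0 (S 0))) ⊔
  -- `A_0(k,b+1) = A_0(k,b) * k`
  exLast 3 (eq (x 0) (ackFact (x 4) 0 (S (x 5)) (x 6 * x 4)) ⊓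
    known (n := 3) (ackFact (x 4) 0 (x 5) (x 6))) ⊔
  -- `A_{a+1}(k,0) = A_a^k(k,·)(0)`
  exLast 3 (eq (x 0) (ackFact (x 4) (S (x 5)) 0 (x 6)) ⊓
    known (n := 3) (iterFact (x 4) (x 5) (x 4) 0 (x 6))) ⊔
  -- `A_{a+1}(k,b+1) = A_a^k(k,·)(A_{a+1}(k,b))`
  exLast 5 (eq (x 0) (ackFact (x 4) (S (x 5)) (S (x 6)) (x 7)) ⊓
    known (n := 5) (ackFact (x 4) (S (x 5)) (x 6) (x 8)) ⊓
    known (n := 5) (iterFact (x 4) (x 5) (x 4) (x 8) (x 7))) ⊔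
  -- `A_a^0(k,·)(u) = u`
  exLast 3 (eq (x 0) (iterFact (x 4) (x 5) 0 (x 6) (x 6))) ⊔
  -- `A_a^{i+1}(k,·)(u) = A_a(k, A_a^i(k,·)(u))`
  exLast 6 (eq (x 0) (iterFact (x 4) (x 5) (S (x 6)) (x 7) (x 8)) ⊓
    known (n := 6) (iterFact (x 4) (x 5) (x 6) (x 7) (x 9)) ⊓
    known (n := 6) (ackFact (x 4) (x 5) (x 9) (x 8)))

/-- `A_a(k,b) = v` -/
def ackF (k a b v : arith.Term (Fin n)) : arith.Formula (Fin n) :=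
  derivable ackStep (ackFact k a b v)

/-- `c` has the `k`-normal form `A_a(k,b) * m + r`. -/
def isNFF (k c a b m r : arith.Term (Fin n)) : arith.Formula (Fin n) :=
  BoundedFormula.subst (
    exLast 4 (
      ackF (x 0) (x 2) (x 3) (x 6) ⊓
      ackF (x 0) (x 2) 0 (x 7) ⊓
      ackF (x 0) (S (x 2)) 0 (x 8) ⊓
      ackF (x 0) (x 2) (S (x 3)) (x 9) ⊓
      eq (x 1) (x 6 * x 4 + x 5) ⊓
      le (x 7) (x 1) ⊓ lt (x 1) (x 8) ⊓ le (x 6) (x 1) ⊓ lt (x 1) (x 9) ⊓ lt (x 5) (x 6)) :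
    arith.Formula (Fin 6)) ![k, c, a, b, m, r]

/-- Code of the fact `c[k ← k+1] = v`. -/
def baseChangeFact (k c v : arith.Term (Fin n)) : arith.Term (Fin n) := pair k (pair c v)

/-- The recursion clauses of the base change. -/
def baseChangeStep : arith.Formula (Fin 4) :=
  -- `0[k ← k+1] = 0`
  exLast 1 (eq (x 0) (baseChangeFact (x 4) 0 0)) ⊔
  -- `c[k ← k+1] = A_a(k+1, b[k ← k+1]) * m + r[k ← k+1]`, with the variables
  -- `k, c, a, b, m, r, b[k ← k+1], r[k ← k+1], A_a(k+1, b[k ← k+1])` in this order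
  exLast 9 (eq (x 0) (baseChangeFact (x 4) (x 5) (x 12 * x 8 + x 11)) ⊓
    isNFF (x 4) (x 5) (x 6) (x 7) (x 8) (x 9) ⊓
    known (n := 9) (baseChangeFact (x 4) (x 7) (x 10)) ⊓
    known (n := 9) (baseChangeFact (x 4) (x 9) (x 11)) ⊓
    ackF (S (x 4)) (x 6) (x 10) (x 12))

/-- `c[k ← k+1] = v` -/
def baseChangeF (k c v : arith.Term (Fin n)) : arith.Formula (Fin n) :=
  derivable baseChangeStep (baseChangeFact k c v)

/-- Code of the fact `b_k(ℓ) = v`. -/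
def goodsteinFact (ℓ k v : arith.Term (Fin n)) : arith.Term (Fin n) := pair ℓ (pair k v)

/-- The recursion clauses of the Goodstein process. -/
def goodsteinStep : arith.Formula (Fin 4) :=
  -- `b_0(ℓ) = ℓ`
  exLast 1 (eq (x 0) (goodsteinFact (x 4) 0 (x 4))) ⊔
  -- if `b_k(ℓ) = 0`, then `b_{k+1}(ℓ) = 0`
  exLast 2 (eq (x 0) (goodsteinFact (x 4) (S (x 5)) 0) ⊓
    known (n := 2) (goodsteinFact (x 4) (x 5) 0)) ⊔
  -- if `b_k(ℓ) = u > 0`, then `b_{k+1}(ℓ) + 1 = u[k+2 ← k+3]`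
  exLast 4 (eq (x 0) (goodsteinFact (x 4) (S (x 5)) (x 7)) ⊓
    known (n := 4) (goodsteinFact (x 4) (x 5) (x 6)) ⊓
    (eq (x 6) 0).not ⊓
    baseChangeF (S (S (x 5))) (x 6) (S (x 7)))

/-- `b_k(ℓ) = v` -/
def goodsteinF (ℓ k v : arith.Term (Fin n)) : arith.Formula (Fin n) :=
  derivable goodsteinStep (goodsteinFact ℓ k v)

/-- The arithmetical sentence `∀ ℓ ∃ k b_k(ℓ) = 0`. -/
def goodsteinSentence : arith.Sentence :=
  univClosure (n := 1) (exLast 1 (goodsteinF (x 0) (x 1) 0))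

end Goodstein

/-! ### Ordinal notations below `ε_ω` and transfinite induction

The notations are `0` and `[a, e, r]` with `a` a number and `e`, `r` notations. They denote ordinals
by `|0| = 0`, `|[0, e, r]| = ω ^ |e| + |r|` and `|[a+1, e, r]| = ω ^ (ε_a + |e|) + |r|`. In a normal
form, `|e| < ε_a`, so that `ω ^ |e|`, respectively `ω ^ (ε_a' + |e|)` with `a = a' + 1`, ranges over
all additively indecomposable ordinals below `ε_0`, respectively from `ε_a'` on and below `ε_a`; and
the leading additively indecomposable term of `|r|` is at most that of `|[a, e, r]|`. So the
normal forms denote every ordinal below `ε_ω` exactly once (Cantor normal form), and ordinals are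
compared by comparing normal forms lexicographically. -/

section TransfiniteInduction

variable {n : ℕ}

/-- The code of `[a, e, r]`; the code of the notation `0` is `0`. -/
def oadd (a e r : arith.Term (Fin n)) : arith.Term (Fin n) := S (pair a (pair e r))

/-- Clauses for `t < s` on ordinal notations, this fact being coded by `⟨t, s⟩`. -/
def ordLtStep : arith.Formula (Fin 4) :=
  exLast 3 (eq (x 0) (pair 0 (oadd (x 4) (x 5) (x 6)))) ⊔
  exLast 6 (eq (x 0) (pair (oadd (x 4) (x 5) (x 6)) (oadd (x 7) (x 8) (x 9))) ⊓
    (lt (x 4) (x 7) ⊔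
     (eq (x 4) (x 7) ⊓ known (n := 6) (pair (x 5) (x 8))) ⊔
     (eq (x 4) (x 7) ⊓ eq (x 5) (x 8) ⊓ known (n := 6) (pair (x 6) (x 9)))))

/-- `t < s` as ordinal notations -/
def ordLt (t s : arith.Term (Fin n)) : arith.Formula (Fin n) := derivable ordLtStep (pair t s)

/-- Clauses for being a notation in normal form. -/
def ordStep : arith.Formula (Fin 4) :=
  eq (x 0) 0 ⊔
  exLast 3 (eq (x 0) (oadd (x 4) (x 5) (x 6)) ⊓
    known (n := 3) (x 5) ⊓ known (n := 3) (x 6) ⊓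
    (eq (x 5) 0 ⊔
      exLast 3 (eq (x 5) (oadd (x 7) (x 8) (x 9)) ⊓ le (x 7) (x 4))) ⊓
    (eq (x 6) 0 ⊔
      exLast 3 (eq (x 6) (oadd (x 7) (x 8) (x 9)) ⊓
        (lt (x 7) (x 4) ⊔ (eq (x 7) (x 4) ⊓ (eq (x 8) (x 5) ⊔ ordLt (x 8) (x 5)))))))

/-- `t` is a notation in normal form of an ordinal below `ε_ω`. -/
def isOrd (t : arith.Term (Fin n)) : arith.Formula (Fin n) := derivable ordStep t

/-- Transfinite induction along all ordinals below `ε_ω` for `φ(p₀,…,pₙ₋₁,y)` in the variable `y`: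
`∀ p, (∀ y ∈ Ord, (∀ z ∈ Ord, z < y → φ(p,z)) → φ(p,y)) → ∀ y ∈ Ord, φ(p,y)`. -/
def transfiniteInduction (φ : arith.Formula (Fin (n + 1))) : arith.Sentence :=
  univClosure
    ((allLast 1 ((isOrd (x (Fin.last n))).imp
      ((allLast 1 ((isOrd (x (Fin.last (n + 1)))).imp
        ((ordLt (x (Fin.last (n + 1))) (x (Fin.last n).castSucc)).imp
          (φ.subst (Fin.snoc (fun i => x i.castSucc.castSucc) (x (Fin.last (n + 1)))))))).imp
        φ))).imp
      (allLast 1 ((isOrd (x (Fin.last n))).imp φ)))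

/-- The theory `PA + TI(ε_ω)`. -/
def PA_TI_epsilon_omega : arith.Theory :=
  {σ | PA σ} ∪ {σ | ∃ (n : ℕ) (φ : arith.Formula (Fin (n + 1))), σ = transfiniteInduction φ}

end TransfiniteInduction

end PeanoArithmetic

/-! ## The completeness theorem -/

namespace FirstOrder.Language

universe u v

variable {L : Language.{u, v}} {α β γ : Type}

/-! ### Substitution, instantiation and fresh variables -/

namespace BoundedFormula

/-! Termination. Write `c` in base `k` by repeatedly splitting off the leading term, `c = A_a(k,b) +
d`, and replace `A_a(k,b)` by a power of `ω` whose index is `a` and whose exponent is the ordinal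
already assigned to `b`. This gives the notation `Ov j c = [a, Ov j b, Ov j d]` with `k = j + 2`.
Normal forms compare lexicographically, exactly as notations do, so the assignment is strictly
increasing (`ordLt_Ov`) and its values are in normal form (`isOrd_Ov`). The base change sends a
`k`-normal form to a `(k+1)`-normal form with the same `a` and `m` (`NF.bc`), so it leaves the
ordinal unchanged (`Ov_Bc`). Subtracting one then lowers the ordinal, and transfinite induction
yields a zero (`exists_gsR_zero`).

The combinatorial core is `bcGood`: the base change is strictly increasing and respects the bounds
that define normal forms. The critical estimate is `BcGood.lt_A_succ_right`. There the coefficient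
`m`, which may be huge when `a > 0`, is absorbed by the one additional iteration available in base
`k + 1`, because `A_a(k+1,·)` dominates squaring.

Provability. By the completeness theorem (`Theory.Proves.of_forall_models`) it is enough to run this
argument inside an arbitrary model of the theory. Every model of the Peano axioms is an ordered
semiring with induction for predicates definable with parameters. Finite sets are coded there by a
variant of Gödel's beta function (`exists_code`), and a recursive definition becomes membership in a
coded set closed under justification (`Der`), which satisfies the expected recursion equations
(`IsFinitary.der_iff`). Totality and uniqueness of values are proved by induction in the model. The
`realize` lemmas identify the official formulas with these notions, so the induction schema of the
theory supplies the transfinite induction that is needed.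

Truth in `ℕ`. The natural numbers are one of these models. Transfinite induction holds in them
because the notations evaluate monotonically to actual ordinals (`ONote.eval_lt_and_eval_lt`), and
the functions of the model agree with the recursively defined ones. -/

theorem subst_subst {n : ℕ} (φ : L.BoundedFormula α n) (f : α → L.Term β) (g : β → L.Term γ) :
    (φ.subst f).subst g = φ.subst fun a => (f a).subst g := by
  have term : ∀ {n : ℕ} (t : L.Term (α ⊕ Fin n)),
      (t.subst (Sum.elim (Term.relabel Sum.inl ∘ f) (Term.var ∘ Sum.inr))).subst
        (Sum.elim (Term.relabel Sum.inl ∘ g) (Term.var ∘ Sum.inr)) =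
      t.subst (Sum.elim (Term.relabel Sum.inl ∘ fun a => (f a).subst g)
        (Term.var ∘ Sum.inr)) := by
    intro n t
    induction t with
    | var a =>
      rcases a with a | i
      · simp only [Term.subst, Sum.elim_inl, Function.comp_apply]
        generalize f a = s
        induction s with
        | var b => rfl
        | func F ts ih => simp only [Term.relabel, Term.subst, ih]
      · rfl
    | func F ts ih => simp only [Term.subst, ih]
  unfold subst
  induction φ with
  | falsum => rfl
  | equal => simp [mapTermRel, term]
  | rel => simp [mapTermRel, term]
  | imp _ _ ih1 ih2 => simp [mapTermRel, ih1, ih2]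
  | all _ ih => simp [mapTermRel, ih]

theorem inst_subst {n : ℕ} (φ : L.BoundedFormula α (n + 1)) (t : L.Term α) (f : α → L.Term β) :
    (φ.inst t).subst f = (φ.subst f).inst (t.subst f) := by
  have term : ∀ {n : ℕ} (s : L.Term (α ⊕ Fin (n + 1))),
      (inst.instTerm t s).subst (Sum.elim (Term.relabel Sum.inl ∘ f) (Term.var ∘ Sum.inr)) =
      inst.instTerm (t.subst f)
        (s.subst (Sum.elim (Term.relabel Sum.inl ∘ f) (Term.var ∘ Sum.inr))) := by
    intro n s
    unfold inst.instTerm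
    induction s with
    | var a =>
      rcases a with a | i
      · simp only [Term.subst, Sum.elim_inl, Function.comp_apply]
        generalize f a = s
        induction s with
        | var b => rfl
        | func F ts ih => simp only [Term.relabel, Term.subst]; congr 1; funext i; exact ih i
      · refine Fin.cases ?_ (fun i => ?_) i
        · simp only [Term.subst, Sum.elim_inr, Function.comp_apply, Fin.cases_zero]
          clear φ
          induction t with
          | var b => rfl
          | func F ts ih => simp only [Term.relabel, Term.subst, ih]
        · rfl
    | func F ts ih => simp only [Term.subst, ih]
  -- A structural induction on `φ` needs the number of bound variables to be a variable; the shape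
  -- `n + 1` is therefore carried as an equation.
  suffices h : ∀ {m : ℕ} (φ : L.BoundedFormula α m) (n : ℕ) (hm : m = n + 1),
      ((hm ▸ φ : L.BoundedFormula α (n + 1)).inst t).subst f =
        ((hm ▸ φ : L.BoundedFormula α (n + 1)).subst f).inst (t.subst f) from h φ n rfl
  clear φ n
  intro m φ
  induction φ with
  | falsum => rintro n rfl; simp only [inst, subst, mapTermRel]
  | equal => rintro n rfl; simp only [inst, subst, mapTermRel, term]
  | rel => rintro n rfl; simp only [inst, subst, mapTermRel, term, id]
  | imp _ _ ih1 ih2 =>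
    rintro n rfl
    have h1 := ih1 n rfl
    have h2 := ih2 n rfl
    simp only [subst] at h1 h2
    simp only [inst, subst, mapTermRel, h1, h2]
  | all _ ih =>
    rintro n rfl
    have h1 := ih (n + 1) rfl
    simp only [subst] at h1
    simp only [inst, subst, mapTermRel, h1, id]

/-- The lift of `f` past a fresh variable fixes `0` and shifts the values of `f`. This commutation
is what makes `allI` stable under substitution. -/
theorem shift_subst {n : ℕ} (φ : L.BoundedFormula ℕ n) (f : ℕ → L.Term ℕ) :
    φ.shift.subst (fun i => Nat.casesOn i (Term.var 0) fun i =>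
      (f i).subst fun j => Term.var (j + 1)) = (φ.subst f).shift := by
  simp only [shift, subst_subst]
  rfl

theorem equal_subst (t s : L.Term α) (f : α → L.Term β) :
    (t.equal s : L.Formula α).subst f = (t.subst f).equal (s.subst f) := by
  have term : ∀ t : L.Term α, (t.relabel Sum.inl : L.Term (α ⊕ Fin 0)).subst
      (Sum.elim (Term.relabel Sum.inl ∘ f) (Term.var ∘ Sum.inr)) =
      (t.subst f).relabel Sum.inl := by
    intro t
    induction t with
    | var a => rfl
    | func F ts ih => simp only [Term.relabel, Term.subst, ih]
  simp only [Term.equal, Term.bdEqual, subst, mapTermRel, term]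

/-- `φ` depends only on its free variables below `N`. -/
def FreeBelow (N : ℕ) {n : ℕ} (φ : L.BoundedFormula ℕ n) : Prop :=
  ∀ f g : ℕ → L.Term ℕ, (∀ i < N, f i = g i) → φ.subst f = φ.subst g

theorem FreeBelow.mono {N N' n : ℕ} (h : N ≤ N') {φ : L.BoundedFormula ℕ n} (hφ : φ.FreeBelow N) :
    φ.FreeBelow N' := fun f g hfg => hφ f g fun i hi => hfg i (hi.trans_le h)

theorem FreeBelow.imp {N n : ℕ} {φ ψ : L.BoundedFormula ℕ n} (hφ : φ.FreeBelow N)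
    (hψ : ψ.FreeBelow N) : (φ.imp ψ).FreeBelow N := fun f g hfg => by
  have h1 := hφ f g hfg
  have h2 := hψ f g hfg
  simp only [subst, mapTermRel] at h1 h2 ⊢
  rw [h1, h2]

theorem FreeBelow.not {N n : ℕ} {φ : L.BoundedFormula ℕ n} (hφ : φ.FreeBelow N) :
    φ.not.FreeBelow N := hφ.imp fun _ _ _ => rfl

theorem FreeBelow.of_all {N n : ℕ} {φ : L.BoundedFormula ℕ (n + 1)} (hφ : φ.all.FreeBelow N) :
    φ.FreeBelow N := fun f g hfg => by
  have h := hφ f g hfg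
  simpa only [subst, mapTermRel, id, all.injEq] using h

theorem FreeBelow.inst_var {N n m : ℕ} {φ : L.BoundedFormula ℕ (n + 1)} (hφ : φ.FreeBelow N)
    (hm : m < N) : (φ.inst (Term.var m)).FreeBelow N := fun f g hfg => by
  rw [inst_subst, inst_subst, hφ f g hfg]
  simp only [Term.subst, hfg m hm]

/-- Freshness is expressed through the effect of substitutions, so no set of free variables is
computed; a bound exists because a formula contains only finitely many variables. -/
theorem exists_freeBelow {n : ℕ} (φ : L.BoundedFormula ℕ n) : ∃ N, φ.FreeBelow N := by
  have term : ∀ {n : ℕ} (t : L.Term (ℕ ⊕ Fin n)), ∃ N, ∀ f g : ℕ → L.Term ℕ,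
      (∀ i < N, f i = g i) →
      t.subst (Sum.elim (Term.relabel (Sum.inl : ℕ → ℕ ⊕ Fin n) ∘ f) (Term.var ∘ Sum.inr)) =
      t.subst (Sum.elim (Term.relabel Sum.inl ∘ g) (Term.var ∘ Sum.inr)) := by
    intro n t
    induction t with
    | var a =>
      rcases a with a | i
      · refine ⟨a + 1, fun f g h => ?_⟩
        simp only [Term.subst, Sum.elim_inl, Function.comp_apply, h a (Nat.lt_succ_self a)]
      · exact ⟨0, fun f g h => rfl⟩
    | func F ts ih =>
      choose N hN using ih
      refine ⟨Finset.univ.sup N, fun f g h => ?_⟩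
      simp only [Term.subst]
      congr 1
      funext i
      exact hN i f g fun j hj => h j (hj.trans_le (Finset.le_sup (Finset.mem_univ i)))
  induction φ with
  | falsum => exact ⟨0, fun f g h => rfl⟩
  | equal t s =>
    obtain ⟨N, hN⟩ := term t
    obtain ⟨K, hK⟩ := term s
    refine ⟨max N K, fun f g h => ?_⟩
    simp only [subst, mapTermRel]
    rw [hN f g fun i hi => h i (lt_max_of_lt_left hi),
      hK f g fun i hi => h i (lt_max_of_lt_right hi)]
  | rel R ts =>
    choose N hN using fun i => term (ts i)
    refine ⟨Finset.univ.sup N, fun f g h => ?_⟩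
    simp only [subst, mapTermRel]
    congr 1
    funext i
    exact hN i f g fun j hj => h j (hj.trans_le (Finset.le_sup (Finset.mem_univ i)))
  | imp _ _ ih1 ih2 =>
    obtain ⟨N, hN⟩ := ih1
    obtain ⟨K, hK⟩ := ih2
    exact ⟨max N K, (hN.mono (le_max_left _ _)).imp (hK.mono (le_max_right _ _))⟩
  | all _ ih =>
    obtain ⟨N, hN⟩ := ih
    refine ⟨N, fun f g h => ?_⟩
    have := hN f g h
    simp only [subst, mapTermRel, id] at this ⊢
    rw [this]

/-- For a theory all variables are fresh, so the variables themselves can serve as Henkin constants.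
-/
theorem freeBelow_zero_subst_empty (σ : L.Sentence) :
    (σ.subst (β := ℕ) Empty.elim).FreeBelow 0 := fun f g _ => by
  rw [subst_subst, subst_subst]
  congr 1
  funext i
  exact i.elim

theorem realize_inst {M : Type*} [L.Structure M] {n : ℕ} (φ : L.BoundedFormula α (n + 1))
    (t : L.Term α) (v : α → M) (xs : Fin n → M) :
    (φ.inst t).Realize v xs ↔ φ.Realize v (Fin.cons (t.realize v) xs) := by
  have term : ∀ {n : ℕ} (s : L.Term (α ⊕ Fin (n + 1))) (xs : Fin n → M),
      (inst.instTerm t s).realize (Sum.elim v xs) =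
        s.realize (Sum.elim v (Fin.cons (t.realize v) xs)) := by
    intro n s xs
    unfold inst.instTerm
    rw [Term.realize_subst]
    congr 1
    funext a
    rcases a with a | i
    · rfl
    · refine Fin.cases ?_ (fun i => ?_) i
      · simp only [Sum.elim_inr, Fin.cases_zero, Term.realize_relabel, Fin.cons_zero]
        rfl
      · rfl
  suffices h : ∀ {m : ℕ} (φ : L.BoundedFormula α m) (n : ℕ) (hm : m = n + 1) (xs : Fin n → M),
      ((hm ▸ φ : L.BoundedFormula α (n + 1)).inst t).Realize v xs ↔
        (hm ▸ φ : L.BoundedFormula α (n + 1)).Realize v (Fin.cons (t.realize v) xs) from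
    h φ n rfl xs
  clear φ xs n
  intro m φ
  induction φ with
  | falsum => rintro n rfl xs; simp only [inst, Realize]
  | equal => rintro n rfl xs; simp only [inst, Realize, term]
  | rel => rintro n rfl xs; simp only [inst, Realize, term]
  | imp _ _ ih1 ih2 =>
    rintro n rfl xs
    have h1 := ih1 n rfl xs
    have h2 := ih2 n rfl xs
    simp only at h1 h2
    simp only [inst, Realize, h1, h2]
  | all _ ih =>
    rintro n rfl xs
    simp only [inst, Realize]
    refine forall_congr' fun a => ?_
    have h1 := ih (n + 1) rfl (Fin.snoc xs a)
    simp only at h1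
    -- Quantifiers extend a valuation at its end, instantiation acts at its front; the two
    -- extensions commute.
    rw [h1, Fin.cons_snoc_eq_snoc_cons]

/-- The number of logical symbols of a formula. -/
def size : ∀ {n : ℕ}, L.BoundedFormula α n → ℕ
  | _, .falsum => 0
  | _, .equal _ _ => 0
  | _, .rel _ _ => 0
  | _, .imp φ ψ => φ.size + ψ.size + 1
  | _, .all φ => φ.size + 1

/-- An instance of `φ` is not a subformula of `φ.all`. The truth lemma recurses on this size
instead, where the instance counts as smaller. -/
theorem size_inst {n : ℕ} (φ : L.BoundedFormula α (n + 1)) (t : L.Term α) :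
    (φ.inst t).size = φ.size := by
  suffices h : ∀ {m : ℕ} (φ : L.BoundedFormula α m) (n : ℕ) (hm : m = n + 1),
      ((hm ▸ φ : L.BoundedFormula α (n + 1)).inst t).size = φ.size from h φ n rfl
  clear φ n
  intro m φ
  induction φ with
  | falsum => rintro n rfl; simp only [inst, size]
  | equal => rintro n rfl; simp only [inst, size]
  | rel => rintro n rfl; simp only [inst, size]
  | imp _ _ ih1 ih2 =>
    rintro n rfl
    have h1 := ih1 n rfl
    have h2 := ih2 n rfl
    simp only at h1 h2
    simp only [inst, size, h1, h2]
  | all _ ih =>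
    rintro n rfl
    have h1 := ih (n + 1) rfl
    simp only at h1
    simp only [inst, size, h1]

end BoundedFormula

open BoundedFormula

/-! ### Structural properties of derivability -/

namespace Derives

theorem weaken {Γ Δ : Set (L.Formula ℕ)} {φ : L.Formula ℕ} (h : Derives Γ φ) (hs : Γ ⊆ Δ) :
    Derives Δ φ := by
  induction h generalizing Δ with
  | assume h => exact .assume (hs h)
  | impI _ ih => exact .impI (ih (Set.insert_subset_insert hs))
  | impE _ _ ih1 ih2 => exact .impE (ih1 hs) (ih2 hs)
  | byContra _ ih => exact .byContra (ih (Set.insert_subset_insert hs))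
  | allI _ ih => exact .allI (ih (Set.image_mono hs))
  | allE t _ ih => exact .allE t (ih hs)
  | eqRefl t => exact .eqRefl t
  | eqSubst _ _ ih1 ih2 => exact .eqSubst (ih1 hs) (ih2 hs)

/-- For `allI` the induction hypothesis is applied to the lifted substitution of `shift_subst`,
which is why `f` is generalized. The result is used to rename a fresh variable. -/
theorem subst {Γ : Set (L.Formula ℕ)} {φ : L.Formula ℕ} (h : Derives Γ φ) (f : ℕ → L.Term ℕ) :
    Derives ((fun ψ : L.Formula ℕ => ψ.subst f) '' Γ) (φ.subst f) := by
  induction h generalizing f with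
  | assume h => exact .assume (Set.mem_image_of_mem _ h)
  | impI _ ih =>
    have h := ih f
    rw [Set.image_insert_eq] at h
    exact .impI h
  | impE _ _ ih1 ih2 => exact .impE (ih1 f) (ih2 f)
  | byContra _ ih =>
    have h := ih f
    rw [Set.image_insert_eq] at h
    exact .byContra h
  | @allI Γ φ _ ih =>
    have h := ih fun i => Nat.casesOn i (Term.var 0) fun i =>
      (f i).subst fun j => Term.var (j + 1)
    rw [inst_subst, shift_subst, Set.image_image] at h
    have hs : (fun ψ : L.Formula ℕ => ψ.shift.subst fun i => Nat.casesOn i (Term.var 0) fun i =>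
        (f i).subst fun j => Term.var (j + 1)) = fun ψ => (ψ.subst f).shift :=
      funext fun ψ => shift_subst ψ f
    rw [hs, ← Set.image_image BoundedFormula.shift fun ψ : L.Formula ℕ => ψ.subst f] at h
    exact .allI h
  | allE t _ ih =>
    rw [inst_subst]
    exact .allE _ (ih f)
  | eqRefl t => rw [equal_subst]; exact .eqRefl _
  | eqSubst _ _ ih1 ih2 =>
    have h1 := ih1 f
    have h2 := ih2 f
    rw [equal_subst] at h1
    rw [inst_subst] at h2 ⊢
    exact .eqSubst h1 h2

/-- Generalization over a fresh variable. -/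
theorem all_of_inst_var {Γ : Set (L.Formula ℕ)} {φ : L.BoundedFormula ℕ 1} {N : ℕ}
    (hΓ : ∀ ψ ∈ Γ, ψ.FreeBelow N) (hφ : φ.FreeBelow N) (h : Derives Γ (φ.inst (Term.var N))) :
    Derives Γ φ.all := by
  -- This substitution turns `N` into `0` and acts as `shift` on everything that is free below `N`.
  have h1 := h.subst fun i => if i = N then Term.var 0 else Term.var (i + 1)
  have hf : ∀ i < N, (if i = N then Term.var 0 else Term.var (i + 1) : L.Term ℕ) =
      Term.var (i + 1) := fun i hi => if_neg hi.ne
  rw [inst_subst, hφ _ _ hf] at h1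
  simp only [Term.subst, if_true] at h1
  refine .allI (h1.weaken ?_)
  rintro _ ⟨ψ, hψ, rfl⟩
  exact ⟨ψ, hψ, (hΓ ψ hψ _ _ hf).symm⟩

theorem of_bot {Γ : Set (L.Formula ℕ)} (h : Derives Γ ⊥) (φ : L.Formula ℕ) : Derives Γ φ :=
  .byContra (h.weaken (Set.subset_insert _ _))

theorem cut {Γ : Set (L.Formula ℕ)} {φ ψ : L.Formula ℕ} (h : Derives Γ φ)
    (h' : Derives (insert φ Γ) ψ) : Derives Γ ψ := (impI h').impE h

/-- A derivation uses finitely many assumptions, and these lie together in one member of an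
increasing chain. Chains are convenient here because `insert` and images under `shift`, which the
rules apply to the context, act on them memberwise. -/
theorem exists_of_iUnion {Γ : ℕ → Set (L.Formula ℕ)} (hΓ : Monotone Γ) {φ : L.Formula ℕ}
    (h : Derives (⋃ n, Γ n) φ) : ∃ n, Derives (Γ n) φ := by
  generalize hΔ : ⋃ n, Γ n = Δ at h
  induction h generalizing Γ with
  | assume h =>
    subst hΔ
    obtain ⟨n, hn⟩ := Set.mem_iUnion.1 h
    exact ⟨n, .assume hn⟩
  | impI _ ih =>
    subst hΔ
    obtain ⟨n, hn⟩ := ih (fun m n h => Set.insert_subset_insert (hΓ h)) (Set.insert_iUnion _ _).symm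
    exact ⟨n, .impI hn⟩
  | impE _ _ ih1 ih2 =>
    obtain ⟨n, hn⟩ := ih1 hΓ hΔ
    obtain ⟨m, hm⟩ := ih2 hΓ hΔ
    exact ⟨max n m, .impE (hn.weaken (hΓ (le_max_left _ _))) (hm.weaken (hΓ (le_max_right _ _)))⟩
  | byContra _ ih =>
    subst hΔ
    obtain ⟨n, hn⟩ := ih (fun m n h => Set.insert_subset_insert (hΓ h)) (Set.insert_iUnion _ _).symm
    exact ⟨n, .byContra hn⟩
  | allI _ ih =>
    subst hΔ
    obtain ⟨n, hn⟩ := ih (fun m n h => Set.image_mono (hΓ h)) Set.image_iUnion.symm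
    exact ⟨n, .allI hn⟩
  | allE t _ ih =>
    obtain ⟨n, hn⟩ := ih hΓ hΔ
    exact ⟨n, .allE t hn⟩
  | eqRefl t => exact ⟨0, .eqRefl t⟩
  | eqSubst _ _ ih1 ih2 =>
    obtain ⟨n, hn⟩ := ih1 hΓ hΔ
    obtain ⟨m, hm⟩ := ih2 hΓ hΔ
    exact ⟨max n m, .eqSubst (hn.weaken (hΓ (le_max_left _ _)))
      (hm.weaken (hΓ (le_max_right _ _)))⟩

end Derives

/-! ### Extension to a Henkin set -/

/-- A consistent set of formulas that omits infinitely many variables. -/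
structure HenkinExtendable (Γ : Set (L.Formula ℕ)) : Prop where
  consistent : ¬ Derives Γ ⊥
  exists_freeBelow : ∃ N, ∀ ψ ∈ Γ, ψ.FreeBelow N

/-- One step of the Lindenbaum–Henkin construction. When `∀ ψ` is refuted, the negation of `ψ(N)` is
added for a fresh variable `N`. If that were inconsistent, `ψ(N)` would follow, hence `∀ ψ` by
generalization, against the consistency of its negation. -/
theorem HenkinExtendable.exists_extension {Γ : Set (L.Formula ℕ)} (hΓ : HenkinExtendable Γ)
    (φ : L.Formula ℕ) : ∃ Δ, Γ ⊆ Δ ∧ HenkinExtendable Δ ∧ (φ ∈ Δ ∨ φ.not ∈ Δ ∧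
      ∀ ψ : L.BoundedFormula ℕ 1, φ = ψ.all → ∃ t, (ψ.inst t).not ∈ Δ) := by
  obtain ⟨N₁, hN₁⟩ := hΓ.exists_freeBelow
  obtain ⟨N₂, hN₂⟩ := BoundedFormula.exists_freeBelow φ
  obtain ⟨N, hN, hφN⟩ : ∃ N, (∀ ψ ∈ Γ, ψ.FreeBelow N) ∧ φ.FreeBelow N :=
    ⟨max N₁ N₂, fun ψ hψ => (hN₁ ψ hψ).mono (le_max_left _ _), hN₂.mono (le_max_right _ _)⟩
  have hins : ∀ {Δ : Set (L.Formula ℕ)} {χ : L.Formula ℕ} {K : ℕ}, (∀ ψ ∈ Δ, ψ.FreeBelow K) →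
      χ.FreeBelow K → ∀ ψ ∈ insert χ Δ, ψ.FreeBelow K := by
    rintro Δ χ K hΔ hχ ψ (rfl | h)
    exacts [hχ, hΔ _ h]
  by_cases hc : Derives (insert φ Γ) ⊥
  · have hnot : Derives Γ φ.not := .impI hc
    have hc' : ¬ Derives (insert φ.not Γ) ⊥ := fun h => hΓ.consistent (hnot.cut h)
    by_cases hall : ∃ ψ : L.BoundedFormula ℕ 1, φ = ψ.all
    · obtain ⟨ψ, rfl⟩ := hall
      refine ⟨insert (ψ.inst (Term.var N)).not (insert ψ.all.not Γ),
        (Set.subset_insert _ _).trans (Set.subset_insert _ _), ⟨fun h => hc' ?_, N + 1, ?_⟩,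
        Or.inr ⟨Set.mem_insert_of_mem _ (Set.mem_insert _ _), ?_⟩⟩
      · have h1 : Derives (insert ψ.all.not Γ) ψ.all :=
          Derives.all_of_inst_var (hins hN hφN.not) hφN.of_all (.byContra h)
        exact (Derives.assume (Set.mem_insert _ _)).impE h1
      · have h1 := Nat.le_succ N
        exact hins (hins (fun χ hχ => (hN χ hχ).mono h1) (hφN.not.mono h1))
          ((hφN.of_all.mono h1).inst_var (Nat.lt_succ_self N)).not
      · rintro ψ' h
        obtain rfl : ψ = ψ' := by simpa using h
        exact ⟨_, Set.mem_insert _ _⟩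
    · exact ⟨insert φ.not Γ, Set.subset_insert _ _, ⟨hc', N, hins hN hφN.not⟩,
        Or.inr ⟨Set.mem_insert _ _, fun ψ h => (hall ⟨ψ, h⟩).elim⟩⟩
  · exact ⟨insert φ Γ, Set.subset_insert _ _, ⟨hc, N, hins hN hφN⟩, Or.inl (Set.mem_insert _ _)⟩

/-- A maximal consistent set of formulas with witnesses. -/
structure IsHenkin (Γ : Set (L.Formula ℕ)) : Prop where
  consistent : ¬ Derives Γ ⊥
  mem_or_not_mem (φ : L.Formula ℕ) : φ ∈ Γ ∨ φ.not ∈ Γ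
  exists_witness (ψ : L.BoundedFormula ℕ 1) : ψ.all.not ∈ Γ → ∃ t, (ψ.inst t).not ∈ Γ

/-- The step is iterated along an enumeration of all formulas, stage `n + 1` deciding the `n`-th
one; the union is consistent because inconsistency would already show at some stage. -/
theorem HenkinExtendable.exists_isHenkin [Countable (L.Formula ℕ)] {Γ : Set (L.Formula ℕ)}
    (hΓ : HenkinExtendable Γ) : ∃ Δ, Γ ⊆ Δ ∧ IsHenkin Δ := by
  obtain ⟨e, he⟩ := exists_surjective_nat (L.Formula ℕ)
  choose! F hF1 hF2 hF3 using fun (Γ : Set (L.Formula ℕ)) (h : HenkinExtendable Γ) =>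
    h.exists_extension
  let s : ℕ → Set (L.Formula ℕ) := fun n => Nat.rec Γ (fun n Δ => F Δ (e n)) n
  have hs : ∀ n, HenkinExtendable (s n) := fun n => by
    induction n with
    | zero => exact hΓ
    | succ n ih => exact hF2 _ ih _
  have hmono : Monotone s := monotone_nat_of_le_succ fun n => hF1 _ (hs n) _
  have hcons : ¬ Derives (⋃ n, s n) ⊥ := fun h => by
    obtain ⟨n, hn⟩ := h.exists_of_iUnion hmono
    exact (hs n).consistent hn
  have hmem : ∀ {n φ}, φ ∈ s n → φ ∈ ⋃ n, s n := fun h => Set.mem_iUnion.2 ⟨_, h⟩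
  refine ⟨⋃ n, s n, Set.subset_iUnion s 0, hcons, fun φ => ?_, fun ψ hψ => ?_⟩
  · obtain ⟨n, rfl⟩ := he φ
    rcases hF3 _ (hs n) (e n) with h | ⟨h, -⟩
    · exact Or.inl (hmem (n := n + 1) h)
    · exact Or.inr (hmem (n := n + 1) h)
  · obtain ⟨n, hn⟩ := he ψ.all
    rcases hF3 _ (hs n) (e n) with h | ⟨-, h⟩
    · refine (hcons (.impE (.assume hψ) (.assume ?_))).elim
      rw [← hn]
      exact hmem (n := n + 1) h
    · obtain ⟨t, ht⟩ := h ψ hn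
      exact ⟨t, hmem (n := n + 1) ht⟩

/-! ### The term model of a Henkin set -/

theorem instTerm_relabel (t s : L.Term ℕ) :
    inst.instTerm t (s.relabel Sum.inl : L.Term (ℕ ⊕ Fin 1)) = s.relabel Sum.inl := by
  unfold inst.instTerm
  induction s with
  | var a => rfl
  | func F ts ih => simp only [Term.relabel, Term.subst, ih]

namespace IsHenkin

variable {Γ : Set (L.Formula ℕ)}

theorem mem_iff_derives (hΓ : IsHenkin Γ) {φ : L.Formula ℕ} : φ ∈ Γ ↔ Derives Γ φ := by
  refine ⟨.assume, fun h => (hΓ.mem_or_not_mem φ).resolve_right fun h' => hΓ.consistent ?_⟩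
  exact (Derives.assume h').impE h

theorem not_mem_iff (hΓ : IsHenkin Γ) {φ : L.Formula ℕ} : φ.not ∈ Γ ↔ φ ∉ Γ :=
  ⟨fun h h' => hΓ.consistent ((Derives.assume h).impE (.assume h')),
    fun h => (hΓ.mem_or_not_mem φ).resolve_left h⟩

/-- `eqSubst` fills a single hole, so the arguments are exchanged one after the other: after `j`
steps the first `j` arguments have been replaced. -/
theorem func_congr {n : ℕ} {Γ : Set (L.Formula ℕ)} (F : L.Functions n) {ts ss : Fin n → L.Term ℕ}
    (h : ∀ i, Derives Γ ((ts i).equal (ss i))) :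
    Derives Γ ((Term.func F ts).equal (Term.func F ss)) := by
  suffices H : ∀ j : ℕ, Derives Γ ((Term.func F ts).equal
      (Term.func F fun i => if (i : ℕ) < j then ss i else ts i)) by
    simpa using H n
  intro j
  induction j with
  | zero => simpa using Derives.eqRefl _
  | succ j ih =>
    by_cases hj : j < n
    -- The formula with its hole at argument `j`, the arguments before it being replaced already.
    · have key : ∀ t : L.Term ℕ, (((Term.func F ts).relabel Sum.inl).bdEqual
          (Term.func F fun i : Fin n => if (i : ℕ) < j then (ss i).relabel Sum.inl
            else if (i : ℕ) = j then Term.var (Sum.inr 0) else (ts i).relabel Sum.inl) :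
            L.BoundedFormula ℕ 1).inst t = (Term.func F ts).equal
          (Term.func F fun i : Fin n => if (i : ℕ) < j then ss i
            else if (i : ℕ) = j then t else ts i) := by
        intro t
        have hr := instTerm_relabel t
        rw [Term.bdEqual, inst, hr, Term.equal, Term.bdEqual]
        congr 1
        unfold inst.instTerm at hr ⊢
        simp only [Term.subst, Term.relabel]
        congr 1
        funext i
        split_ifs
        · exact hr _
        · rfl
        · exact hr _
      have h1 : ∀ i : Fin n, (if (i : ℕ) < j then ss i else ts i) =
          if (i : ℕ) < j then ss i else if (i : ℕ) = j then ts ⟨j, hj⟩ else ts i := by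
        intro i
        split_ifs with h1 h2
        · rfl
        · congr 1; exact Fin.ext h2
        · rfl
      have h2 : ∀ i : Fin n, (if (i : ℕ) < j + 1 then ss i else ts i) =
          if (i : ℕ) < j then ss i else if (i : ℕ) = j then ss ⟨j, hj⟩ else ts i := by
        intro i
        split_ifs with h1 h2 h3 h4 h5
        · rfl
        · congr 1; exact Fin.ext h3
        · omega
        · omega
        · omega
        · rfl
      simp only [h1, ← key] at ih
      simp only [h2, ← key]
      exact .eqSubst (h ⟨j, hj⟩) ih
    · have : ∀ i : Fin n, (if (i : ℕ) < j + 1 then ss i else ts i) =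
          if (i : ℕ) < j then ss i else ts i := fun i => by
        rw [if_pos (by omega), if_pos (by omega)]
      simpa only [this] using ih

end IsHenkin

namespace Derives

theorem eqSymm {Γ : Set (L.Formula ℕ)} {t s : L.Term ℕ} (h : Derives Γ (t.equal s)) :
    Derives Γ (s.equal t) := by
  have key : ∀ r : L.Term ℕ, ((Term.var (Sum.inr 0)).bdEqual (t.relabel Sum.inl) :
      L.BoundedFormula ℕ 1).inst r = r.equal t := fun r => by
    rw [Term.bdEqual, inst, instTerm_relabel]
    rfl
  rw [← key]
  refine .eqSubst h ?_
  rw [key]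
  exact .eqRefl t

theorem eqTrans {Γ : Set (L.Formula ℕ)} {t s r : L.Term ℕ} (h : Derives Γ (t.equal s))
    (h' : Derives Γ (s.equal r)) : Derives Γ (t.equal r) := by
  have key : ∀ r : L.Term ℕ, ((t.relabel Sum.inl).bdEqual (Term.var (Sum.inr 0)) :
      L.BoundedFormula ℕ 1).inst r = t.equal r := fun r => by
    rw [Term.bdEqual, inst, instTerm_relabel]
    rfl
  rw [← key]
  refine .eqSubst h' ?_
  rw [key]
  exact h

end Derives

namespace IsHenkin

variable {Γ : Set (L.Formula ℕ)}

/-- Provable equality of terms. -/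
def termSetoid (Γ : Set (L.Formula ℕ)) : Setoid (L.Term ℕ) where
  r t s := Derives Γ (t.equal s)
  iseqv := ⟨.eqRefl, .eqSymm, .eqTrans⟩

/-- The universe of the term model. -/
def TermModel (Γ : Set (L.Formula ℕ)) : Type _ := Quotient (termSetoid Γ)

/-- The element of the term model denoted by a term. -/
def TermModel.mk (t : L.Term ℕ) : TermModel Γ := Quotient.mk (termSetoid Γ) t

/-- Representatives of the arguments are chosen; by `func_congr` the class of the value does not
depend on them. There are no relation symbols to interpret. -/
noncomputable instance [L.IsAlgebraic] : L.Structure (TermModel Γ) where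
  funMap F ts := Quotient.mk (termSetoid Γ) (Term.func F fun i => (ts i).out)
  RelMap R := isEmptyElim R

theorem realize_termModel [L.IsAlgebraic] (t : L.Term ℕ) :
    t.realize (fun i => TermModel.mk (Term.var i) : ℕ → TermModel Γ) =
      TermModel.mk t := by
  induction t with
  | var i => rfl
  | func F ts ih =>
    simp only [Term.realize, ih]
    exact Quotient.sound (func_congr F fun i =>
      Quotient.exact (Quotient.out_eq (TermModel.mk (ts i) : TermModel Γ)))

/-- The truth lemma. Maximality settles implication. For a universal formula outside `Γ` the witness
gives a false instance; conversely every element of the model is the class of a term, so `allE`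
covers all of them. -/
theorem realize_termModel_iff [L.IsAlgebraic] (hΓ : IsHenkin Γ) (φ : L.Formula ℕ) :
    φ.Realize (fun i => TermModel.mk (Term.var i) : ℕ → TermModel Γ) ↔ φ ∈ Γ := by
  induction hk : φ.size using Nat.strong_induction_on generalizing φ with
  | _ k ih =>
    subst hk
    unfold Formula.Realize at ih ⊢
    cases φ with
    | falsum => exact ⟨False.elim, fun h => hΓ.consistent (.assume h)⟩
    | equal t s =>
      have hr : ∀ t : L.Term (ℕ ⊕ Fin 0), ∃ t' : L.Term ℕ, t = t'.relabel Sum.inl := by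
        intro t
        refine ⟨t.relabel (Sum.elim id Fin.elim0), ?_⟩
        rw [Term.relabel_relabel]
        conv_lhs => rw [← Term.relabel_id t]
        congr 1
        funext a
        rcases a with a | i
        exacts [rfl, i.elim0]
      obtain ⟨t, rfl⟩ := hr t
      obtain ⟨s, rfl⟩ := hr s
      simp only [Realize, Term.realize_relabel, Sum.elim_comp_inl, realize_termModel]
      exact Quotient.eq.trans hΓ.mem_iff_derives.symm
    | rel R ts => exact isEmptyElim R
    | imp φ ψ =>
      rw [Realize, ih _ (by simp only [size]; omega) φ rfl, ih _ (by simp only [size]; omega) ψ rfl]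
      constructor
      · intro h
        by_contra h'
        have hφ : φ ∈ Γ := by
          by_contra hφ
          refine h' (hΓ.mem_iff_derives.2 (.impI (Derives.of_bot ?_ _)))
          exact ((Derives.assume (hΓ.not_mem_iff.2 hφ)).weaken (Set.subset_insert _ _)).impE
            (.assume (Set.mem_insert _ _))
        exact h' (hΓ.mem_iff_derives.2 (.impI (.assume (Set.mem_insert_of_mem _ (h hφ)))))
      · exact fun h hφ => hΓ.mem_iff_derives.2 ((Derives.assume h).impE (.assume hφ))
    | all φ =>
      have hi : ∀ t : L.Term ℕ, φ.Realize
          (fun i => TermModel.mk (Term.var i) : ℕ → TermModel Γ)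
          (Fin.snoc default (TermModel.mk t)) ↔ φ.inst t ∈ Γ := fun t => by
        rw [← ih _ (by simp only [size, size_inst]; omega) (φ.inst t) rfl, realize_inst,
          realize_termModel]
        congr! 1
        funext i
        obtain rfl : i = 0 := Fin.fin_one_eq_zero i
        rfl
      rw [Realize]
      constructor
      · intro h
        by_contra h'
        obtain ⟨t, ht⟩ := hΓ.exists_witness φ (hΓ.not_mem_iff.2 h')
        exact hΓ.not_mem_iff.1 ht ((hi t).1 (h _))
      · intro h a
        induction a using Quotient.inductionOn with
        | h t => exact (hi t).2 (hΓ.mem_iff_derives.2 (.allE t (.assume h)))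

end IsHenkin

/-- Completeness: a sentence true in all models is provable. -/
theorem Theory.Proves.of_forall_models {L : Language.{0, 0}} [Countable (L.Formula ℕ)]
    [L.IsAlgebraic] {T : L.Theory} {σ : L.Sentence}
    (h : ∀ (M : Type) [L.Structure M] [Nonempty M], M ⊨ T → M ⊨ σ) : T.Proves σ := by
  by_contra hσ
  -- If `σ` is not provable, the axioms together with its negation are consistent, and their term
  -- model is a counterexample.
  have hext : HenkinExtendable (insert (σ.subst (β := ℕ) Empty.elim).not
      ((fun τ : L.Sentence => τ.subst (β := ℕ) Empty.elim) '' T)) := by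
    refine ⟨fun h => hσ (.byContra h), 0, ?_⟩
    rintro ψ (rfl | ⟨τ, -, rfl⟩)
    · exact (freeBelow_zero_subst_empty σ).not
    · exact freeBelow_zero_subst_empty τ
  obtain ⟨Δ, hsub, hΔ⟩ := hext.exists_isHenkin
  have hreal : ∀ τ : L.Sentence, IsHenkin.TermModel Δ ⊨ τ ↔ τ.subst (β := ℕ) Empty.elim ∈ Δ := by
    intro τ
    rw [← hΔ.realize_termModel_iff]
    refine _root_.Iff.trans ?_ realize_subst.symm
    unfold Sentence.Realize Formula.Realize
    congr! 1
  have hne : Nonempty (IsHenkin.TermModel Δ) := ⟨Quotient.mk _ (Term.var 0)⟩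
  have hT : IsHenkin.TermModel Δ ⊨ T := (Theory.model_iff _).2 fun τ hτ =>
    (hreal τ).2 (hsub (Set.mem_insert_of_mem _ ⟨τ, hτ, rfl⟩))
  exact hΔ.not_mem_iff.1 (hsub (Set.mem_insert _ _)) ((hreal σ).1 (h _ hT))

end FirstOrder.Language

/-! ### Countability of the language of arithmetic -/

namespace PeanoArithmetic

open FirstOrder Language

instance : arith.IsAlgebraic := fun _ => inferInstanceAs (IsEmpty Empty)

instance : Countable (Σ n, arith.Functions n) := by
  refine Function.Injective.countable (β := ℕ) (f := fun F => match F with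
    | ⟨_, ArithFunc.zero⟩ => 0
    | ⟨_, ArithFunc.succ⟩ => 1
    | ⟨_, ArithFunc.add⟩ => 2
    | ⟨_, ArithFunc.mul⟩ => 3) ?_
  rintro ⟨_, _ | _⟩ ⟨_, _ | _⟩ h <;> first | rfl | cases h

instance : Countable (arith.Formula ℕ) := by
  have h : Cardinal.mk (Σ n, arith.BoundedFormula ℕ n) ≤ Cardinal.aleph0 := by
    refine BoundedFormula.card_le.trans ?_
    simp only [Cardinal.mk_nat, Cardinal.lift_uzero, max_le_iff, le_refl,
      true_and]
    refine Cardinal.add_le_aleph0.2 ⟨le_rfl, ?_⟩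
    have : Countable (Σ n, arith.Relations n) := by
      have : IsEmpty (Σ n, arith.Relations n) := ⟨fun R => isEmptyElim R.2⟩
      infer_instance
    rw [Language.card, Cardinal.mk_sum]
    simp only [Cardinal.lift_le_aleph0, Cardinal.add_le_aleph0]
    exact ⟨Cardinal.mk_le_aleph0, Cardinal.mk_le_aleph0⟩
  have : Countable (Σ n, arith.BoundedFormula ℕ n) := Cardinal.mk_le_aleph0_iff.1 h
  exact Function.Injective.countable (f := fun φ : arith.Formula ℕ =>
    (⟨0, φ⟩ : Σ n, arith.BoundedFormula ℕ n)) fun _ _ h => by simpa using h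

end PeanoArithmetic

/-! ## Arithmetically definable predicates and functions -/

namespace PeanoArithmetic

open FirstOrder Language

/-- A type of finite tuples of elements of `M`, given by its coordinates. -/
class Ctx (M X : Type) where
  /-- The index type of the coordinates. -/
  ι : Type
  finite : Finite ι
  /-- The coordinates. -/
  coord : X → ι → M

attribute [instance] Ctx.finite

/-- Contexts are nested products of copies of `M`: a quantifier over `M` turns a predicate on `X ×
M` into one on `X`, and definability can be proved by following the syntax with `fun_prop`. -/
instance (M : Type) : Ctx M M := ⟨Unit, inferInstance, fun x _ => x⟩

instance (M X Y : Type) [Ctx M X] [Ctx M Y] : Ctx M (X × Y) :=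
  ⟨Ctx.ι M X ⊕ Ctx.ι M Y, inferInstance, fun p => Sum.elim (Ctx.coord p.1) (Ctx.coord p.2)⟩

variable (M : Type) [arith.Structure M] {X Y Z : Type} [Ctx M X] [Ctx M Y] [Ctx M Z]

/-- Definability of a predicate by a formula with parameters. -/
@[fun_prop]
def DP (P : X → Prop) : Prop :=
  ∃ φ : arith.Formula (Ctx.ι M X ⊕ M), ∀ x, φ.Realize (Sum.elim (Ctx.coord x) id) ↔ P x

/-- Definability, with parameters, of the graph of a function. -/
@[fun_prop]
def DF (f : X → Y) : Prop :=
  ∀ j : Ctx.ι M Y, DP M fun p : X × M => Ctx.coord (f p.1) j = p.2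

variable {M}

theorem DP.congr {P Q : X → Prop} (hP : DP M P) (h : ∀ x, P x ↔ Q x) : DP M Q := by
  obtain rfl : P = Q := funext fun x => propext (h x)
  exact hP

namespace DP

@[fun_prop]
theorem const (p : Prop) : DP M fun _ : X => p := by
  by_cases h : p
  · exact ⟨⊤, fun x => by simp [h]⟩
  · exact ⟨⊥, fun x => by simp [h]⟩

@[fun_prop]
theorem not {P : X → Prop} (hP : DP M P) : DP M fun x => ¬ P x := by
  obtain ⟨φ, hφ⟩ := hP
  exact ⟨φ.not, fun x => by rw [Formula.realize_not, hφ]⟩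

@[fun_prop]
theorem and {P Q : X → Prop} (hP : DP M P) (hQ : DP M Q) : DP M fun x => P x ∧ Q x := by
  obtain ⟨φ, hφ⟩ := hP
  obtain ⟨ψ, hψ⟩ := hQ
  exact ⟨φ ⊓ ψ, fun x => by rw [Formula.realize_inf, hφ, hψ]⟩

@[fun_prop]
theorem or {P Q : X → Prop} (hP : DP M P) (hQ : DP M Q) : DP M fun x => P x ∨ Q x :=
  (hP.not.and hQ.not).not.congr fun x => by tauto

@[fun_prop]
theorem imp {P Q : X → Prop} (hP : DP M P) (hQ : DP M Q) : DP M fun x => P x → Q x :=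
  (hP.not.or hQ).congr fun x => by tauto

@[fun_prop]
theorem iff {P Q : X → Prop} (hP : DP M P) (hQ : DP M Q) : DP M fun x => (P x ↔ Q x) :=
  ((hP.imp hQ).and (hQ.imp hP)).congr fun x => by tauto

@[fun_prop]
theorem all {P : X → M → Prop} (hP : DP M fun p : X × M => P p.1 p.2) :
    DP M fun x => ∀ y, P x y := by
  obtain ⟨φ, hφ⟩ := hP
  let r : Ctx.ι M (X × M) ⊕ M → (Ctx.ι M X ⊕ M) ⊕ Unit :=
    Sum.elim (Sum.elim (Sum.inl ∘ Sum.inl) Sum.inr) (Sum.inl ∘ Sum.inr)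
  refine ⟨Formula.iAlls Unit (Formula.relabel r φ), fun x => ?_⟩
  rw [Formula.realize_iAlls]
  have h : ∀ y : Unit → M, Sum.elim (Sum.elim (Ctx.coord x) _root_.id) y ∘ r =
      Sum.elim (Ctx.coord (M := M) (x, y ())) _root_.id := by
    intro y
    funext a
    rcases a with (a | a) | a <;> rfl
  simp only [Formula.realize_relabel, h, hφ]
  exact ⟨fun H y => H fun _ => y, fun H y => H (y ())⟩

@[fun_prop]
theorem ex {P : X → M → Prop} (hP : DP M fun p : X × M => P p.1 p.2) :
    DP M fun x => ∃ y, P x y :=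
  (DP.all (P := fun x y => ¬ P x y) hP.not).not.congr fun x => by simp

theorem relabel {P : Y → Prop} (hP : DP M P) (f : X → Y) (r : Ctx.ι M Y → Ctx.ι M X)
    (hr : ∀ x j, Ctx.coord (M := M) (f x) j = Ctx.coord x (r j)) : DP M fun x => P (f x) := by
  obtain ⟨φ, hφ⟩ := hP
  refine ⟨φ.relabel (Sum.map r _root_.id), fun x => ?_⟩
  refine Formula.realize_relabel.trans (Iff.trans ?_ (hφ (f x)))
  congr! 1
  funext a
  rcases a with a | a
  exacts [(hr x a).symm, rfl]

@[fun_prop]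
-- `P (f x)` is expressed as: there is a `y` with `P y` whose coordinates are those of `f x`.
-- Definable graphs are thus enough and no terms for the functions are needed; finiteness of the
-- index type keeps this first order.
theorem comp {P : Y → Prop} (hP : DP M P) {f : X → Y} (hf : DF M f) : DP M fun x => P (f x) := by
  obtain ⟨φ, hφ⟩ := hP
  choose ψ hψ using hf
  let r : (Ctx.ι M Y) ⊕ M → (Ctx.ι M X ⊕ M) ⊕ Ctx.ι M Y := Sum.elim Sum.inr (Sum.inl ∘ Sum.inr)
  let s : Ctx.ι M Y → Ctx.ι M (X × M) ⊕ M → (Ctx.ι M X ⊕ M) ⊕ Ctx.ι M Y := fun j =>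
    Sum.elim (Sum.elim (Sum.inl ∘ Sum.inl) fun _ => Sum.inr j) (Sum.inl ∘ Sum.inr)
  refine ⟨Formula.iExs (Ctx.ι M Y) (Formula.relabel r φ ⊓
    Formula.iInf fun j => Formula.relabel (s j) (ψ j)), fun x => ?_⟩
  rw [Formula.realize_iExs]
  have h : ∀ y j, Sum.elim (Sum.elim (Ctx.coord x) _root_.id) y ∘ s j =
      Sum.elim (Ctx.coord (M := M) (x, y j)) _root_.id := by
    intro y j
    funext a
    rcases a with (a | a) | a <;> rfl
  have h' : ∀ y, Sum.elim (Sum.elim (Ctx.coord x) _root_.id) y ∘ r = Sum.elim y _root_.id := by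
    intro y
    funext a
    rcases a with a | a <;> rfl
  simp only [Formula.realize_inf, Formula.realize_iInf, Formula.realize_relabel, h, h', hψ]
  constructor
  · rintro ⟨y, hy, hj⟩
    obtain rfl : Ctx.coord (f x) = y := funext hj
    exact (hφ _).1 hy
  · exact fun H => ⟨_, (hφ _).2 H, fun _ => rfl⟩

end DP

namespace DF

@[fun_prop]
theorem id : DF M fun x : X => x := fun j =>
  ⟨Term.equal (Term.var (Sum.inl (Sum.inl j))) (Term.var (Sum.inl (Sum.inr ()))), fun x => by
    rw [Formula.realize_equal]; rfl⟩

@[fun_prop]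
theorem const (y : Y) : DF M fun _ : X => y := fun j =>
  ⟨Term.equal (Term.var (Sum.inr (Ctx.coord y j))) (Term.var (Sum.inl (Sum.inr ()))), fun x => by
    rw [Formula.realize_equal]; rfl⟩

@[fun_prop]
theorem fst {f : X → Y × Z} (hf : DF M f) : DF M fun x => (f x).1 := fun j => hf (Sum.inl j)

@[fun_prop]
theorem snd {f : X → Y × Z} (hf : DF M f) : DF M fun x => (f x).2 := fun j => hf (Sum.inr j)

@[fun_prop]
theorem prodMk {f : X → Y} {g : X → Z} (hf : DF M f) (hg : DF M g) :
    DF M fun x => (f x, g x)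
  | .inl j => hf j
  | .inr j => hg j

@[fun_prop]
theorem comp {f : Y → Z} {g : X → Y} (hf : DF M f) (hg : DF M g) : DF M fun x => f (g x) := by
  intro j
  refine (hf j).comp (f := fun p : X × M => (g p.1, p.2)) (.prodMk ?_ (snd id))
  exact fun i =>
    (hg i).relabel (fun p : (X × M) × M => (p.1.1, p.2)) (Sum.map Sum.inl _root_.id) <| by
      rintro x (j | j) <;> rfl

theorem of_graph {f : X → M} (hf : DP M fun p : X × M => f p.1 = p.2) : DF M f := fun _ => hf

end DF

@[fun_prop]
theorem DP.eq {f g : X → M} (hf : DF M f) (hg : DF M g) : DP M fun x => f x = g x := by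
  have h : DP M fun p : M × M => p.1 = p.2 :=
    ⟨Term.equal (Term.var (Sum.inl (Sum.inl ()))) (Term.var (Sum.inl (Sum.inr ()))), fun x => by
      rw [Formula.realize_equal]; rfl⟩
  exact h.comp (hf.prodMk hg)

theorem DF.funMap₂ (F : arith.Functions 2) {f g : X → M} (hf : DF M f) (hg : DF M g) :
    DF M fun x => Structure.funMap F ![f x, g x] := by
  refine DF.comp (f := fun y : M × M => Structure.funMap F ![y.1, y.2]) (.of_graph ?_)
    (hf.prodMk hg)
  refine ⟨Term.equal (Functions.apply₂ F (Term.var (Sum.inl (Sum.inl (Sum.inl ()))))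
    (Term.var (Sum.inl (Sum.inl (Sum.inr ()))))) (Term.var (Sum.inl (Sum.inr ()))), fun x => ?_⟩
  rw [Formula.realize_equal, Term.realize_functions_apply₂]
  rfl

/-- A definable predicate is given by a formula with finitely many parameters. -/
theorem DP.exists_formula [Nonempty M] {P : M → Prop} (hP : DP M P) :
    ∃ (n : ℕ) (φ : arith.Formula (Fin (n + 1)))
    (p : Fin n → M), ∀ y, φ.Realize (Fin.snoc p y : Fin (n + 1) → M) ↔ P y := by
  classical
  obtain ⟨φ, hφ⟩ := hP
  let e := φ.freeVarFinset.equivFin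
  -- The argument goes to the last place and the parameters to the first ones. Every free variable
  -- owns a parameter slot; one owned by the argument is never read and gets an arbitrary value.
  refine ⟨φ.freeVarFinset.card, φ.restrictFreeVar fun a =>
    Sum.elim (fun _ => Fin.last _) (fun _ => (e a).castSucc) a.1,
    fun i => Sum.elim (fun _ => Classical.arbitrary M) (fun m => m) (e.symm i).1, fun y => ?_⟩
  rw [← hφ]
  refine BoundedFormula.realize_restrictFreeVar _ ?_
  rintro ⟨a | a, ha⟩
  · simp only [Sum.elim_inl, Fin.snoc_last]
    rfl
  · simp only [Sum.elim_inr, Fin.snoc_castSucc, Equiv.symm_apply_apply]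
    rfl

end PeanoArithmetic

/-! ## Arithmetic in models of Peano arithmetic -/

namespace PeanoArithmetic

open FirstOrder Language

/-- Models of Peano arithmetic as ordered semirings. -/
class PAModel (M : Type) extends CommSemiring M, LinearOrder M, Language.Structure arith M where
  isStrictOrderedRing : IsStrictOrderedRing M
  canonicallyOrderedAdd : CanonicallyOrderedAdd M
  add_one_le_of_lt {a b : M} : a < b → a + 1 ≤ b
  funMap_zero (v : Fin 0 → M) : funMap ArithFunc.zero v = (0 : M)
  funMap_succ (v : Fin 1 → M) : funMap ArithFunc.succ v = v 0 + 1
  funMap_add (v : Fin 2 → M) : funMap ArithFunc.add v = v 0 + v 1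
  funMap_mul (v : Fin 2 → M) : funMap ArithFunc.mul v = v 0 * v 1
  induction {P : M → Prop} : DP M P → P 0 → (∀ y, P y → P (y + 1)) → ∀ y, P y

attribute [instance] PAModel.isStrictOrderedRing PAModel.canonicallyOrderedAdd

variable {M : Type} [PAModel M] {X Y : Type} [Ctx M X] [Ctx M Y]

@[fun_prop]
theorem DF.add {f g : X → M} (hf : DF M f) (hg : DF M g) : DF M fun x => f x + g x := by
  have := DF.funMap₂ ArithFunc.add hf hg
  simpa only [PAModel.funMap_add, Matrix.cons_val_zero, Matrix.cons_val_one] using this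

@[fun_prop]
theorem DF.mul {f g : X → M} (hf : DF M f) (hg : DF M g) : DF M fun x => f x * g x := by
  have := DF.funMap₂ ArithFunc.mul hf hg
  simpa only [PAModel.funMap_mul, Matrix.cons_val_zero, Matrix.cons_val_one] using this

@[fun_prop]
theorem DP.le {f g : X → M} (hf : DF M f) (hg : DF M g) : DP M fun x => f x ≤ g x := by
  have : DP M fun x => ∃ y, g x = f x + y := by fun_prop
  exact this.congr fun _ => le_iff_exists_add.symm

@[fun_prop]
theorem DP.lt {f g : X → M} (hf : DF M f) (hg : DF M g) : DP M fun x => f x < g x :=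
  (DP.not (DP.le hg hf)).congr fun _ => not_le

@[fun_prop]
theorem DP.dvd {f g : X → M} (hf : DF M f) (hg : DF M g) : DP M fun x => f x ∣ g x := by
  have : DP M fun x => ∃ y, g x = f x * y := by fun_prop
  exact this

/-- A function with definable graph is definable. -/
theorem DF.of_iff {f : X → M} {P : X → M → Prop} (hP : DP M fun p : X × M => P p.1 p.2)
    (h : ∀ x y, f x = y ↔ P x y) : DF M f := .of_graph (hP.congr fun p => (h p.1 p.2).symm)

theorem lt_add_one_iff {a b : M} : a < b + 1 ↔ a ≤ b :=
  ⟨fun h => by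
    by_contra h'
    exact absurd (PAModel.add_one_le_of_lt (not_le.1 h')) (not_le.2 h),
    fun h => h.trans_lt (lt_add_one b)⟩

theorem add_one_le_iff {a b : M} : a + 1 ≤ b ↔ a < b :=
  ⟨fun h => (lt_add_one a).trans_le h, PAModel.add_one_le_of_lt⟩

theorem one_le_iff {a : M} : 1 ≤ a ↔ 0 < a := by
  rw [← add_one_le_iff, zero_add]

theorem eq_zero_or_exists_add_one (a : M) : a = 0 ∨ ∃ b, a = b + 1 := by
  rcases eq_or_ne a 0 with h | h
  · exact Or.inl h
  · obtain ⟨c, rfl⟩ := exists_add_of_le (one_le_iff.2 (pos_iff_ne_zero.2 h))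
    exact Or.inr ⟨c, add_comm _ _⟩

theorem zero_ne_add_one (a : M) : 0 ≠ a + 1 := (pos_of_gt (lt_add_one a)).ne

theorem strong_induction {P : M → Prop} (hP : DP M P) (h : ∀ y, (∀ z < y, P z) → P y) (y : M) :
    P y := by
  have : ∀ y, ∀ z < y, P z := PAModel.induction (by fun_prop) (fun z hz => (not_lt_zero hz).elim)
    fun y ih z hz => by
      rcases (lt_add_one_iff.1 hz).lt_or_eq with hz | rfl
      exacts [ih z hz, h z ih]
  exact h y (this y)

theorem exists_least {P : M → Prop} (hP : DP M P) (h : ∃ y, P y) : ∃ y, P y ∧ ∀ z < y, ¬ P z := by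
  by_contra! h'
  obtain ⟨y, hy⟩ := h
  exact strong_induction (P := fun y => ¬ P y) (by fun_prop) (fun y ih hy => by
    obtain ⟨z, hz, hz'⟩ := h' y hy
    exact ih z hz hz') y hy

theorem exists_div_mod {d : M} (hd : 0 < d) (c : M) : ∃ q r, c = d * q + r ∧ r < d := by
  refine PAModel.induction (P := fun c => ∃ q r, c = d * q + r ∧ r < d) (by fun_prop)
    ⟨0, 0, by simp, hd⟩ ?_ c
  rintro y ⟨q, r, rfl, hr⟩
  rcases (add_one_le_iff.2 hr).lt_or_eq with h | h
  · exact ⟨q, r + 1, by ring, h⟩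
  · exact ⟨q + 1, 0, by rw [← h]; ring, hd⟩

theorem le_of_dvd {a b : M} (hb : 0 < b) (h : a ∣ b) : a ≤ b := by
  obtain ⟨x, rfl⟩ := h
  refine le_mul_of_one_le_right zero_le ?_
  rw [one_le_iff]
  exact pos_of_mul_pos_right hb zero_le

/-- Replaces divisibility of a difference, as there is no subtraction. If the quotient of `a` is at
least that of `a + b`, then `b = 0`. -/
theorem dvd_of_dvd_add {u a b : M} (h : u ∣ a + b) (h' : u ∣ a) : u ∣ b := by
  obtain ⟨x, hx⟩ := h
  obtain ⟨y, rfl⟩ := h'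
  rcases le_total y x with hyx | hyx
  · obtain ⟨z, rfl⟩ := exists_add_of_le hyx
    rw [mul_add] at hx
    exact ⟨z, add_left_cancel hx⟩
  · have : u * x ≤ u * y := by gcongr
    rw [← hx] at this
    have hb : b ≤ 0 := le_of_add_le_add_left (this.trans (add_zero _).ge)
    rw [nonpos_iff_eq_zero.1 hb]
    exact dvd_zero u

/-! ### Pairs -/

/-- The pairing function of the coding. -/
def pr (a b : M) : M := (a + b) * (a + b) + a

@[fun_prop]
theorem DF.pr {f g : X → M} (hf : DF M f) (hg : DF M g) : DF M fun x => pr (f x) (g x) := by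
  unfold PeanoArithmetic.pr
  fun_prop

theorem pr_lt (a b : M) : pr a b < (a + b + 1) * (a + b + 1) := by
  have : pr a b + (a + b + b + 1) = (a + b + 1) * (a + b + 1) := by unfold pr; ring
  rw [← this]
  exact lt_add_of_pos_right _ (by positivity)

/-- By `pr_lt` the sum `a + b` is the integer part of the square root of the code, and the remainder
is `a`. -/
theorem pr_inj {a b a' b' : M} : pr a b = pr a' b' ↔ a = a' ∧ b = b' := by
  refine ⟨fun h => ?_, fun h => by rw [h.1, h.2]⟩
  have key : ∀ {a b a' b' : M}, pr a b = pr a' b' → a + b ≤ a' + b' := by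
    intro a b a' b' h
    by_contra hlt
    rw [not_le, ← add_one_le_iff] at hlt
    have h1 := pr_lt a' b'
    rw [← h] at h1
    have h2 : (a' + b' + 1) * (a' + b' + 1) ≤ (a + b) * (a + b) := by gcongr
    exact absurd (h1.trans_le h2) (not_lt.2 le_self_add)
  have hs := le_antisymm (key h) (key h.symm)
  unfold pr at h
  rw [hs] at h
  obtain rfl := add_left_cancel h
  exact ⟨rfl, add_left_cancel hs⟩

/-! ### Coding of finite sets -/

/-- `t` belongs to the finite set with code `(c, d, N)`. -/
def Mem (t c d N : M) : Prop := t < N ∧ (t + 1) * d + 1 ∣ c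

@[fun_prop]
theorem DP.mem {f g h k : X → M} (hf : DF M f) (hg : DF M g) (hh : DF M h) (hk : DF M k) :
    DP M fun x => Mem (f x) (g x) (h x) (k x) := by
  unfold Mem
  fun_prop

/-- Plays the role of `N!` in Gödel's beta function. -/
theorem exists_common_multiple (N : M) : ∃ d, 0 < d ∧ ∀ i, 0 < i → i ≤ N → i ∣ d := by
  refine PAModel.induction (P := fun N => ∃ d, 0 < d ∧ ∀ i, 0 < i → i ≤ N → i ∣ d) (by fun_prop)
    ⟨1, one_pos, fun i hi h => (hi.not_ge h).elim⟩ ?_ N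
  rintro N ⟨d, hd, h⟩
  refine ⟨d * (N + 1), by positivity, fun i hi hiN => ?_⟩
  rcases hiN.lt_or_eq with hiN | rfl
  · exact Dvd.dvd.mul_right (h i hi (lt_add_one_iff.1 hiN)) _
  · exact dvd_mul_left _ _

/-- Since `u` is `1` modulo `d`, it is coprime to `d`; concretely `w (c d) + c = u c`. -/
theorem dvd_of_dvd_mul_of_eq_mul_add_one {u w d c : M} (hu : u = w * d + 1) (h : u ∣ c * d) :
    u ∣ c := by
  refine dvd_of_dvd_add (a := w * (c * d)) ?_ (Dvd.dvd.mul_left h _)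
  exact ⟨c, by rw [hu]; ring⟩

/-- The moduli for distinct `s`, `t` are coprime: they differ by `e * d` with `0 < e ≤ N`, so `e`
divides `d`, and the modulus of `t` is coprime to `d`. Stated as a cancellation law, this avoids
primes and gcds. -/
theorem dvd_of_dvd_mul_of_ne {N d s t c : M} (hd : ∀ i, 0 < i → i ≤ N → i ∣ d) (hs : s < N)
    (ht : t < N) (hst : t ≠ s) (h : (t + 1) * d + 1 ∣ c * ((s + 1) * d + 1)) :
    (t + 1) * d + 1 ∣ c := by
  have key : ∀ e, 0 < e → e ≤ N → (t + 1) * d + 1 ∣ c * (e * d) → (t + 1) * d + 1 ∣ c := by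
    intro e he heN h
    obtain ⟨q, rfl⟩ := hd e he heN
    have h1 : (t + 1) * (e * q) + 1 ∣ c * (e * q) * (e * q) := by
      refine h.trans ⟨q, by ring⟩
    exact dvd_of_dvd_mul_of_eq_mul_add_one rfl (dvd_of_dvd_mul_of_eq_mul_add_one rfl h1)
  rcases lt_or_gt_of_ne hst with hlt | hlt
  · obtain ⟨e, rfl⟩ := exists_add_of_le hlt.le
    refine key e (pos_of_lt_add_right hlt) (le_add_self.trans hs.le) ?_
    refine dvd_of_dvd_add (a := c * ((t + 1) * d + 1)) ?_ (dvd_mul_left _ _)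
    convert h using 1
    ring
  · obtain ⟨e, rfl⟩ := exists_add_of_le hlt.le
    refine key e (pos_of_lt_add_right hlt) (le_add_self.trans ht.le) ?_
    exact dvd_of_dvd_add (u := (s + e + 1) * d + 1) (a := c * ((s + 1) * d + 1)) (b := c * (e * d))
      ⟨c, (by ring :
      c * ((s + 1) * d + 1) + c * (e * d) = ((s + e + 1) * d + 1) * c)⟩ h

/-- Bounded definable sets have codes. -/
theorem exists_code {P : M → Prop} (hP : DP M P) (N : M) :
    ∃ c d, ∀ t, Mem t c d N ↔ t < N ∧ P t := by
  obtain ⟨d, hd0, hd⟩ := exists_common_multiple N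
  -- The code `c` is the product of the moduli of those elements of `P` that lie below both `n` and
  -- `N`; coprimality keeps the other moduli from dividing it.
  have : ∀ n, ∃ c, ∀ t < N, ((t + 1) * d + 1 ∣ c ↔ t < n ∧ P t) := by
    refine PAModel.induction (by fun_prop) ⟨1, fun t ht => ?_⟩ ?_
    · refine ⟨fun h => ?_, fun h => (not_lt_zero h.1).elim⟩
      have h1 := le_of_dvd one_pos h
      have h2 : 0 < (t + 1) * d := by positivity
      exact absurd h1 (not_le.2 (lt_add_of_pos_left 1 h2))
    · rintro n ⟨c, hc⟩
      by_cases hn : P n ∧ n < N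
      · refine ⟨c * ((n + 1) * d + 1), fun t ht => ?_⟩
        rcases eq_or_ne t n with rfl | htn
        · exact ⟨fun _ => ⟨lt_add_one t, hn.1⟩, fun _ => dvd_mul_left _ _⟩
        · rw [lt_add_one_iff, htn.le_iff_lt, ← hc t ht]
          exact ⟨dvd_of_dvd_mul_of_ne hd hn.2 ht htn, fun h => Dvd.dvd.mul_right h _⟩
      · refine ⟨c, fun t ht => ?_⟩
        rw [hc t ht, lt_add_one_iff]
        refine ⟨fun h => ⟨h.1.le, h.2⟩, fun h => ⟨lt_of_le_of_ne h.1 ?_, h.2⟩⟩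
        rintro rfl
        exact hn ⟨h.2, ht⟩
  obtain ⟨c, hc⟩ := this N
  refine ⟨c, d, fun t => ⟨fun h => ⟨h.1, ((hc t h.1).1 h.2).2⟩, fun h => ⟨h.1, (hc t h.1).2 h⟩⟩⟩

@[fun_prop]
theorem DP.existsUnique {P : X → M → Prop} (hP : DP M fun p : X × M => P p.1 p.2) :
    DP M fun x => ∃! y, P x y := by
  unfold ExistsUnique
  have h : DP M fun q : (X × M) × M => P q.1.1 q.2 :=
    hP.comp (f := fun q : (X × M) × M => (q.1.1, q.2)) (by fun_prop)
  fun_prop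

/-! ### Inductive definitions by codes of finite sets -/

/-- `t` belongs to a coded finite set all of whose elements are justified by this set. -/
def Der (J : (M → Prop) → M → Prop) (t : M) : Prop :=
  ∃ c d N, Mem t c d N ∧ ∀ s, Mem s c d N → J (fun u => Mem u c d N) s

/-- A monotone operator each of whose consequences depends on finitely many premises. -/
structure IsFinitary (J : (M → Prop) → M → Prop) : Prop where
  mono {S S' : M → Prop} {t : M} : (∀ u, S u → S' u) → J S t → J S' t
  exists_finset {S : M → Prop} {t : M} : J S t → ∃ F : Finset M, (∀ u ∈ F, S u) ∧ J (· ∈ F) t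

/-- Every derivable element brings its own coded set. A union of two coded sets is coded, and
monotonicity preserves justification in it. `F` is finite in the metatheory, so the induction on it
takes place outside the model. -/
theorem IsFinitary.exists_code {J : (M → Prop) → M → Prop} (hJ : IsFinitary J) (F : Finset M)
    (hF : ∀ u ∈ F, Der J u) : ∃ c d N, (∀ u ∈ F, Mem u c d N) ∧
      ∀ s, Mem s c d N → J (fun u => Mem u c d N) s := by
  classical
  induction F using Finset.induction_on with
  | empty => exact ⟨0, 0, 0, by simp, fun s hs => (not_lt_zero hs.1).elim⟩
  | insert a F _ ih =>
    obtain ⟨c, d, N, h1, h2⟩ := ih fun u hu => hF u (Finset.mem_insert_of_mem hu)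
    obtain ⟨c', d', N', h1', h2'⟩ := hF a (Finset.mem_insert_self a F)
    obtain ⟨c₁, d₁, h⟩ := PeanoArithmetic.exists_code
      (P := fun t => Mem t c d N ∨ Mem t c' d' N') (by fun_prop) (max N N')
    have h' : ∀ t, Mem t c₁ d₁ (max N N') ↔ Mem t c d N ∨ Mem t c' d' N' := fun t =>
      (h t).trans (and_iff_right_of_imp fun ht => ht.elim (fun h => h.1.trans_le (le_max_left _ _))
        fun h => h.1.trans_le (le_max_right _ _))
    refine ⟨c₁, d₁, max N N', fun u hu => ?_, fun s hs => ?_⟩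
    · rw [h']
      rcases Finset.mem_insert.1 hu with rfl | hu
      exacts [Or.inr h1', Or.inl (h1 u hu)]
    · rcases (h' s).1 hs with hs | hs
      exacts [hJ.mono (fun u hu => (h' u).2 (Or.inl hu)) (h2 s hs),
        hJ.mono (fun u hu => (h' u).2 (Or.inr hu)) (h2' s hs)]

/-- The source of all recursion equations below. Backwards, the finitely many premises are put into
one coded set and `t` is added. Only a fixed point is obtained, not leastness, so uniqueness of
values must come from induction in the model. -/
theorem IsFinitary.der_iff {J : (M → Prop) → M → Prop} (hJ : IsFinitary J) {t : M} :
    Der J t ↔ J (Der J) t := by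
  constructor
  · rintro ⟨c, d, N, ht, h⟩
    exact hJ.mono (fun u hu => ⟨c, d, N, hu, h⟩) (h t ht)
  · intro h
    obtain ⟨F, hF, hJF⟩ := hJ.exists_finset h
    obtain ⟨c, d, N, h1, h2⟩ := hJ.exists_code F hF
    obtain ⟨c₁, d₁, h⟩ := PeanoArithmetic.exists_code (P := fun s => Mem s c d N ∨ s = t)
      (by fun_prop) (max N (t + 1))
    have h' : ∀ s, Mem s c₁ d₁ (max N (t + 1)) ↔ Mem s c d N ∨ s = t := fun s =>
      (h s).trans (and_iff_right_of_imp fun ht => ht.elim (fun h => h.1.trans_le (le_max_left _ _))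
        fun h => h ▸ (lt_add_one s).trans_le (le_max_right _ _))
    refine ⟨c₁, d₁, max N (t + 1), (h' t).2 (Or.inr rfl), fun s hs => ?_⟩
    rcases (h' s).1 hs with hs | rfl
    · exact hJ.mono (fun u hu => (h' u).2 (Or.inl hu)) (h2 s hs)
    · exact hJ.mono (fun u hu => (h' u).2 (Or.inl (h1 u hu))) hJF

end PeanoArithmetic

/-! ## The Ackermann function in models of Peano arithmetic -/

namespace PeanoArithmetic

open FirstOrder Language

variable {M : Type} [PAModel M] {X Y : Type} [Ctx M X] [Ctx M Y]

/-- Code of the fact `A_a(k,b) = v`. -/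
def ackCode (k a b v : M) : M := pr 0 (pr k (pr a (pr b v)))

/-- Code of the fact `A_a^i(k,·)(u) = v`. -/
def iterCode (k a i u v : M) : M := pr 1 (pr k (pr a (pr i (pr u v))))

/-- The recursion clauses of the Ackermann function and its iterates. -/
def AckJ (S : M → Prop) (t : M) : Prop :=
  (∃ k, t = ackCode k 0 0 1) ∨
  (∃ k b v, t = ackCode k 0 (b + 1) (v * k) ∧ S (ackCode k 0 b v)) ∨
  (∃ k a v, t = ackCode k (a + 1) 0 v ∧ S (iterCode k a k 0 v)) ∨
  (∃ k a b v w, t = ackCode k (a + 1) (b + 1) v ∧ S (ackCode k (a + 1) b w) ∧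
    S (iterCode k a k w v)) ∨
  (∃ k a u, t = iterCode k a 0 u u) ∨
  ∃ k a i u v w, t = iterCode k a (i + 1) u v ∧ S (iterCode k a i u w) ∧ S (ackCode k a w v)

theorem isFinitary_ackJ : IsFinitary (AckJ (M := M)) where
  mono := by
    rintro S S' t h (⟨k, ht⟩ | ⟨k, b, v, ht, h1⟩ | ⟨k, a, v, ht, h1⟩ | ⟨k, a, b, v, w, ht, h1, h2⟩ |
      ⟨k, a, u, ht⟩ | ⟨k, a, i, u, v, w, ht, h1, h2⟩)
    · exact Or.inl ⟨k, ht⟩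
    · exact Or.inr (Or.inl ⟨k, b, v, ht, h _ h1⟩)
    · exact Or.inr (Or.inr (Or.inl ⟨k, a, v, ht, h _ h1⟩))
    · exact Or.inr (Or.inr (Or.inr (Or.inl ⟨k, a, b, v, w, ht, h _ h1, h _ h2⟩)))
    · exact Or.inr (Or.inr (Or.inr (Or.inr (Or.inl ⟨k, a, u, ht⟩))))
    · exact Or.inr (Or.inr (Or.inr (Or.inr (Or.inr ⟨k, a, i, u, v, w, ht, h _ h1, h _ h2⟩))))
  exists_finset := by
    classical
    rintro S t (⟨k, ht⟩ | ⟨k, b, v, ht, h1⟩ | ⟨k, a, v, ht, h1⟩ | ⟨k, a, b, v, w, ht, h1, h2⟩ |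
      ⟨k, a, u, ht⟩ | ⟨k, a, i, u, v, w, ht, h1, h2⟩)
    · exact ⟨∅, by simp, Or.inl ⟨k, ht⟩⟩
    · exact ⟨{_}, by simpa using h1, Or.inr (Or.inl ⟨k, b, v, ht, Finset.mem_singleton_self _⟩)⟩
    · exact ⟨{_}, by simpa using h1,
        Or.inr (Or.inr (Or.inl ⟨k, a, v, ht, Finset.mem_singleton_self _⟩))⟩
    · exact ⟨{_, _}, by simpa using ⟨h1, h2⟩, Or.inr (Or.inr (Or.inr (Or.inl
        ⟨k, a, b, v, w, ht, Finset.mem_insert_self _ _, by simp⟩)))⟩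
    · exact ⟨∅, by simp, Or.inr (Or.inr (Or.inr (Or.inr (Or.inl ⟨k, a, u, ht⟩))))⟩
    · exact ⟨{_, _}, by simpa using ⟨h1, h2⟩, Or.inr (Or.inr (Or.inr (Or.inr (Or.inr
        ⟨k, a, i, u, v, w, ht, Finset.mem_insert_self _ _, by simp⟩))))⟩

@[fun_prop]
theorem DP.der_ackJ {f : X → M} (hf : DF M f) : DP M fun x => Der AckJ (f x) := by
  refine DP.comp (P := fun t : M => Der AckJ t) ?_ hf
  unfold Der AckJ ackCode iterCode
  fun_prop

/-- The graph of the Ackermann function. -/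
def AckR (k a b v : M) : Prop := Der AckJ (ackCode k a b v)

/-- The graph of the iterates of the Ackermann function. -/
def IterR (k a i u v : M) : Prop := Der AckJ (iterCode k a i u v)

@[fun_prop]
theorem DP.ackR {f g h l : X → M} (hf : DF M f) (hg : DF M g) (hh : DF M h) (hl : DF M l) :
    DP M fun x => AckR (f x) (g x) (h x) (l x) := by
  unfold AckR ackCode
  fun_prop

@[fun_prop]
theorem DP.iterR {f g h l m : X → M} (hf : DF M f) (hg : DF M g) (hh : DF M h) (hl : DF M l)
    (hm : DF M m) : DP M fun x => IterR (f x) (g x) (h x) (l x) (m x) := by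
  unfold IterR iterCode
  fun_prop

theorem ackR_zero_zero {k v : M} : AckR k 0 0 v ↔ v = 1 := by
  rw [AckR, isFinitary_ackJ.der_iff]
  simp [AckJ, ackCode, iterCode, pr_inj, zero_ne_add_one, eq_comm (a := v)]

theorem ackR_zero_succ {k b v : M} : AckR k 0 (b + 1) v ↔ ∃ w, w * k = v ∧ AckR k 0 b w := by
  unfold AckR
  rw [isFinitary_ackJ.der_iff]
  simp [AckJ, ackCode, iterCode, pr_inj, zero_ne_add_one, (zero_ne_add_one _).symm,
    eq_comm (a := v)]

theorem ackR_succ_zero {k a v : M} : AckR k (a + 1) 0 v ↔ IterR k a k 0 v := by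
  unfold AckR IterR
  rw [isFinitary_ackJ.der_iff]
  simp [AckJ, ackCode, iterCode, pr_inj, zero_ne_add_one, (zero_ne_add_one _).symm,
    eq_comm (a := v)]

theorem ackR_succ_succ {k a b v : M} :
    AckR k (a + 1) (b + 1) v ↔ ∃ w, AckR k (a + 1) b w ∧ IterR k a k w v := by
  unfold AckR IterR
  rw [isFinitary_ackJ.der_iff]
  simp [AckJ, ackCode, iterCode, pr_inj, (zero_ne_add_one _).symm, eq_comm (a := v)]

theorem iterR_zero {k a u v : M} : IterR k a 0 u v ↔ u = v := by
  unfold IterR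
  rw [isFinitary_ackJ.der_iff]
  simp [AckJ, ackCode, iterCode, pr_inj, zero_ne_add_one, eq_comm (a := v)]

theorem iterR_succ {k a i u v : M} :
    IterR k a (i + 1) u v ↔ ∃ w, IterR k a i u w ∧ AckR k a w v := by
  unfold IterR AckR
  rw [isFinitary_ackJ.der_iff]
  simp [AckJ, ackCode, iterCode, pr_inj, (zero_ne_add_one _).symm, eq_comm (a := v)]

/-- Induction on `a` for the definable statement that all values `A_a(k,b)` exist and are unique,
with inner inductions on the number of iterations and on `b`. -/
theorem existsUnique_ackR_iterR (k a : M) :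
    (∀ b, ∃! v, AckR k a b v) ∧ ∀ i u, ∃! v, IterR k a i u v := by
  have iter : ∀ a : M, (∀ b, ∃! v, AckR k a b v) → ∀ i u, ∃! v, IterR k a i u v := by
    intro a h i
    refine PAModel.induction (P := fun i => ∀ u, ∃! v, IterR k a i u v) (by fun_prop) ?_ ?_ i
    · simp [iterR_zero]
    · intro i ih u
      obtain ⟨w, hw, hwu⟩ := ih u
      obtain ⟨v, hv, hvu⟩ := h w
      refine ⟨v, iterR_succ.2 ⟨w, hw, hv⟩, fun v' hv' => ?_⟩
      obtain ⟨w', hw', hv'⟩ := iterR_succ.1 hv'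
      obtain rfl := hwu w' hw'
      exact hvu v' hv'
  suffices H : ∀ b, ∃! v, AckR k a b v from ⟨H, iter a H⟩
  refine PAModel.induction (P := fun a => ∀ b, ∃! v, AckR k a b v) (by fun_prop) ?_ ?_ a
  · refine PAModel.induction (by fun_prop) ⟨1, ackR_zero_zero.2 rfl, fun v => ackR_zero_zero.1⟩ ?_
    rintro b ⟨w, hw, hwu⟩
    refine ⟨w * k, ackR_zero_succ.2 ⟨w, rfl, hw⟩, fun v hv => ?_⟩
    obtain ⟨w', rfl, hw'⟩ := ackR_zero_succ.1 hv
    rw [hwu w' hw']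
  · intro a ih
    have hi := iter a ih
    refine PAModel.induction (by fun_prop) ?_ ?_
    · simpa only [ackR_succ_zero] using hi k 0
    · rintro b ⟨w, hw, hwu⟩
      obtain ⟨v, hv, hvu⟩ := hi k w
      refine ⟨v, ackR_succ_succ.2 ⟨w, hw, hv⟩, fun v' hv' => ?_⟩
      obtain ⟨w', hw', hv'⟩ := ackR_succ_succ.1 hv'
      obtain rfl := hwu w' hw'
      exact hvu v' hv'

/-- The Ackermann function. -/
noncomputable def A (k a b : M) : M := ((existsUnique_ackR_iterR k a).1 b).choose

/-- The iterates of the Ackermann function. -/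
noncomputable def It (k a i u : M) : M := ((existsUnique_ackR_iterR k a).2 i u).choose

theorem A_eq_iff {k a b v : M} : A k a b = v ↔ AckR k a b v := by
  have h := ((existsUnique_ackR_iterR k a).1 b).choose_spec
  exact ⟨fun e => e ▸ h.1, fun e => (h.2 v e).symm⟩

theorem It_eq_iff {k a i u v : M} : It k a i u = v ↔ IterR k a i u v := by
  have h := ((existsUnique_ackR_iterR k a).2 i u).choose_spec
  exact ⟨fun e => e ▸ h.1, fun e => (h.2 v e).symm⟩

@[fun_prop]
theorem DF.A {f g h : X → M} (hf : DF M f) (hg : DF M g) (hh : DF M h) :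
    DF M fun x => A (f x) (g x) (h x) :=
  .of_iff (P := fun x y => AckR (f x) (g x) (h x) y) (by fun_prop) fun _ _ => A_eq_iff

@[fun_prop]
theorem DF.It {f g h l : X → M} (hf : DF M f) (hg : DF M g) (hh : DF M h) (hl : DF M l) :
    DF M fun x => It (f x) (g x) (h x) (l x) :=
  .of_iff (P := fun x y => IterR (f x) (g x) (h x) (l x) y) (by fun_prop) fun _ _ => It_eq_iff

theorem A_zero_zero (k : M) : A k 0 0 = 1 := A_eq_iff.2 (ackR_zero_zero.2 rfl)

theorem A_zero_succ (k b : M) : A k 0 (b + 1) = A k 0 b * k :=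
  A_eq_iff.2 (ackR_zero_succ.2 ⟨_, rfl, A_eq_iff.1 rfl⟩)

theorem A_succ_zero (k a : M) : A k (a + 1) 0 = It k a k 0 :=
  A_eq_iff.2 (ackR_succ_zero.2 (It_eq_iff.1 rfl))

theorem A_succ_succ (k a b : M) : A k (a + 1) (b + 1) = It k a k (A k (a + 1) b) :=
  A_eq_iff.2 (ackR_succ_succ.2 ⟨_, A_eq_iff.1 rfl, It_eq_iff.1 rfl⟩)

theorem It_zero (k a u : M) : It k a 0 u = u := It_eq_iff.2 (iterR_zero.2 rfl)

theorem It_succ (k a i u : M) : It k a (i + 1) u = A k a (It k a i u) :=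
  It_eq_iff.2 (iterR_succ.2 ⟨_, It_eq_iff.1 rfl, A_eq_iff.1 rfl⟩)

end PeanoArithmetic

/-! ### Growth of the Ackermann function -/

namespace PeanoArithmetic

open FirstOrder Language

variable {M : Type} [PAModel M] {X Y : Type} [Ctx M X] [Ctx M Y]

theorem strictMono_of_lt_add_one {f : M → M} (hf : DF M f) (h : ∀ x, f x < f (x + 1)) :
    StrictMono f := by
  suffices H : ∀ y, ∀ x < y, f x < f y from fun x y hxy => H y x hxy
  refine PAModel.induction (by fun_prop) (fun x hx => (not_lt_zero hx).elim) fun y ih x hx => ?_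
  rcases (lt_add_one_iff.1 hx).lt_or_eq with hx | rfl
  exacts [(ih x hx).trans (h y), h x]

theorem le_of_strictMono {f : M → M} (hf : DF M f) (h : StrictMono f) (x : M) : x ≤ f x := by
  refine PAModel.induction (P := fun x => x ≤ f x) (by fun_prop) zero_le (fun y ih => ?_) x
  exact add_one_le_iff.2 (ih.trans_lt (h (lt_add_one y)))

theorem exists_bracket {f : M → M} (hf : DF M f) (h : StrictMono f) {c : M} (h0 : f 0 ≤ c) :
    ∃ i, f i ≤ c ∧ c < f (i + 1) := by
  obtain ⟨i, hi, hmin⟩ := exists_least (P := fun i => c < f (i + 1)) (by fun_prop)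
    ⟨c, (lt_add_one c).trans_le (le_of_strictMono hf h _)⟩
  refine ⟨i, ?_, hi⟩
  rcases eq_zero_or_exists_add_one i with rfl | ⟨j, rfl⟩
  exacts [h0, not_lt.1 (hmin j (lt_add_one j))]

theorem le_of_bracket {f : M → M} (h : StrictMono f) {c d i j : M} (hi : f i ≤ c) (hcd : c ≤ d)
    (hj : d < f (j + 1)) : i ≤ j :=
  lt_add_one_iff.1 (h.lt_iff_lt.1 ((hi.trans hcd).trans_lt hj))

theorem A_zero_pos {k : M} (hk : 0 < k) (b : M) : 0 < A k 0 b := by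
  refine PAModel.induction (P := fun b => 0 < A k 0 b) (by fun_prop) ?_ (fun b ih => ?_) b
  · rw [A_zero_zero]; exact one_pos
  · rw [A_zero_succ]; positivity

theorem It_strictMono {k a : M} (h : ∀ x, x < A k a x) (u : M) :
    StrictMono fun i => It k a i u :=
  strictMono_of_lt_add_one (by fun_prop) fun i => by rw [It_succ]; exact h _

theorem two_pos' : (0 : M) < 2 := two_pos

theorem lt_A {k : M} (hk : 2 ≤ k) (a b : M) : b < A k a b := by
  have hk0 : 0 < k := two_pos'.trans_le hk
  refine PAModel.induction (P := fun a => ∀ b, b < A k a b) (by fun_prop) ?_ (fun a ih => ?_) a b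
  · refine PAModel.induction (by fun_prop) (A_zero_pos hk0 0) fun b ih => ?_
    have h1 := A_zero_pos hk0 b
    rw [A_zero_succ]
    calc b + 1 ≤ A k 0 b := add_one_le_iff.2 ih
      _ < A k 0 b * 2 := by rw [mul_two]; exact lt_add_of_pos_right _ h1
      _ ≤ A k 0 b * k := by gcongr
  · have hI := fun u => It_strictMono ih u hk0
    simp only [It_zero] at hI
    refine PAModel.induction (by fun_prop) ?_ fun b ihb => ?_
    · rw [A_succ_zero]; exact hI 0
    · rw [A_succ_succ]; exact (add_one_le_iff.2 ihb).trans_lt (hI _)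

theorem A_pos {k : M} (hk : 2 ≤ k) (a b : M) : 0 < A k a b := pos_of_gt (lt_A hk a b)

theorem le_It {k : M} (hk : 2 ≤ k) (a i u : M) : u ≤ It k a i u := by
  have := (It_strictMono (lt_A hk a) u).monotone (zero_le (a := i))
  simpa only [It_zero] using this

theorem A_strictMono {k : M} (hk : 2 ≤ k) (a : M) : StrictMono fun b => A k a b := by
  have hk0 : 0 < k := two_pos'.trans_le hk
  refine strictMono_of_lt_add_one (by fun_prop) fun b => ?_
  rcases eq_zero_or_exists_add_one a with rfl | ⟨a, rfl⟩
  · rw [A_zero_succ]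
    have h1 := A_zero_pos hk0 b
    calc A k 0 b < A k 0 b * 2 := by rw [mul_two]; exact lt_add_of_pos_right _ h1
      _ ≤ A k 0 b * k := by gcongr
  · rw [A_succ_succ]
    have := It_strictMono (lt_A hk a) (A k (a + 1) b) hk0
    simpa only [It_zero] using this

theorem A_mono {k : M} (hk : 2 ≤ k) (a : M) {b b' : M} (h : b ≤ b') : A k a b ≤ A k a b' :=
  (A_strictMono hk a).monotone h

theorem A_zero_strictMono {k : M} (hk : 2 ≤ k) : StrictMono fun a => A k a 0 := by
  refine strictMono_of_lt_add_one (by fun_prop) fun a => ?_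
  rw [A_succ_zero]
  have h1 : (1 : M) < k := one_lt_two.trans_le hk
  have := It_strictMono (lt_A hk a) 0 h1
  have e : It k a (0 + 1) 0 = A k a 0 := by rw [It_succ, It_zero]
  rw [zero_add] at e
  exact e ▸ this

theorem It_mono {k k' a : M} (hk' : 2 ≤ k') (h : ∀ x, A k a x ≤ A k' a x)
    {i i' u u' : M} (hi : i ≤ i') (hu : u ≤ u') : It k a i u ≤ It k' a i' u' := by
  have h1 : ∀ i, It k a i u ≤ It k' a i u' := by
    refine PAModel.induction (by fun_prop) (by simpa only [It_zero] using hu) fun i ih => ?_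
    rw [It_succ, It_succ]
    exact (h _).trans (A_mono hk' a ih)
  exact (h1 i).trans ((It_strictMono (lt_A hk' a) u').monotone hi)

theorem A_mono_base {k k' : M} (hk : 2 ≤ k) (hkk' : k ≤ k') (a b : M) : A k a b ≤ A k' a b := by
  refine PAModel.induction (P := fun a => ∀ b, A k a b ≤ A k' a b) (by fun_prop) ?_ (fun a ih => ?_)
    a b
  · refine PAModel.induction (by fun_prop) (by rw [A_zero_zero, A_zero_zero]) fun b ih => ?_
    rw [A_zero_succ, A_zero_succ]
    gcongr
  · have hI := fun u u' => It_mono (a := a) (u := u) (u' := u') (hk.trans hkk') ih hkk'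
    refine PAModel.induction (by fun_prop) ?_ fun b ihb => ?_
    · rw [A_succ_zero, A_succ_zero]; exact hI _ _ le_rfl
    · rw [A_succ_succ, A_succ_succ]; exact hI _ _ ihb

theorem A_le_A_succ {k : M} (hk : 2 ≤ k) (a b : M) : A k a b ≤ A k (a + 1) b := by
  rcases eq_zero_or_exists_add_one b with rfl | ⟨b, rfl⟩
  · exact (A_zero_strictMono hk).monotone (lt_add_one a).le
  -- The last of the `k` iterations applies `A_a` to a number that is at least `A_{a+1}(k,b) ≥ b +
  -- 1`.
  · rw [A_succ_succ]
    obtain ⟨j, rfl⟩ : ∃ j, k = j + 1 :=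
      (eq_zero_or_exists_add_one k).resolve_left (two_pos'.trans_le hk).ne'
    rw [It_succ]
    refine A_mono hk a ((add_one_le_iff.2 (lt_A hk (a + 1) b)).trans (le_It hk _ _ _))

/-- Used to absorb coefficients after a base change, where the base is at least `3`; for base `2` it
fails, as `2 ^ 3 < 3 * 3`. The bound with `b * b + 1` is the one that passes through the induction.
-/
theorem sq_le_A {k : M} (hk : 3 ≤ k) (a b : M) : b * b ≤ A k a b := by
  have hk2 : (2 : M) ≤ k := le_trans (by norm_num) hk
  refine PAModel.induction (P := fun a => b * b ≤ A k a b) (by fun_prop) ?_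
    (fun a ih => ih.trans (A_le_A_succ hk2 a b)) a
  suffices h : b * b + 1 ≤ A k 0 b from le_self_add.trans h
  refine PAModel.induction (P := fun b => b * b + 1 ≤ A k 0 b) (by fun_prop)
    (by rw [A_zero_zero]; simp) (fun b ih => ?_) b
  rw [A_zero_succ]
  refine le_trans ?_ (mul_le_mul' ih hk)
  rcases eq_zero_or_exists_add_one b with rfl | ⟨z, rfl⟩
  · norm_num
  · have : (z + 1 + 1) * (z + 1 + 1) + 1 + (2 * z * z + 2 * z + 1) =
        ((z + 1) * (z + 1) + 1) * 3 := by ring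
    rw [← this]
    exact le_self_add

/-! ### Normal forms -/

/-- `c` has the `k`-normal form `A_a(k,b) * m + n`. -/
def NF (k c a b m n : M) : Prop :=
  c = A k a b * m + n ∧ A k a 0 ≤ c ∧ c < A k (a + 1) 0 ∧ A k a b ≤ c ∧ c < A k a (b + 1) ∧
    n < A k a b

@[fun_prop]
theorem DP.normalForm {f g h l m n : X → M} (hf : DF M f) (hg : DF M g) (hh : DF M h) (hl : DF M l)
    (hm : DF M m) (hn : DF M n) : DP M fun x => NF (f x) (g x) (h x) (l x) (m x) (n x) := by
  unfold NF
  fun_prop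

theorem exists_NF {k c : M} (hk : 2 ≤ k) (hc : 0 < c) : ∃ a b m n, NF k c a b m n := by
  obtain ⟨a, ha, ha'⟩ := exists_bracket (f := fun a => A k a 0) (by fun_prop)
    (A_zero_strictMono hk) (c := c) (by
      rw [A_zero_zero]; exact one_le_iff.2 hc)
  obtain ⟨b, hb, hb'⟩ := exists_bracket (f := fun b => A k a b) (by fun_prop)
    (A_strictMono hk a) ha
  obtain ⟨m, n, h, hn⟩ := exists_div_mod (A_pos hk a b) c
  exact ⟨a, b, m, n, h, ha, ha', hb, hb', hn⟩

/-- Comparison of numbers by their normal forms. -/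
theorem NF.compare {k c d a b m n a' b' m' n' : M} (hk : 2 ≤ k) (h : NF k c a b m n)
    (h' : NF k d a' b' m' n') (hcd : c ≤ d) : a < a' ∨ a = a' ∧ (b < b' ∨ b = b' ∧
      (m < m' ∨ m = m' ∧ n ≤ n')) := by
  rcases (le_of_bracket (A_zero_strictMono hk) h.2.1 hcd h'.2.2.1).lt_or_eq with ha | rfl
  · exact Or.inl ha
  refine Or.inr ⟨rfl, ?_⟩
  rcases (le_of_bracket (A_strictMono hk a) h.2.2.2.1 hcd h'.2.2.2.2.1).lt_or_eq with hb | rfl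
  · exact Or.inl hb
  refine Or.inr ⟨rfl, ?_⟩
  rcases lt_trichotomy m m' with hm | rfl | hm
  · exact Or.inl hm
  · rw [h.1, h'.1] at hcd
    exact Or.inr ⟨rfl, le_of_add_le_add_left hcd⟩
  · have h1 : A k a b * (m' + 1) ≤ A k a b * m := by
      have := add_one_le_iff.2 hm
      gcongr
    have h2 : d < c := calc
      d = A k a b * m' + n' := h'.1
      _ < A k a b * m' + A k a b := by have := h'.2.2.2.2.2; gcongr
      _ = A k a b * (m' + 1) := by ring
      _ ≤ A k a b * m + n := h1.trans le_self_add
      _ = c := h.1.symm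
    exact absurd h2 (not_lt.2 hcd)

theorem NF.unique {k c a b m n a' b' m' n' : M} (hk : 2 ≤ k) (h : NF k c a b m n)
    (h' : NF k c a' b' m' n') : a = a' ∧ b = b' ∧ m = m' ∧ n = n' := by
  rcases h.compare hk h' le_rfl with h1 | ⟨rfl, h1⟩ <;>
    rcases h'.compare hk h le_rfl with h2 | ⟨h3, h2⟩
  · exact absurd h1 h2.not_gt
  · exact absurd h3 h1.ne'
  · exact absurd h2 (lt_irrefl _)
  rcases h1 with h1 | ⟨rfl, h1⟩ <;> rcases h2 with h2 | ⟨h3, h2⟩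
  · exact absurd h1 h2.not_gt
  · exact absurd h3 h1.ne'
  · exact absurd h2 (lt_irrefl _)
  rcases h1 with h1 | ⟨rfl, h1⟩ <;> rcases h2 with h2 | ⟨h3, h2⟩
  · exact absurd h1 h2.not_gt
  · exact absurd h3 h1.ne'
  · exact absurd h2 (lt_irrefl _)
  exact ⟨rfl, rfl, rfl, le_antisymm h1 h2⟩

theorem NF.pos {k c a b m n : M} (h : NF k c a b m n) : 0 < m := by
  rw [pos_iff_ne_zero]
  rintro rfl
  have h1 := h.2.2.2.1
  rw [h.1, mul_zero, zero_add] at h1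
  exact absurd h.2.2.2.2.2 (not_lt.2 h1)

theorem NF.lt {k c a b m n : M} (hk : 2 ≤ k) (h : NF k c a b m n) : b < c ∧ n < c :=
  ⟨(lt_A hk a b).trans_le h.2.2.2.1, h.2.2.2.2.2.trans_le h.2.2.2.1⟩

end PeanoArithmetic

/-! ### The base change -/

namespace PeanoArithmetic

open FirstOrder Language

variable {M : Type} [PAModel M] {X Y : Type} [Ctx M X] [Ctx M Y]

/-- Code of the fact `c[k ← k+1] = v`. -/
def bcCode (k c v : M) : M := pr k (pr c v)

/-- The recursion clauses of the base change. -/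
def BcJ (S : M → Prop) (t : M) : Prop :=
  (∃ k, t = bcCode k 0 0) ∨
  ∃ k c a b m n vb vn w, t = bcCode k c (w * m + vn) ∧ NF k c a b m n ∧ S (bcCode k b vb) ∧
    S (bcCode k n vn) ∧ AckR (k + 1) a vb w

theorem isFinitary_bcJ : IsFinitary (BcJ (M := M)) where
  mono := by
    rintro S S' t h (⟨k, ht⟩ | ⟨k, c, a, b, m, n, vb, vn, w, ht, h0, h1, h2, h3⟩)
    · exact Or.inl ⟨k, ht⟩
    · exact Or.inr ⟨k, c, a, b, m, n, vb, vn, w, ht, h0, h _ h1, h _ h2, h3⟩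
  exists_finset := by
    classical
    rintro S t (⟨k, ht⟩ | ⟨k, c, a, b, m, n, vb, vn, w, ht, h0, h1, h2, h3⟩)
    · exact ⟨∅, by simp, Or.inl ⟨k, ht⟩⟩
    · exact ⟨{_, _}, by simpa using ⟨h1, h2⟩, Or.inr
        ⟨k, c, a, b, m, n, vb, vn, w, ht, h0, Finset.mem_insert_self _ _, by simp, h3⟩⟩

/-- The graph of the base change. -/
def BcR (k c v : M) : Prop := Der BcJ (bcCode k c v)

@[fun_prop]
theorem DP.bcR {f g h : X → M} (hf : DF M f) (hg : DF M g) (hh : DF M h) :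
    DP M fun x => BcR (f x) (g x) (h x) := by
  have key : DP M fun t : M => Der BcJ t := by
    unfold Der BcJ bcCode
    fun_prop
  unfold BcR bcCode
  exact key.comp (by fun_prop)

theorem bcR_zero {k v : M} (hk : 2 ≤ k) : BcR k 0 v ↔ v = 0 := by
  unfold BcR
  rw [isFinitary_bcJ.der_iff]
  constructor
  · rintro (⟨k, ht⟩ | ⟨k', c, a, b, m, n, vb, vn, w, ht, h0, -⟩)
    · exact (pr_inj.1 (pr_inj.1 ht).2).2
    · obtain rfl := (pr_inj.1 ht).1
      obtain rfl := (pr_inj.1 (pr_inj.1 ht).2).1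
      exact (not_lt_zero (h0.lt hk).1).elim
  · rintro rfl
    exact Or.inl ⟨k, rfl⟩

theorem bcR_of_NF {k c a b m n v : M} (hk : 2 ≤ k) (h : NF k c a b m n) :
    BcR k c v ↔ ∃ vb vn, BcR k b vb ∧ BcR k n vn ∧ v = A (k + 1) a vb * m + vn := by
  unfold BcR
  rw [isFinitary_bcJ.der_iff]
  constructor
  · rintro (⟨k, ht⟩ | ⟨k', c', a', b', m', n', vb, vn, w, ht, h0, h1, h2, h3⟩)
    · obtain rfl := (pr_inj.1 (pr_inj.1 ht).2).1
      exact (not_lt_zero (h.lt hk).1).elim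
    · have ht' := pr_inj.1 ht
      obtain rfl := ht'.1
      obtain ⟨rfl, rfl⟩ := pr_inj.1 ht'.2
      obtain ⟨rfl, rfl, rfl, rfl⟩ := h.unique hk h0
      rw [← A_eq_iff] at h3
      exact ⟨vb, vn, h1, h2, by rw [h3]⟩
  · rintro ⟨vb, vn, h1, h2, rfl⟩
    exact Or.inr ⟨k, c, a, b, m, n, vb, vn, _, rfl, h, h1, h2, A_eq_iff.1 rfl⟩

theorem existsUnique_bcR {k : M} (hk : 2 ≤ k) (c : M) : ∃! v, BcR k c v := by
  refine strong_induction (P := fun c => ∃! v, BcR k c v) (by fun_prop) (fun c ih => ?_) c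
  rcases eq_zero_or_pos c with rfl | hc
  · simp [bcR_zero hk]
  obtain ⟨a, b, m, n, h⟩ := exists_NF hk hc
  obtain ⟨vb, hb, hbu⟩ := ih b (h.lt hk).1
  obtain ⟨vn, hn, hnu⟩ := ih n (h.lt hk).2
  refine ⟨_, (bcR_of_NF hk h).2 ⟨vb, vn, hb, hn, rfl⟩, fun v hv => ?_⟩
  obtain ⟨vb', vn', hb', hn', rfl⟩ := (bcR_of_NF hk h).1 hv
  rw [hbu vb' hb', hnu vn' hn']

/-- Bases are written `j + 2`, so that base change and ordinal assignment are functions of all `j`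
without a side condition. -/
theorem two_le_add_two (j : M) : 2 ≤ j + 2 := le_add_self

/-- The base change `c[j+2 ← j+3]`. -/
noncomputable def Bc (j c : M) : M := (existsUnique_bcR (two_le_add_two j) c).choose

theorem Bc_eq_iff {j c v : M} : Bc j c = v ↔ BcR (j + 2) c v := by
  have h := (existsUnique_bcR (two_le_add_two j) c).choose_spec
  exact ⟨fun e => e ▸ h.1, fun e => (h.2 v e).symm⟩

@[fun_prop]
theorem DF.bc {f g : X → M} (hf : DF M f) (hg : DF M g) : DF M fun x => Bc (f x) (g x) :=
  .of_iff (P := fun x y => BcR (f x + 2) (g x) y) (by fun_prop) fun _ _ => Bc_eq_iff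

theorem Bc_zero (j : M) : Bc j 0 = 0 := Bc_eq_iff.2 ((bcR_zero (two_le_add_two j)).2 rfl)

theorem Bc_of_NF {j c a b m n : M} (h : NF (j + 2) c a b m n) :
    Bc j c = A (j + 2 + 1) a (Bc j b) * m + Bc j n :=
  Bc_eq_iff.2 ((bcR_of_NF (two_le_add_two j) h).2
    ⟨_, _, Bc_eq_iff.1 rfl, Bc_eq_iff.1 rfl, rfl⟩)

/-- The properties of the base change at `c` that are proved by simultaneous induction. -/
structure BcGood (j c : M) : Prop where
  le : c ≤ Bc j c
  mono : ∀ d < c, Bc j d < Bc j c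
  -- The version for iterates is the inductive form of the bound below `A_{a+1}(k,0)`, which is the
  -- `k`-fold iterate at `0`.
  lt_It : ∀ a i, i ≤ j + 2 → c < It (j + 2) a i 0 → Bc j c < It (j + 2 + 1) a i 0
  of_NF : ∀ a b m n, NF (j + 2) c a b m n → Bc j n < A (j + 2 + 1) a (Bc j b) ∧
    Bc j c < A (j + 2 + 1) a (Bc j b + 1) ∧ Bc j c < A (j + 2 + 1) (a + 1) 0

/-- The conjunction is the form in which definability can be derived, as required for induction in
the model. -/
theorem bcGood_iff {j c : M} : BcGood j c ↔ c ≤ Bc j c ∧ (∀ d < c, Bc j d < Bc j c) ∧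
    (∀ a i, i ≤ j + 2 → c < It (j + 2) a i 0 → Bc j c < It (j + 2 + 1) a i 0) ∧
    ∀ a b m n, NF (j + 2) c a b m n → Bc j n < A (j + 2 + 1) a (Bc j b) ∧
      Bc j c < A (j + 2 + 1) a (Bc j b + 1) ∧ Bc j c < A (j + 2 + 1) (a + 1) 0 :=
  ⟨fun h => ⟨h.1, h.2, h.3, h.4⟩, fun h => ⟨h.1, h.2.1, h.2.2.1, h.2.2.2⟩⟩

theorem bcGood_zero (j : M) : BcGood j 0 where
  le := zero_le
  mono d hd := (not_lt_zero hd).elim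
  lt_It a i hi h := by
    rw [Bc_zero]
    exact h.trans_le (It_mono ((two_le_add_two j).trans le_self_add)
      (A_mono_base (two_le_add_two j) le_self_add a) le_rfl le_rfl)
  of_NF a b m n h := (not_lt_zero (h.lt (two_le_add_two j)).1).elim

/-- Either the index of `n` is below `a`, and the bound by the next index suffices; or the indices
agree, the argument of `n` is below `b`, and the base change is monotone at `b`. -/
theorem BcGood.rem_lt {j c a b m n : M} (ih : ∀ d < c, BcGood j d)
    (h : NF (j + 2) c a b m n) :
    Bc j n < A (j + 2 + 1) a (Bc j b) := by
  have hk := two_le_add_two j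
  have hk' : 2 ≤ j + 2 + 1 := hk.trans le_self_add
  rcases eq_zero_or_pos n with rfl | hn
  · rw [Bc_zero]; exact A_pos hk' _ _
  obtain ⟨a', b', m', n', h'⟩ := exists_NF hk hn
  have hG := (ih n (h.lt hk).2).of_NF _ _ _ _ h'
  rcases (le_of_bracket (A_zero_strictMono hk) h'.2.1 (h.lt hk).2.le h.2.2.1).lt_or_eq with ha | rfl
  · calc Bc j n < A (j + 2 + 1) (a' + 1) 0 := hG.2.2
      _ ≤ A (j + 2 + 1) a 0 := (A_zero_strictMono hk').monotone (add_one_le_iff.2 ha)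
      _ ≤ _ := A_mono hk' a zero_le
  · have hb : b' < b := (A_strictMono hk a').lt_iff_lt.1 (h'.2.2.2.1.trans_lt h.2.2.2.2.2)
    exact hG.2.1.trans_le (A_mono hk' _ (add_one_le_iff.2 ((ih b (h.lt hk).1).mono b' hb)))

/-- With `u = A_a(k+1, Bc b)` the value is below `u (m + 1)`. For `a = 0` one has `m < k`, so `m +
1` is at most the new base. For index `a + 1` let `y` be the `k`-fold iterate of `A_a(k+1,·)` at
`u`; then `u ≤ y` and `m + 1 ≤ y`, so the product is at most `y * y ≤ A_a(k+1,y)`, and this is the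
additional iteration of base `k + 1`. -/
theorem BcGood.lt_A_succ_right {j c a b m n : M} (ih : ∀ d < c, BcGood j d)
    (h : NF (j + 2) c a b m n) :
    Bc j c < A (j + 2 + 1) a (Bc j b + 1) := by
  have hk := two_le_add_two j
  have hk' : 2 ≤ j + 2 + 1 := hk.trans le_self_add
  have hA := A_pos hk a b
  have h1 : Bc j c < A (j + 2 + 1) a (Bc j b) * (m + 1) := by
    rw [Bc_of_NF h, mul_add, mul_one]
    have := BcGood.rem_lt ih h
    gcongr
  refine h1.trans_le ?_
  have hc : A (j + 2) a b * m ≤ c := by conv_rhs => rw [h.1]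
                                        exact le_self_add
  rcases eq_zero_or_exists_add_one a with rfl | ⟨a, rfl⟩
  · have hm : m < j + 2 := by
      have := hc.trans_lt h.2.2.2.2.1
      rw [A_zero_succ] at this
      exact lt_of_mul_lt_mul_left this zero_le
    rw [A_zero_succ]
    have : m + 1 ≤ j + 2 + 1 := add_le_add hm.le le_rfl
    gcongr
  · have hu := (A_mono hk (a + 1) (ih b (h.lt hk).1).le).trans
      (A_mono_base hk (le_self_add (b := 1)) (a + 1) (Bc j b))
    set u := A (j + 2 + 1) (a + 1) (Bc j b) with hu_def
    have hy : m + 1 ≤ It (j + 2 + 1) a (j + 2) u := by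
      have h2 := h.2.2.2.2.1
      rw [A_succ_succ] at h2
      rw [add_one_le_iff]
      calc m ≤ A (j + 2) (a + 1) b * m := le_mul_of_one_le_left zero_le (one_le_iff.2 hA)
        _ ≤ c := hc
        _ < _ := h2
        _ ≤ _ := It_mono hk' (A_mono_base hk le_self_add a) le_rfl hu
    rw [A_succ_succ, It_succ, ← hu_def]
    have hy' := le_It hk' a (j + 2) u
    refine (mul_le_mul' hy' hy).trans (sq_le_A ?_ _ _)
    have : j + 2 + 1 = j + 3 := by ring
    rw [this]
    exact le_add_self

/-- Removing the outermost `A_a` bounds `b` by the shorter iterate; the induction hypothesis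
transfers this to the new base and `BcGood.lt_A_succ_right` restores the outer application. -/
theorem BcGood.lt_It_succ {j c a b m n i : M} (ih : ∀ d < c, BcGood j d)
    (h : NF (j + 2) c a b m n) (hi : c < It (j + 2) a (i + 1) 0) (hij : i ≤ j + 2) :
    Bc j c < It (j + 2 + 1) a (i + 1) 0 := by
  have hk := two_le_add_two j
  have hk' : 2 ≤ j + 2 + 1 := hk.trans le_self_add
  rw [It_succ] at hi ⊢
  have hb : b < It (j + 2) a i 0 := (A_strictMono hk a).lt_iff_lt.1 (h.2.2.2.1.trans_lt hi)
  exact (BcGood.lt_A_succ_right ih h).trans_le (A_mono hk' _ (add_one_le_iff.2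
    ((ih b (h.lt hk).1).lt_It a i hij hb)))

/-- The bound by the `k`-fold iterate at `0` survives the base change, and in base `k + 1` one
iteration more is available. -/
theorem BcGood.lt_A_succ_left {j c a b m n : M} (ih : ∀ d < c, BcGood j d)
    (h : NF (j + 2) c a b m n) :
    Bc j c < A (j + 2 + 1) (a + 1) 0 := by
  have hk' : 2 ≤ j + 2 + 1 := (two_le_add_two j).trans le_self_add
  have h1 := h.2.2.1
  have e : j + 2 = j + 1 + 1 := by ring
  rw [A_succ_zero]
  refine (?_ : Bc j c < It (j + 2 + 1) a (j + 2) 0).trans_le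
    ((It_strictMono (lt_A hk' a) 0).monotone le_self_add)
  rw [A_succ_zero] at h1
  have h2 := BcGood.lt_It_succ ih h (i := j + 1) (by rwa [← e]) (by rw [e]; exact le_self_add)
  rwa [← e] at h2

theorem BcGood.step {j c a b m n : M} (ih : ∀ d < c, BcGood j d)
    (h : NF (j + 2) c a b m n) :
    BcGood j c := by
  have hk := two_le_add_two j
  have hk' : 2 ≤ j + 2 + 1 := hk.trans le_self_add
  have hAle : A (j + 2 + 1) a (Bc j b) ≤ Bc j c := by
    rw [Bc_of_NF h]
    exact (le_mul_of_one_le_right zero_le (one_le_iff.2 h.pos)).trans le_self_add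
  have hle : c ≤ Bc j c := by
    rw [Bc_of_NF h]
    conv_lhs => rw [h.1]
    have h1 := (A_mono hk a (ih b (h.lt hk).1).le).trans
      (A_mono_base hk (le_self_add (b := 1)) a (Bc j b))
    have h2 := (ih n (h.lt hk).2).le
    gcongr
  refine ⟨hle, fun d hd => ?_, fun a' i hi hc => ?_, fun a' b' m' n' h' => ?_⟩
  · rcases eq_zero_or_pos d with rfl | hd0
    · rw [Bc_zero]
      exact hd.trans_le hle
    obtain ⟨a', b', m', n', h'⟩ := exists_NF hk hd0
    have hG := (ih d hd).of_NF _ _ _ _ h'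
    -- The cases are the first place at which the normal forms of `d` and `c` differ.
    rcases h'.compare hk h hd.le with ha | ⟨rfl, hb | ⟨rfl, hm | ⟨rfl, hn⟩⟩⟩
    · calc Bc j d < A (j + 2 + 1) (a' + 1) 0 := hG.2.2
        _ ≤ A (j + 2 + 1) a 0 := (A_zero_strictMono hk').monotone (add_one_le_iff.2 ha)
        _ ≤ _ := A_mono hk' a zero_le
        _ ≤ _ := hAle
    · exact hG.2.1.trans_le ((A_mono hk' _
        (add_one_le_iff.2 ((ih b (h.lt hk).1).mono b' hb))).trans hAle)
    · rw [Bc_of_NF h, Bc_of_NF h']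
      calc _ < A (j + 2 + 1) a' (Bc j b') * m' + A (j + 2 + 1) a' (Bc j b') := by
            have := hG.1
            gcongr
        _ = A (j + 2 + 1) a' (Bc j b') * (m' + 1) := by ring
        _ ≤ A (j + 2 + 1) a' (Bc j b') * m := by
            have := add_one_le_iff.2 hm
            gcongr
        _ ≤ _ := le_self_add
    · have hn' : n' < n := lt_of_le_of_ne hn (by
        rintro rfl
        exact hd.ne (h'.1.trans h.1.symm))
      rw [Bc_of_NF h, Bc_of_NF h']
      have := (ih n (h.lt hk).2).mono n' hn'
      gcongr
  · rcases eq_zero_or_exists_add_one i with rfl | ⟨i, rfl⟩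
    · rw [It_zero] at hc
      exact (not_lt_zero hc).elim
    -- At most `k` iterations stay below `A_{a'+1}(k,0)`, so the index of `c` is at most `a'`.
    have ha : a ≤ a' := by
      refine le_of_bracket (A_zero_strictMono hk) h.2.1 le_rfl (hc.trans_le ?_)
      rw [A_succ_zero]
      exact (It_strictMono (lt_A hk a') 0).monotone hi
    rcases ha.lt_or_eq with ha | rfl
    · calc Bc j c < A (j + 2 + 1) (a + 1) 0 := BcGood.lt_A_succ_left ih h
        _ ≤ A (j + 2 + 1) a' 0 := (A_zero_strictMono hk').monotone (add_one_le_iff.2 ha)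
        _ ≤ _ := by rw [It_succ]; exact A_mono hk' a' zero_le
    · exact BcGood.lt_It_succ ih h hc ((lt_add_one i).le.trans hi)
  · obtain ⟨rfl, rfl, rfl, rfl⟩ := h.unique hk h'
    exact ⟨BcGood.rem_lt ih h, BcGood.lt_A_succ_right ih h, BcGood.lt_A_succ_left ih h⟩

theorem bcGood (j c : M) : BcGood j c := by
  refine strong_induction (P := fun c => BcGood j c) ?_ (fun c ih => ?_) c
  · simp only [bcGood_iff]
    fun_prop
  · rcases eq_zero_or_pos c with rfl | hc
    · exact bcGood_zero j
    · obtain ⟨a, b, m, n, h⟩ := exists_NF (two_le_add_two j) hc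
      exact BcGood.step ih h

/-- The base change preserves normal forms. -/
theorem NF.bc {j c a b m n : M} (h : NF (j + 2) c a b m n) :
    NF (j + 2 + 1) (Bc j c) a (Bc j b) m (Bc j n) := by
  have hk' : 2 ≤ j + 2 + 1 := (two_le_add_two j).trans le_self_add
  obtain ⟨h1, h2, h3⟩ := (bcGood j c).of_NF _ _ _ _ h
  have hAle : A (j + 2 + 1) a (Bc j b) ≤ Bc j c := by
    rw [Bc_of_NF h]
    exact (le_mul_of_one_le_right zero_le (one_le_iff.2 h.pos)).trans le_self_add
  exact ⟨Bc_of_NF h, (A_mono hk' a zero_le).trans hAle, h3, hAle, h2, h1⟩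

end PeanoArithmetic

/-! ### Ordinal notations -/

namespace PeanoArithmetic

open FirstOrder Language

variable {M : Type} [PAModel M] {X Y : Type} [Ctx M X] [Ctx M Y]

/-- The code of the notation `[a, e, r]`. -/
def oa (a e r : M) : M := pr a (pr e r) + 1

theorem oa_inj {a e r a' e' r' : M} : oa a e r = oa a' e' r' ↔ a = a' ∧ e = e' ∧ r = r' := by
  unfold oa
  rw [add_left_inj, pr_inj, pr_inj]

theorem oa_ne_zero (a e r : M) : oa a e r ≠ 0 := (zero_ne_add_one _).symm

@[fun_prop]
theorem DF.oa {f g h : X → M} (hf : DF M f) (hg : DF M g) (hh : DF M h) :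
    DF M fun x => oa (f x) (g x) (h x) := by
  unfold PeanoArithmetic.oa
  fun_prop

/-- Clauses for the order of notations. -/
def OrdLtJ (S : M → Prop) (t : M) : Prop :=
  (∃ a e r, t = pr 0 (oa a e r)) ∨
  ∃ a e r a' e' r', t = pr (oa a e r) (oa a' e' r') ∧
    (a < a' ∨ (a = a' ∧ S (pr e e')) ∨ (a = a' ∧ e = e' ∧ S (pr r r')))

theorem isFinitary_ordLtJ : IsFinitary (OrdLtJ (M := M)) where
  mono := by
    rintro S S' t h (⟨a, e, r, ht⟩ | ⟨a, e, r, a', e', r', ht, h1⟩)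
    · exact Or.inl ⟨a, e, r, ht⟩
    · exact Or.inr ⟨a, e, r, a', e', r', ht,
        h1.imp_right (Or.imp (And.imp_right (h _)) (And.imp_right (And.imp_right (h _))))⟩
  exists_finset := by
    classical
    rintro S t (⟨a, e, r, ht⟩ | ⟨a, e, r, a', e', r', ht, h1 | ⟨h1, h2⟩ | ⟨h1, h2, h3⟩⟩)
    · exact ⟨∅, by simp, Or.inl ⟨a, e, r, ht⟩⟩
    · exact ⟨∅, by simp, Or.inr ⟨a, e, r, a', e', r', ht, Or.inl h1⟩⟩
    · exact ⟨{_}, by simpa using h2, Or.inr ⟨a, e, r, a', e', r', ht,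
        Or.inr (Or.inl ⟨h1, Finset.mem_singleton_self _⟩)⟩⟩
    · exact ⟨{_}, by simpa using h3, Or.inr ⟨a, e, r, a', e', r', ht,
        Or.inr (Or.inr ⟨h1, h2, Finset.mem_singleton_self _⟩)⟩⟩

/-- The order of notations. -/
def OrdLt (t s : M) : Prop := Der OrdLtJ (pr t s)

@[fun_prop]
theorem DP.ordLt {f g : X → M} (hf : DF M f) (hg : DF M g) :
    DP M fun x => OrdLt (f x) (g x) := by
  have key : DP M fun t : M => Der OrdLtJ t := by
    unfold Der OrdLtJ
    fun_prop
  unfold OrdLt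
  exact key.comp (by fun_prop)

theorem ordLt_iff {t s : M} : OrdLt t s ↔ (t = 0 ∧ ∃ a e r, s = oa a e r) ∨
    ∃ a e r a' e' r', t = oa a e r ∧ s = oa a' e' r' ∧
      (a < a' ∨ (a = a' ∧ OrdLt e e') ∨ (a = a' ∧ e = e' ∧ OrdLt r r')) := by
  unfold OrdLt
  rw [isFinitary_ordLtJ.der_iff]
  simp only [OrdLtJ, pr_inj, exists_and_left, and_assoc]

/-- Clauses for being a notation in normal form. -/
def OrdJ (S : M → Prop) (t : M) : Prop :=
  t = 0 ∨ ∃ a e r, t = oa a e r ∧ S e ∧ S r ∧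
    (e = 0 ∨ ∃ a' e' r', e = oa a' e' r' ∧ a' ≤ a) ∧
    (r = 0 ∨ ∃ a' e' r', r = oa a' e' r' ∧ (a' < a ∨ (a' = a ∧ (e' = e ∨ OrdLt e' e))))

theorem isFinitary_ordJ : IsFinitary (OrdJ (M := M)) where
  mono := by
    rintro S S' t h (ht | ⟨a, e, r, ht, h1, h2, h3⟩)
    · exact Or.inl ht
    · exact Or.inr ⟨a, e, r, ht, h _ h1, h _ h2, h3⟩
  exists_finset := by
    classical
    rintro S t (ht | ⟨a, e, r, ht, h1, h2, h3⟩)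
    · exact ⟨∅, by simp, Or.inl ht⟩
    · exact ⟨{e, r}, by simpa using ⟨h1, h2⟩, Or.inr ⟨a, e, r, ht, by simp, by simp, h3⟩⟩

/-- Notations in normal form. -/
def IsOrd (t : M) : Prop := Der OrdJ t

theorem isOrd_iff {t : M} : IsOrd t ↔ OrdJ IsOrd t := isFinitary_ordJ.der_iff

@[fun_prop]
theorem DP.isOrd {f : X → M} (hf : DF M f) : DP M fun x => IsOrd (f x) := by
  have key : DP M fun t : M => IsOrd t := by
    unfold IsOrd Der OrdJ
    fun_prop
  exact key.comp hf

/-! ### The ordinals of numbers -/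

/-- Code of the fact that `c` has the ordinal `v` with respect to base `k`. -/
def ovCode (k c v : M) : M := pr k (pr c v)

/-- The recursion clauses of the ordinal assignment. -/
def OvJ (S : M → Prop) (t : M) : Prop :=
  (∃ k, t = ovCode k 0 0) ∨
  ∃ k c a b m n d vb vd, t = ovCode k c (oa a vb vd) ∧ NF k c a b m n ∧ c = A k a b + d ∧
    S (ovCode k b vb) ∧ S (ovCode k d vd)

theorem isFinitary_ovJ : IsFinitary (OvJ (M := M)) where
  mono := by
    rintro S S' t h (⟨k, ht⟩ | ⟨k, c, a, b, m, n, d, vb, vd, ht, h0, h1, h2, h3⟩)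
    · exact Or.inl ⟨k, ht⟩
    · exact Or.inr ⟨k, c, a, b, m, n, d, vb, vd, ht, h0, h1, h _ h2, h _ h3⟩
  exists_finset := by
    classical
    rintro S t (⟨k, ht⟩ | ⟨k, c, a, b, m, n, d, vb, vd, ht, h0, h1, h2, h3⟩)
    · exact ⟨∅, by simp, Or.inl ⟨k, ht⟩⟩
    · exact ⟨{_, _}, by simpa using ⟨h2, h3⟩, Or.inr
        ⟨k, c, a, b, m, n, d, vb, vd, ht, h0, h1, Finset.mem_insert_self _ _, by simp⟩⟩

/-- The graph of the ordinal assignment. -/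
def OvR (k c v : M) : Prop := Der OvJ (ovCode k c v)

@[fun_prop]
theorem DP.ovR {f g h : X → M} (hf : DF M f) (hg : DF M g) (hh : DF M h) :
    DP M fun x => OvR (f x) (g x) (h x) := by
  have key : DP M fun t : M => Der OvJ t := by
    unfold Der OvJ ovCode
    fun_prop
  unfold OvR ovCode
  exact key.comp (by fun_prop)

theorem ovR_zero {k v : M} (hk : 2 ≤ k) : OvR k 0 v ↔ v = 0 := by
  unfold OvR
  rw [isFinitary_ovJ.der_iff]
  constructor
  · rintro (⟨k, ht⟩ | ⟨k', c, a, b, m, n, d, vb, vd, ht, h0, -⟩)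
    · exact (pr_inj.1 (pr_inj.1 ht).2).2
    · obtain rfl := (pr_inj.1 ht).1
      obtain rfl := (pr_inj.1 (pr_inj.1 ht).2).1
      exact (not_lt_zero (h0.lt hk).1).elim
  · rintro rfl
    exact Or.inl ⟨k, rfl⟩

/-- One copy of the leading term is split off at a time. The coefficient `m` becomes an `m`-fold
repetition of the term, so notations need no coefficients and no addition. -/
theorem ovR_of_NF {k c a b m n d v : M} (hk : 2 ≤ k) (h : NF k c a b m n) (hd : c = A k a b + d) :
    OvR k c v ↔ ∃ vb vd, OvR k b vb ∧ OvR k d vd ∧ v = oa a vb vd := by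
  unfold OvR
  rw [isFinitary_ovJ.der_iff]
  constructor
  · rintro (⟨k, ht⟩ | ⟨k', c', a', b', m', n', d', vb, vd, ht, h0, h1, h2, h3⟩)
    · obtain rfl := (pr_inj.1 (pr_inj.1 ht).2).1
      exact (not_lt_zero (h.lt hk).1).elim
    · have ht' := pr_inj.1 ht
      obtain rfl := ht'.1
      obtain ⟨rfl, rfl⟩ := pr_inj.1 ht'.2
      obtain ⟨rfl, rfl, rfl, rfl⟩ := h.unique hk h0
      obtain rfl := add_left_cancel (hd.symm.trans h1)
      exact ⟨vb, vd, h2, h3, rfl⟩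
  · rintro ⟨vb, vd, h1, h2, rfl⟩
    exact Or.inr ⟨k, c, a, b, m, n, d, vb, vd, rfl, h, hd, h1, h2⟩

/-- Splitting off the leading term of a normal form. -/
theorem NF.exists_eq_add {k c a b m n : M} (hk : 2 ≤ k) (h : NF k c a b m n) :
    ∃ d, c = A k a b + d ∧ d < c ∧ (m = 1 ∧ d = n ∨ ∃ m', m = m' + 1 ∧ NF k d a b m' n) := by
  obtain ⟨m', rfl⟩ := (eq_zero_or_exists_add_one m).resolve_left h.pos.ne'
  have hc : c = A k a b + (A k a b * m' + n) := by rw [h.1]; ring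
  refine ⟨_, hc, ?_, ?_⟩
  · conv_rhs => rw [hc]
    exact lt_add_of_pos_left _ (A_pos hk a b)
  · rcases eq_zero_or_pos m' with rfl | hm
    · exact Or.inl ⟨zero_add 1, by simp⟩
    · have hle : A k a b ≤ A k a b * m' + n :=
        (le_mul_of_one_le_right zero_le (one_le_iff.2 hm)).trans le_self_add
      have hlt : A k a b * m' + n ≤ c := by conv_rhs => rw [hc]
                                            exact le_add_self
      exact Or.inr ⟨m', rfl, rfl, (A_mono hk a zero_le).trans hle, hlt.trans_lt h.2.2.1, hle,
        hlt.trans_lt h.2.2.2.2.1, h.2.2.2.2.2⟩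

theorem existsUnique_ovR {k : M} (hk : 2 ≤ k) (c : M) : ∃! v, OvR k c v := by
  refine strong_induction (P := fun c => ∃! v, OvR k c v) (by fun_prop) (fun c ih => ?_) c
  rcases eq_zero_or_pos c with rfl | hc
  · simp [ovR_zero hk]
  obtain ⟨a, b, m, n, h⟩ := exists_NF hk hc
  obtain ⟨d, hd, hdc, -⟩ := h.exists_eq_add hk
  obtain ⟨vb, hb, hbu⟩ := ih b (h.lt hk).1
  obtain ⟨vd, hvd, hdu⟩ := ih d hdc
  refine ⟨_, (ovR_of_NF hk h hd).2 ⟨vb, vd, hb, hvd, rfl⟩, fun v hv => ?_⟩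
  obtain ⟨vb', vd', hb', hd', rfl⟩ := (ovR_of_NF hk h hd).1 hv
  rw [hbu vb' hb', hdu vd' hd']

/-- The ordinal of `c` with respect to base `j + 2`. -/
noncomputable def Ov (j c : M) : M := (existsUnique_ovR (two_le_add_two j) c).choose

theorem Ov_eq_iff {j c v : M} : Ov j c = v ↔ OvR (j + 2) c v := by
  have h := (existsUnique_ovR (two_le_add_two j) c).choose_spec
  exact ⟨fun e => e ▸ h.1, fun e => (h.2 v e).symm⟩

@[fun_prop]
theorem DF.ov {f g : X → M} (hf : DF M f) (hg : DF M g) : DF M fun x => Ov (f x) (g x) :=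
  .of_iff (P := fun x y => OvR (f x + 2) (g x) y) (by fun_prop) fun _ _ => Ov_eq_iff

theorem Ov_zero (j : M) : Ov j 0 = 0 := Ov_eq_iff.2 ((ovR_zero (two_le_add_two j)).2 rfl)

theorem Ov_of_NF {j c a b m n d : M} (h : NF (j + 2) c a b m n) (hd : c = A (j + 2) a b + d) :
    Ov j c = oa a (Ov j b) (Ov j d) :=
  Ov_eq_iff.2 ((ovR_of_NF (two_le_add_two j) h hd).2
    ⟨_, _, Ov_eq_iff.1 rfl, Ov_eq_iff.1 rfl, rfl⟩)

theorem Ov_eq_zero_or (j c : M) : (c = 0 ∧ Ov j c = 0) ∨ ∃ a b m n d, NF (j + 2) c a b m n ∧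
    c = A (j + 2) a b + d ∧ d < c ∧ Ov j c = oa a (Ov j b) (Ov j d) := by
  rcases eq_zero_or_pos c with rfl | hc
  · exact Or.inl ⟨rfl, Ov_zero j⟩
  · obtain ⟨a, b, m, n, h⟩ := exists_NF (two_le_add_two j) hc
    obtain ⟨d, hd, hdc, -⟩ := h.exists_eq_add (two_le_add_two j)
    exact Or.inr ⟨a, b, m, n, d, h, hd, hdc, Ov_of_NF h hd⟩

/-- The ordinal assignment is strictly increasing. -/
theorem ordLt_Ov (j c : M) : ∀ d < c, OrdLt (Ov j d) (Ov j c) := by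
  have hk := two_le_add_two j
  refine strong_induction (P := fun c => ∀ d < c, OrdLt (Ov j d) (Ov j c)) (by fun_prop)
    (fun c ih d hd => ?_) c
  rcases Ov_eq_zero_or j c with ⟨rfl, -⟩ | ⟨a, b, m, n, c₁, h, hc₁, hc₁c, e⟩
  · exact (not_lt_zero hd).elim
  rw [e, ordLt_iff]
  rcases Ov_eq_zero_or j d with ⟨rfl, e'⟩ | ⟨a', b', m', n', d₁, h', hd₁, hd₁d, e'⟩
  · exact Or.inl ⟨e', _, _, _, rfl⟩
  refine Or.inr ⟨_, _, _, _, _, _, e', rfl, ?_⟩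
  rcases h'.compare hk h hd.le with ha | ⟨rfl, hb | ⟨rfl, -⟩⟩
  · exact Or.inl ha
  · exact Or.inr (Or.inl ⟨rfl, ih b (h.lt hk).1 b' hb⟩)
  -- With equal index and argument, the common leading term is cancelled.
  · refine Or.inr (Or.inr ⟨rfl, rfl, ih c₁ hc₁c d₁ ?_⟩)
    rw [hc₁, hd₁] at hd
    exact lt_of_add_lt_add_left hd

/-- The normal form conditions mirror `b < c` and `c₁ < c`: the former bounds the index of the
exponent, the latter makes the next term no larger than the leading one. -/
theorem isOrd_Ov (j c : M) : IsOrd (Ov j c) := by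
  have hk := two_le_add_two j
  refine strong_induction (P := fun c => IsOrd (Ov j c)) (by fun_prop) (fun c ih => ?_) c
  rw [isOrd_iff]
  rcases Ov_eq_zero_or j c with ⟨rfl, e⟩ | ⟨a, b, m, n, c₁, h, hc₁, hc₁c, e⟩
  · exact Or.inl e
  have hbc := (h.lt hk).1
  refine Or.inr ⟨_, _, _, e, ih b hbc, ih c₁ hc₁c, ?_, ?_⟩
  · rcases Ov_eq_zero_or j b with ⟨-, e'⟩ | ⟨a', b', m', n', d, h', -, -, e'⟩
    · exact Or.inl e'
    · exact Or.inr ⟨_, _, _, e', le_of_bracket (A_zero_strictMono hk) h'.2.1 hbc.le h.2.2.1⟩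
  · rcases Ov_eq_zero_or j c₁ with ⟨-, e'⟩ | ⟨a', b', m', n', d, h', -, -, e'⟩
    · exact Or.inl e'
    · refine Or.inr ⟨_, _, _, e', ?_⟩
      rcases h'.compare hk h hc₁c.le with ha | ⟨rfl, hb | ⟨rfl, -⟩⟩
      · exact Or.inl ha
      · exact Or.inr ⟨rfl, Or.inr (ordLt_Ov j b b' hb)⟩
      · exact Or.inr ⟨rfl, Or.inl rfl⟩

/-- The base change preserves the ordinal assignment. -/
theorem Ov_Bc (j c : M) : Ov (j + 1) (Bc j c) = Ov j c := by
  have hk := two_le_add_two j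
  have hj : j + 1 + 2 = j + 2 + 1 := by ring
  refine strong_induction (P := fun c => Ov (j + 1) (Bc j c) = Ov j c) (by fun_prop)
    (fun c ih => ?_) c
  rcases eq_zero_or_pos c with rfl | hc
  · rw [Bc_zero, Ov_zero, Ov_zero]
  obtain ⟨a, b, m, n, h⟩ := exists_NF hk hc
  obtain ⟨d, hd, hdc, hd'⟩ := h.exists_eq_add hk
  -- The base change commutes with splitting off the leading term: the rest is `n`, or it has the
  -- same normal form with the coefficient lowered by one.
  have h1 : Bc j c = A (j + 2 + 1) a (Bc j b) + Bc j d := by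
    rw [Bc_of_NF h]
    rcases hd' with ⟨rfl, rfl⟩ | ⟨m', rfl, hd'⟩
    · rw [mul_one]
    · rw [Bc_of_NF hd']
      ring
  have h2 := h.bc
  rw [← hj] at h1 h2
  rw [Ov_of_NF h2 h1, Ov_of_NF h hd, ih b (h.lt hk).1, ih d hdc]

end PeanoArithmetic

/-! ### The Goodstein process in models of Peano arithmetic -/

namespace PeanoArithmetic

open FirstOrder Language

variable {M : Type} [PAModel M] {X Y : Type} [Ctx M X] [Ctx M Y]

/-- Code of the fact `b_k(ℓ) = v`. -/
def gsCode (l k v : M) : M := pr l (pr k v)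

/-- The recursion clauses of the Goodstein process. -/
def GsJ (S : M → Prop) (t : M) : Prop :=
  (∃ l, t = gsCode l 0 l) ∨
  (∃ l k, t = gsCode l (k + 1) 0 ∧ S (gsCode l k 0)) ∨
  ∃ l k u v, t = gsCode l (k + 1) v ∧ S (gsCode l k u) ∧ u ≠ 0 ∧ BcR (k + 1 + 1) u (v + 1)

theorem isFinitary_gsJ : IsFinitary (GsJ (M := M)) where
  mono := by
    rintro S S' t h (⟨l, ht⟩ | ⟨l, k, ht, h1⟩ | ⟨l, k, u, v, ht, h1, h2⟩)
    · exact Or.inl ⟨l, ht⟩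
    · exact Or.inr (Or.inl ⟨l, k, ht, h _ h1⟩)
    · exact Or.inr (Or.inr ⟨l, k, u, v, ht, h _ h1, h2⟩)
  exists_finset := by
    rintro S t (⟨l, ht⟩ | ⟨l, k, ht, h1⟩ | ⟨l, k, u, v, ht, h1, h2⟩)
    · exact ⟨∅, by simp, Or.inl ⟨l, ht⟩⟩
    · exact ⟨{_}, by simpa using h1, Or.inr (Or.inl ⟨l, k, ht, Finset.mem_singleton_self _⟩)⟩
    · exact ⟨{_}, by simpa using h1,
        Or.inr (Or.inr ⟨l, k, u, v, ht, Finset.mem_singleton_self _, h2⟩)⟩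

/-- The graph of the Goodstein process. -/
def GsR (l k v : M) : Prop := Der GsJ (gsCode l k v)

@[fun_prop]
theorem DP.gsR {f g h : X → M} (hf : DF M f) (hg : DF M g) (hh : DF M h) :
    DP M fun x => GsR (f x) (g x) (h x) := by
  have key : DP M fun t : M => Der GsJ t := by
    unfold Der GsJ gsCode
    fun_prop
  unfold GsR gsCode
  exact key.comp (by fun_prop)

theorem gsR_zero {l v : M} : GsR l 0 v ↔ v = l := by
  unfold GsR
  rw [isFinitary_gsJ.der_iff]
  simp [GsJ, gsCode, pr_inj, zero_ne_add_one]

theorem gsR_succ {l k v : M} : GsR l (k + 1) v ↔ ∃ u, GsR l k u ∧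
    (u = 0 ∧ v = 0 ∨ u ≠ 0 ∧ Bc k u = v + 1) := by
  have e : k + 1 + 1 = k + 2 := by ring
  unfold GsR
  rw [isFinitary_gsJ.der_iff]
  constructor
  · rintro (⟨l', ht⟩ | ⟨l', k', ht, h1⟩ | ⟨l', k', u, v', ht, h1, h2, h3⟩)
    · exact (zero_ne_add_one k (pr_inj.1 (pr_inj.1 ht).2).1.symm).elim
    · have ht' := pr_inj.1 ht
      obtain rfl := ht'.1
      obtain ⟨hk, rfl⟩ := pr_inj.1 ht'.2
      obtain rfl := add_right_cancel hk
      exact ⟨0, h1, Or.inl ⟨rfl, rfl⟩⟩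
    · have ht' := pr_inj.1 ht
      obtain rfl := ht'.1
      obtain ⟨hk, rfl⟩ := pr_inj.1 ht'.2
      obtain rfl := add_right_cancel hk
      rw [e] at h3
      exact ⟨u, h1, Or.inr ⟨h2, Bc_eq_iff.2 h3⟩⟩
  · rintro ⟨u, h1, ⟨rfl, rfl⟩ | ⟨h2, h3⟩⟩
    · exact Or.inr (Or.inl ⟨l, k, rfl, h1⟩)
    · rw [Bc_eq_iff, ← e] at h3
      exact Or.inr (Or.inr ⟨l, k, u, v, rfl, h1, h2, h3⟩)

/-- Transfinite induction for definable predicates along the notations gives termination of the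
Goodstein process. -/
theorem exists_gsR_zero
    (hTI : ∀ P : M → Prop, DP M P →
      (∀ y, IsOrd y → (∀ z, IsOrd z → OrdLt z y → P z) → P y) → ∀ y, IsOrd y → P y) (l : M) :
    ∃ k, GsR l k 0 := by
  -- The induction predicate says that any stage of the process with ordinal `y` leads to zero;
  -- stage `k` is measured in base `k + 2`.
  have key := hTI (fun y => ∀ k u, GsR l k u → Ov k u = y → ∃ k, GsR l k 0) (by fun_prop) ?_
  · exact key _ (isOrd_Ov 0 l) 0 l (gsR_zero.2 rfl) rfl
  · rintro _ - ih k u hu rfl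
    rcases eq_or_ne u 0 with rfl | h0
    · exact ⟨k, hu⟩
    obtain ⟨v, hv⟩ := (eq_zero_or_exists_add_one _).resolve_left
      ((pos_iff_ne_zero.2 h0).trans_le (bcGood k u).le).ne'
    refine ih _ (isOrd_Ov (k + 1) v) ?_ (k + 1) v (gsR_succ.2 ⟨u, hu, Or.inr ⟨h0, hv⟩⟩) rfl
    rw [← Ov_Bc k u, hv]
    exact ordLt_Ov _ _ _ (lt_add_one v)

/-! ### The meaning of the arithmetical formulas -/

section Realize

variable {N : Type} [arith.Structure N]

theorem realize_exLast {n m : ℕ} {φ : arith.Formula (Fin (n + m))} {v : Fin n → N} :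
    (exLast m φ).Realize v ↔ ∃ w : Fin m → N, φ.Realize (Fin.append v w) := by
  rw [exLast, BoundedFormula.realize_exs]
  refine exists_congr fun w => ?_
  rw [BoundedFormula.realize_relabel]
  unfold Formula.Realize
  congr! 1
  funext i
  refine Fin.addCases (fun i => ?_) (fun i => ?_) i <;> simp

theorem realize_allLast {n m : ℕ} {φ : arith.Formula (Fin (n + m))} {v : Fin n → N} :
    (allLast m φ).Realize v ↔ ∀ w : Fin m → N, φ.Realize (Fin.append v w) := by
  rw [allLast, BoundedFormula.realize_alls]
  refine forall_congr' fun w => ?_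
  rw [BoundedFormula.realize_relabel]
  unfold Formula.Realize
  congr! 1
  funext i
  refine Fin.addCases (fun i => ?_) (fun i => ?_) i <;> simp

theorem realize_univClosure {n : ℕ} {φ : arith.Formula (Fin n)} :
    N ⊨ (univClosure φ) ↔ ∀ v : Fin n → N, φ.Realize v := by
  unfold Sentence.Realize
  rw [univClosure, BoundedFormula.realize_alls]
  refine forall_congr' fun w => ?_
  rw [BoundedFormula.realize_relabel]
  unfold Formula.Realize
  congr! 1

theorem realize_subst' {n m : ℕ} {φ : arith.Formula (Fin n)} {f : Fin n → arith.Term (Fin m)}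
    {v : Fin m → N} : Formula.Realize (BoundedFormula.subst φ f) v ↔
      φ.Realize fun i => (f i).realize v := BoundedFormula.realize_subst

theorem realize_eq {n : ℕ} {t s : arith.Term (Fin n)} {v : Fin n → N} :
    (eq t s).Realize v ↔ t.realize v = s.realize v := Formula.realize_equal

end Realize

theorem realize_x {N : Type} [arith.Structure N] {n : ℕ} (i : Fin n) (v : Fin n → N) :
    (x i).realize v = v i := rfl

variable {n : ℕ} {v : Fin n → M}

theorem realize_zero : (0 : arith.Term (Fin n)).realize v = 0 := PAModel.funMap_zero _

theorem realize_S (t : arith.Term (Fin n)) : (S t).realize v = t.realize v + 1 :=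
  PAModel.funMap_succ _

theorem realize_add (t s : arith.Term (Fin n)) :
    (t + s).realize v = t.realize v + s.realize v := PAModel.funMap_add _

theorem realize_mul (t s : arith.Term (Fin n)) :
    (t * s).realize v = t.realize v * s.realize v := PAModel.funMap_mul _

theorem realize_pair (t s : arith.Term (Fin n)) :
    (pair t s).realize v = pr (t.realize v) (s.realize v) := by
  simp only [pair, pr, realize_add, realize_mul]

theorem realize_le {t s : arith.Term (Fin n)} :
    (le t s).Realize v ↔ t.realize v ≤ s.realize v := by
  simp only [le, realize_subst', realize_exLast, realize_eq, realize_add, realize_x,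
    Fin.exists_fin_succ_pi, Fin.exists_fin_zero_pi, le_iff_exists_add]
  exact exists_congr fun a => eq_comm

theorem realize_lt {t s : arith.Term (Fin n)} :
    (lt t s).Realize v ↔ t.realize v < s.realize v := by
  rw [lt, realize_le, realize_S, add_one_le_iff]

theorem realize_mem {t c d N : arith.Term (Fin n)} :
    (mem t c d N).Realize v ↔ Mem (t.realize v) (c.realize v) (d.realize v) (N.realize v) := by
  simp only [mem, realize_subst', realize_exLast, realize_eq, realize_mul, realize_x, realize_S,
    Fin.exists_fin_succ_pi, Fin.exists_fin_zero_pi, realize_lt, Formula.realize_inf]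
  refine and_congr Iff.rfl (exists_congr fun a => ?_)
  rw [mul_comm]
  rfl

/-- Agreement of `J` with `K` on coded sets suffices, because `derivable` evaluates `J` at no other
sets. -/
theorem realize_derivable {J : arith.Formula (Fin 4)} {K : (M → Prop) → M → Prop}
    (h : ∀ t c d N : M, J.Realize ![t, c, d, N] ↔ K (fun u => Mem u c d N) t)
    {t : arith.Term (Fin n)} : (derivable J t).Realize v ↔ Der K (t.realize v) := by
  simp only [derivable, realize_subst', realize_exLast, realize_allLast, realize_mem, realize_x,
    Fin.exists_fin_succ_pi, Fin.exists_fin_zero_pi, Formula.realize_inf, Formula.realize_imp,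
    Fin.forall_fin_succ_pi, Fin.forall_fin_zero_pi]
  refine exists_congr fun c => exists_congr fun d => exists_congr fun N => and_congr Iff.rfl
    (forall_congr' fun s => imp_congr Iff.rfl ((iff_of_eq ?_).trans (h s c d N)))
  congr 1
  funext i
  fin_cases i <;> rfl

theorem realize_ackStep (t c d N : M) :
    ackStep.Realize ![t, c, d, N] ↔ AckJ (fun u => Mem u c d N) t := by
  simp only [ackStep, Formula.realize_sup, Formula.realize_inf, realize_exLast, realize_eq,
    ackFact, iterFact, realize_pair, realize_x, realize_S, realize_mul, realize_zero, known,
    Fin.exists_fin_succ_pi, Fin.exists_fin_zero_pi, realize_mem, or_assoc, and_assoc, zero_add]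
  -- What remains are coordinates of explicit tuples, equal by computation.
  exact Iff.rfl

theorem realize_ackF {k a b u : arith.Term (Fin n)} : (ackF k a b u).Realize v ↔
    AckR (k.realize v) (a.realize v) (b.realize v) (u.realize v) := by
  rw [ackF, realize_derivable realize_ackStep]
  simp only [ackFact, realize_pair, realize_zero]
  rfl

theorem realize_isNFF {k c a b m r : arith.Term (Fin n)} : (isNFF k c a b m r).Realize v ↔
    NF (k.realize v) (c.realize v) (a.realize v) (b.realize v) (m.realize v) (r.realize v) := by
  simp only [isNFF, realize_subst', realize_exLast, Formula.realize_inf, realize_ackF, realize_x,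
    realize_zero, realize_S, realize_eq, realize_add, realize_mul, realize_le, realize_lt,
    Fin.exists_fin_succ_pi, Fin.exists_fin_zero_pi, ← A_eq_iff, and_assoc, NF]
  -- The four quantified numbers are values of the Ackermann function, hence uniquely determined and
  -- eliminable.
  change (∃ p q r' s, A (k.realize v) (a.realize v) (b.realize v) = p ∧
    A (k.realize v) (a.realize v) 0 = q ∧ A (k.realize v) (a.realize v + 1) 0 = r' ∧
    A (k.realize v) (a.realize v) (b.realize v + 1) = s ∧
    c.realize v = p * m.realize v + r.realize v ∧ q ≤ c.realize v ∧ c.realize v < r' ∧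
    p ≤ c.realize v ∧ c.realize v < s ∧ r.realize v < p) ↔ _
  constructor
  · rintro ⟨_, _, _, _, rfl, rfl, rfl, rfl, h⟩
    exact h
  · exact fun h => ⟨_, _, _, _, rfl, rfl, rfl, rfl, h⟩

theorem realize_baseChangeStep (t c d N : M) :
    baseChangeStep.Realize ![t, c, d, N] ↔ BcJ (fun u => Mem u c d N) t := by
  simp only [baseChangeStep, Formula.realize_sup, Formula.realize_inf, realize_exLast, realize_eq,
    baseChangeFact, realize_pair, realize_x, realize_S, realize_add, realize_mul, realize_zero,
    known, Fin.exists_fin_succ_pi, Fin.exists_fin_zero_pi, realize_mem, realize_isNFF,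
    realize_ackF, and_assoc]
  exact Iff.rfl

theorem realize_baseChangeF {k c u : arith.Term (Fin n)} : (baseChangeF k c u).Realize v ↔
    BcR (k.realize v) (c.realize v) (u.realize v) := by
  rw [baseChangeF, realize_derivable realize_baseChangeStep]
  simp only [baseChangeFact, realize_pair]
  rfl

theorem realize_goodsteinStep (t c d N : M) :
    goodsteinStep.Realize ![t, c, d, N] ↔ GsJ (fun u => Mem u c d N) t := by
  simp only [goodsteinStep, Formula.realize_sup, Formula.realize_inf, realize_exLast, realize_eq,
    goodsteinFact, realize_pair, realize_x, realize_S, realize_zero, Formula.realize_not,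
    known, Fin.exists_fin_succ_pi, Fin.exists_fin_zero_pi, realize_mem, realize_baseChangeF,
    and_assoc, or_assoc]
  exact Iff.rfl

theorem realize_goodsteinSentence : M ⊨ goodsteinSentence ↔ ∀ l : M, ∃ k, GsR l k 0 := by
  simp only [goodsteinSentence, realize_univClosure, realize_exLast, goodsteinF,
    realize_derivable realize_goodsteinStep, goodsteinFact, realize_pair, realize_x, realize_zero,
    Fin.exists_fin_succ_pi, Fin.exists_fin_zero_pi, Fin.forall_fin_succ_pi, Fin.forall_fin_zero_pi]
  exact Iff.rfl

theorem realize_oadd (a e r : arith.Term (Fin n)) :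
    (oadd a e r).realize v = oa (a.realize v) (e.realize v) (r.realize v) := by
  simp only [oadd, oa, realize_S, realize_pair]

theorem realize_ordLtStep (t c d N : M) :
    ordLtStep.Realize ![t, c, d, N] ↔ OrdLtJ (fun u => Mem u c d N) t := by
  simp only [ordLtStep, Formula.realize_sup, Formula.realize_inf, realize_exLast, realize_eq,
    realize_oadd, realize_pair, realize_x, realize_zero, realize_lt, known,
    Fin.exists_fin_succ_pi, Fin.exists_fin_zero_pi, realize_mem, and_assoc, or_assoc]
  exact Iff.rfl

theorem realize_ordLt {t s : arith.Term (Fin n)} :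
    (ordLt t s).Realize v ↔ OrdLt (t.realize v) (s.realize v) := by
  rw [ordLt, realize_derivable realize_ordLtStep, realize_pair]
  rfl

theorem realize_ordStep (t c d N : M) :
    ordStep.Realize ![t, c, d, N] ↔ OrdJ (fun u => Mem u c d N) t := by
  simp only [ordStep, Formula.realize_sup, Formula.realize_inf, realize_exLast, realize_eq,
    realize_oadd, realize_x, realize_zero, realize_lt, realize_le, realize_ordLt, known,
    Fin.exists_fin_succ_pi, Fin.exists_fin_zero_pi, realize_mem, and_assoc]
  exact Iff.rfl

theorem realize_isOrd {t : arith.Term (Fin n)} : (isOrd t).Realize v ↔ IsOrd (t.realize v) := by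
  rw [isOrd, realize_derivable realize_ordStep]
  rfl

theorem realize_transfiniteInduction {φ : arith.Formula (Fin (n + 1))} :
    M ⊨ (transfiniteInduction φ) ↔ ∀ p : Fin n → M,
      (∀ y, IsOrd y → (∀ z, IsOrd z → OrdLt z y → φ.Realize (Fin.snoc p z : Fin (n + 1) → M)) →
        φ.Realize (Fin.snoc p y : Fin (n + 1) → M)) →
      ∀ y, IsOrd y → φ.Realize (Fin.snoc p y : Fin (n + 1) → M) := by
  simp only [transfiniteInduction, realize_univClosure, realize_allLast, Formula.realize_imp,
    realize_isOrd, realize_ordLt, realize_subst', realize_x, Fin.forall_fin_succ_pi,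
    Fin.forall_fin_zero_pi, Fin.append_right_eq_snoc, Fin.cons_zero, Fin.snoc_last,
    Fin.snoc_castSucc]
  have h : ∀ (p : Fin n → M) (y z : M), (fun i => Term.realize
      (Fin.snoc (Fin.snoc p y : Fin (n + 1) → M) z : Fin (n + 1 + 1) → M)
      ((Fin.snoc (fun i => x i.castSucc.castSucc) (x (Fin.last (n + 1))) :
        Fin (n + 1) → arith.Term (Fin (n + 1 + 1))) i)) = (Fin.snoc p z : Fin (n + 1) → M) := by
    intro p y z
    funext i
    refine Fin.lastCases ?_ (fun i => ?_) i <;>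
      simp only [Fin.snoc_last, Fin.snoc_castSucc, realize_x]
  simp only [h]

/-- A model of Peano arithmetic with transfinite induction satisfies the Goodstein sentence. -/
theorem goodsteinSentence_of_transfiniteInduction
    (h : ∀ (n : ℕ) (φ : arith.Formula (Fin (n + 1))), M ⊨ transfiniteInduction φ) :
    M ⊨ goodsteinSentence := by
  rw [realize_goodsteinSentence]
  refine exists_gsR_zero fun P hP hprog => ?_
  -- The parameters in the model become instances of the universally closed variables of the schema.
  obtain ⟨n, φ, p, hφ⟩ := hP.exists_formula
  have := realize_transfiniteInduction.1 (h n φ) p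
  simp only [hφ] at this
  exact this hprog

end PeanoArithmetic

/-! ### Every first-order model of Peano arithmetic is an ordered semiring -/

namespace PeanoArithmetic

open FirstOrder Language

/-- The Peano axioms, with induction for definable predicates. -/
class PeanoBase (N : Type) extends Language.Structure arith N, Zero N, One N, Add N, Mul N where
  funMap_zero (v : Fin 0 → N) : funMap ArithFunc.zero v = (0 : N)
  funMap_succ (v : Fin 1 → N) : funMap ArithFunc.succ v = v 0 + 1
  funMap_add (v : Fin 2 → N) : funMap ArithFunc.add v = v 0 + v 1
  funMap_mul (v : Fin 2 → N) : funMap ArithFunc.mul v = v 0 * v 1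
  one_eq : (0 : N) + 1 = 1
  succ_ne_zero (a : N) : a + 1 ≠ 0
  succ_inj {a b : N} : a + 1 = b + 1 → a = b
  add_zero (a : N) : a + 0 = a
  add_succ (a b : N) : a + (b + 1) = a + b + 1
  mul_zero (a : N) : a * 0 = 0
  mul_succ (a b : N) : a * (b + 1) = a * b + a
  induction {P : N → Prop} : DP N P → P 0 → (∀ y, P y → P (y + 1)) → ∀ y, P y

namespace PeanoBase

variable {N : Type} [PeanoBase N] {X : Type} [Ctx N X]

@[fun_prop]
theorem dF_add {f g : X → N} (hf : DF N f) (hg : DF N g) : DF N fun x => f x + g x := by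
  have := DF.funMap₂ ArithFunc.add hf hg
  simpa only [funMap_add, Matrix.cons_val_zero, Matrix.cons_val_one] using this

@[fun_prop]
theorem dF_mul {f g : X → N} (hf : DF N f) (hg : DF N g) : DF N fun x => f x * g x := by
  have := DF.funMap₂ ArithFunc.mul hf hg
  simpa only [funMap_mul, Matrix.cons_val_zero, Matrix.cons_val_one] using this

theorem zero_add (a : N) : 0 + a = a :=
  induction (P := fun a : N => (0 : N) + a = a) (by fun_prop) (add_zero 0)
    (fun a ih => by rw [add_succ, ih]) a

theorem succ_add (a b : N) : a + 1 + b = a + b + 1 :=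
  induction (P := fun b : N => a + 1 + b = a + b + 1) (by fun_prop) (by rw [add_zero, add_zero])
    (fun b ih => by rw [add_succ, ih, add_succ]) b

theorem add_comm (a b : N) : a + b = b + a :=
  induction (P := fun b : N => a + b = b + a) (by fun_prop) (by rw [add_zero, zero_add])
    (fun b ih => by rw [add_succ, ih, succ_add]) b

theorem add_assoc (a b c : N) : a + b + c = a + (b + c) :=
  induction (P := fun c : N => a + b + c = a + (b + c)) (by fun_prop) (by rw [add_zero, add_zero])
    (fun c ih => by rw [add_succ, ih, add_succ, add_succ]) c

theorem add_right_cancel {a b : N} (c : N) : a + c = b + c → a = b :=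
  induction (P := fun c : N => a + c = b + c → a = b) (by fun_prop)
    (fun h => by rwa [add_zero, add_zero] at h)
    (fun c ih h => ih (succ_inj (by rwa [add_succ, add_succ] at h))) c

theorem add_left_cancel {a b c : N} (h : c + a = c + b) : a = b :=
  add_right_cancel c (by rw [add_comm a, h, add_comm])

theorem zero_mul (a : N) : 0 * a = 0 :=
  induction (P := fun a : N => 0 * a = 0) (by fun_prop) (mul_zero 0)
    (fun a ih => by rw [mul_succ, ih, add_zero]) a

theorem succ_mul (a b : N) : (a + 1) * b = a * b + b :=
  induction (P := fun b : N => (a + 1) * b = a * b + b) (by fun_prop)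
    (by rw [mul_zero, mul_zero, add_zero])
    (fun b ih => by
      rw [mul_succ, ih, mul_succ, add_succ, add_succ, add_assoc (a * b), add_comm b a,
        ← add_assoc]) b

theorem mul_comm (a b : N) : a * b = b * a :=
  induction (P := fun b : N => a * b = b * a) (by fun_prop) (by rw [mul_zero, zero_mul])
    (fun b ih => by rw [mul_succ, ih, succ_mul]) b

theorem mul_add (a b c : N) : a * (b + c) = a * b + a * c :=
  induction (P := fun c : N => a * (b + c) = a * b + a * c) (by fun_prop)
    (by rw [add_zero, mul_zero, add_zero])
    (fun c ih => by rw [add_succ, mul_succ, ih, mul_succ, add_assoc]) c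

theorem mul_assoc (a b c : N) : a * b * c = a * (b * c) :=
  induction (P := fun c : N => a * b * c = a * (b * c)) (by fun_prop)
    (by rw [mul_zero, mul_zero, mul_zero])
    (fun c ih => by rw [mul_succ, ih, mul_succ, mul_add]) c

theorem mul_one (a : N) : a * 1 = a := by rw [← one_eq, mul_succ, mul_zero, zero_add]

theorem eq_zero_or_exists_succ (a : N) : a = 0 ∨ ∃ b, a = b + 1 :=
  induction (P := fun a : N => a = 0 ∨ ∃ b, a = b + 1) (by fun_prop) (Or.inl rfl)
    (fun a _ => Or.inr ⟨a, rfl⟩) a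

theorem eq_zero_of_add_eq_zero {a b : N} (h : a + b = 0) : b = 0 := by
  rcases eq_zero_or_exists_succ b with rfl | ⟨b, rfl⟩
  · rfl
  · exact (succ_ne_zero _ ((add_succ a b).symm.trans h)).elim

theorem exists_add_total (a b : N) : (∃ c, a + c = b) ∨ ∃ c, b + c = a := by
  refine induction (P := fun b : N => (∃ c, a + c = b) ∨ ∃ c, b + c = a) (by fun_prop)
    (Or.inr ⟨a, zero_add a⟩) ?_ b
  rintro b (⟨c, rfl⟩ | ⟨c, rfl⟩)
  · exact Or.inl ⟨c + 1, add_succ a c⟩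
  · rcases eq_zero_or_exists_succ c with rfl | ⟨c, rfl⟩
    · exact Or.inl ⟨1, by rw [add_zero]⟩
    · exact Or.inr ⟨c, by rw [succ_add, add_succ]⟩

variable (N)

/-- The commutative semiring of a model of the Peano axioms. -/
abbrev commSemiring : CommSemiring N where
  add_assoc := add_assoc
  zero_add := zero_add
  add_zero := add_zero
  add_comm := add_comm
  left_distrib := mul_add
  right_distrib a b c := by rw [mul_comm, mul_add, mul_comm c a, mul_comm c b]
  zero_mul := zero_mul
  mul_zero := mul_zero
  mul_assoc := mul_assoc
  one_mul a := by rw [mul_comm, mul_one]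
  mul_one := mul_one
  mul_comm := mul_comm
  nsmul := nsmulRec

open Classical in
/-- The linear order of a model of the Peano axioms. -/
noncomputable abbrev linearOrder : LinearOrder N where
  le a b := ∃ c, a + c = b
  le_refl a := ⟨0, add_zero a⟩
  le_trans := by
    rintro a _ _ ⟨c, rfl⟩ ⟨d, rfl⟩
    exact ⟨c + d, (add_assoc a c d).symm⟩
  le_antisymm := by
    rintro a _ ⟨c, rfl⟩ ⟨d, hd⟩
    rw [add_assoc] at hd
    have := eq_zero_of_add_eq_zero ((add_comm d c).trans
      (add_left_cancel (hd.trans (add_zero a).symm)))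
    rw [this, add_zero]
  le_total := exists_add_total
  toDecidableLE := inferInstance

theorem lt_iff {a b : N} : (linearOrder N).lt a b ↔ ∃ c, a + (c + 1) = b := by
  let _ := linearOrder N
  change a < b ↔ _
  constructor
  · intro h
    obtain ⟨c, rfl⟩ := h.le
    rcases eq_zero_or_exists_succ c with rfl | ⟨c, rfl⟩
    · rw [add_zero] at h
      exact (lt_irrefl _ h).elim
    · exact ⟨c, rfl⟩
  · rintro ⟨c, rfl⟩
    refine lt_of_le_of_ne ⟨_, rfl⟩ fun h => succ_ne_zero c ?_
    exact (add_left_cancel (h.symm.trans (add_zero a).symm))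

noncomputable instance : PAModel N where
  __ := commSemiring N
  __ := linearOrder N
  __ := (inferInstance : Language.Structure arith N)
  isStrictOrderedRing := by
    let _ := commSemiring N
    let _ := linearOrder N
    have hmul : ∀ a : N, 0 < a → ∀ b c : N, b < c → a * b < a * c := by
      intro a ha b c hbc
      obtain ⟨a, rfl⟩ := (eq_zero_or_exists_succ a).resolve_left ha.ne'
      obtain ⟨c, rfl⟩ := (lt_iff N).1 hbc
      refine (lt_iff N).2 ⟨(a + 1) * c + a, ?_⟩
      rw [mul_add, mul_add, mul_one, add_assoc]
    exact {
      add_le_add_left := by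
        rintro a _ ⟨c, rfl⟩ b
        exact ⟨c, by rw [add_assoc, add_comm b c, add_assoc]⟩
      le_of_add_le_add_left := by
        rintro a b c ⟨d, hd⟩
        exact ⟨d, add_left_cancel ((add_assoc a b d).symm.trans hd)⟩
      zero_le_one := ⟨1, zero_add 1⟩
      exists_pair_ne := ⟨0, 1, fun h => succ_ne_zero 0 (one_eq.trans h.symm)⟩
      mul_lt_mul_of_pos_left := fun a ha b c hbc => hmul a ha b c hbc
      mul_lt_mul_of_pos_right := fun a ha b c hbc => by
        change b * a < c * a
        rw [mul_comm b, mul_comm c]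
        exact hmul a ha b c hbc }
  canonicallyOrderedAdd := by
    let _ := commSemiring N
    let _ := linearOrder N
    exact {
      exists_add_of_le := by
        rintro a _ ⟨c, rfl⟩
        exact ⟨c, rfl⟩
      le_add_self := fun a b => ⟨b, add_comm a b⟩
      le_self_add := fun a b => ⟨b, rfl⟩ }
  add_one_le_of_lt {a b} h := by
    obtain ⟨c, rfl⟩ := (lt_iff N).1 h
    exact ⟨c, by rw [add_succ, succ_add]⟩
  funMap_zero := funMap_zero
  funMap_succ := funMap_succ
  funMap_add := funMap_add
  funMap_mul := funMap_mul
  induction := induction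

end PeanoBase

section OfModel

variable {N : Type} [arith.Structure N]

theorem realize_zero_eq_funMap {n : ℕ} {v : Fin n → N} :
    (0 : arith.Term (Fin n)).realize v = Structure.funMap (L := arith) ArithFunc.zero ![] :=
  congrArg (Structure.funMap (L := arith) ArithFunc.zero) (Subsingleton.elim _ _)

theorem realize_S_eq_funMap {n : ℕ} {v : Fin n → N} (t : arith.Term (Fin n)) :
    (S t).realize v = Structure.funMap (L := arith) ArithFunc.succ ![t.realize v] :=
  Term.realize_functions_apply₁

theorem realize_add_eq_funMap {n : ℕ} {v : Fin n → N} (t s : arith.Term (Fin n)) :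
    (t + s).realize v =
      Structure.funMap (L := arith) ArithFunc.add ![t.realize v, s.realize v] :=
  Term.realize_functions_apply₂

theorem realize_mul_eq_funMap {n : ℕ} {v : Fin n → N} (t s : arith.Term (Fin n)) :
    (t * s).realize v =
      Structure.funMap (L := arith) ArithFunc.mul ![t.realize v, s.realize v] :=
  Term.realize_functions_apply₂

/-- The induction axiom for `φ` holds in `N` iff induction holds for all instances of `φ`. -/
theorem realize_induction {n : ℕ} {φ : arith.Formula (Fin (n + 1))} :
    N ⊨ (induction φ) ↔ ∀ p : Fin n → N,
      φ.Realize (Fin.snoc p (Structure.funMap (L := arith) ArithFunc.zero ![]) : Fin (n + 1) → N) →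
      (∀ y, φ.Realize (Fin.snoc p y : Fin (n + 1) → N) → φ.Realize (Fin.snoc p
        (Structure.funMap (L := arith) ArithFunc.succ ![y]) : Fin (n + 1) → N)) →
      ∀ y, φ.Realize (Fin.snoc p y : Fin (n + 1) → N) := by
  simp only [induction, realize_univClosure, realize_allLast, Formula.realize_imp, realize_subst',
    Fin.forall_fin_succ_pi, Fin.forall_fin_zero_pi, Fin.append_right_eq_snoc, Fin.cons_zero]
  have h0 : ∀ p : Fin n → N, (fun i => Term.realize p
      ((Fin.snoc x 0 : Fin (n + 1) → arith.Term (Fin n)) i)) =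
      (Fin.snoc p (Structure.funMap (L := arith) ArithFunc.zero ![]) : Fin (n + 1) → N) := by
    intro p
    funext i
    refine Fin.lastCases ?_ (fun i => ?_) i <;>
      simp only [Fin.snoc_last, Fin.snoc_castSucc, realize_x, realize_zero_eq_funMap]
  have h1 : ∀ (p : Fin n → N) (y : N), (fun i => Term.realize (Fin.snoc p y : Fin (n + 1) → N)
      ((Fin.snoc (fun i => x i.castSucc) (S (x (Fin.last n))) :
        Fin (n + 1) → arith.Term (Fin (n + 1))) i)) =
      (Fin.snoc p (Structure.funMap (L := arith) ArithFunc.succ ![y]) : Fin (n + 1) → N) := by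
    intro p y
    funext i
    refine Fin.lastCases ?_ (fun i => ?_) i <;>
      simp only [Fin.snoc_last, Fin.snoc_castSucc, realize_x, realize_S_eq_funMap]
  simp only [h0, h1]

/-- A first-order model of the axioms of Peano arithmetic satisfies the Peano axioms. -/
abbrev PeanoBase.ofModel [Nonempty N] (h : ∀ σ, PA σ → N ⊨ σ) : PeanoBase N := by
  let z : N := Structure.funMap (L := arith) ArithFunc.zero ![]
  let s : N → N := fun a => Structure.funMap (L := arith) ArithFunc.succ ![a]
  let add : N → N → N := fun a b => Structure.funMap (L := arith) ArithFunc.add ![a, b]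
  let mul : N → N → N := fun a b => Structure.funMap (L := arith) ArithFunc.mul ![a, b]
  have succ_ne_zero : ∀ a, s a ≠ z := by
    have := h _ .succ_ne_zero
    simp only [realize_univClosure, Formula.realize_not, realize_eq, realize_S_eq_funMap,
      realize_zero_eq_funMap, realize_x] at this
    exact fun a => this ![a]
  have succ_inj : ∀ a b, s a = s b → a = b := by
    have := h _ .succ_inj
    simp only [realize_univClosure, Formula.realize_imp, realize_eq, realize_S_eq_funMap,
      realize_x] at this
    exact fun a b => this ![a, b]
  have add_zero : ∀ a, add a z = a := by
    have := h _ .add_zero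
    simp only [realize_univClosure, realize_eq, realize_add_eq_funMap,
      realize_zero_eq_funMap, realize_x] at this
    exact fun a => this ![a]
  have add_succ : ∀ a b, add a (s b) = s (add a b) := by
    have := h _ .add_succ
    simp only [realize_univClosure, realize_eq, realize_S_eq_funMap, realize_add_eq_funMap,
      realize_x] at this
    exact fun a b => this ![a, b]
  have mul_zero : ∀ a, mul a z = z := by
    have := h _ .mul_zero
    simp only [realize_univClosure, realize_eq, realize_mul_eq_funMap,
      realize_zero_eq_funMap, realize_x] at this
    exact fun a => this ![a]
  have mul_succ : ∀ a b, mul a (s b) = add (mul a b) a := by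
    have := h _ .mul_succ
    simp only [realize_univClosure, realize_eq, realize_S_eq_funMap, realize_add_eq_funMap,
      realize_mul_eq_funMap, realize_x] at this
    exact fun a b => this ![a, b]
  -- With `1` taken as `S 0`, successor and addition of one coincide.
  have add_one : ∀ a, add a (s z) = s a := fun a => by rw [add_succ, add_zero]
  exact {
    (inferInstance : Language.Structure arith N) with
    zero := z
    one := s z
    add := add
    mul := mul
    funMap_zero := fun v => congrArg _ (Subsingleton.elim v ![])
    funMap_succ := fun v => by
      refine Eq.trans ?_ (add_one (v 0)).symm
      exact congrArg _ (funext fun i => by rw [Fin.fin_one_eq_zero i]; rfl)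
    funMap_add := fun v => congrArg _ (funext fun i => by fin_cases i <;> rfl)
    funMap_mul := fun v => congrArg _ (funext fun i => by fin_cases i <;> rfl)
    one_eq := add_one z
    succ_ne_zero := fun a e => succ_ne_zero a ((add_one a).symm.trans e)
    succ_inj := fun {a b} e => succ_inj a b ((add_one a).symm.trans (e.trans (add_one b)))
    add_zero := add_zero
    add_succ := fun a b => by
      change add a (add b (s z)) = add (add a b) (s z)
      rw [add_one, add_one, add_succ]
    mul_zero := mul_zero
    mul_succ := fun a b => by
      change mul a (add b (s z)) = add (mul a b) a
      rw [add_one, mul_succ]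
    induction := fun {P} hP h0 hs => by
      obtain ⟨n, φ, p, hφ⟩ := hP.exists_formula
      have := realize_induction.1 (h _ (.induction φ)) p
      simp only [hφ] at this
      refine this h0 fun y hy => ?_
      have := hs y hy
      change P (add y (s z)) at this
      rwa [add_one] at this }

end OfModel

/-- Peano arithmetic with transfinite induction below `ε_ω` proves the Goodstein sentence. -/
theorem proves_goodsteinSentence : PA_TI_epsilon_omega.Proves goodsteinSentence := by
  refine Theory.Proves.of_forall_models fun N _ _ hN => ?_
  have h : ∀ σ ∈ PA_TI_epsilon_omega, N ⊨ σ := (Theory.model_iff _).1 hN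
  let _ : PeanoBase N := PeanoBase.ofModel fun σ hσ => h σ (Or.inl hσ)
  exact goodsteinSentence_of_transfiniteInduction (M := N) fun n φ => h _ (Or.inr ⟨n, φ, rfl⟩)

end PeanoArithmetic

/-! ### Well-foundedness of the notations for the natural numbers -/

namespace PeanoArithmetic

open FirstOrder Language

instance : Language.Structure arith ℕ where
  funMap := fun F v => match F with
    | ArithFunc.zero => 0
    | ArithFunc.succ => v 0 + 1
    | ArithFunc.add => v 0 + v 1
    | ArithFunc.mul => v 0 * v 1
  RelMap := fun R => isEmptyElim R

/-- Makes the development for arbitrary models available for the standard one. -/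
instance : PAModel ℕ where
  __ := (inferInstance : CommSemiring ℕ)
  __ := (inferInstance : LinearOrder ℕ)
  __ := (inferInstance : Language.Structure arith ℕ)
  isStrictOrderedRing := inferInstance
  canonicallyOrderedAdd := inferInstance
  add_one_le_of_lt := Nat.succ_le_of_lt
  funMap_zero _ := rfl
  funMap_succ _ := rfl
  funMap_add _ := rfl
  funMap_mul _ := rfl
  induction _ h0 hs y := Nat.rec h0 hs y

/-- Ordinal notations. -/
inductive ONote
  | zero : ONote
  | oadd (a : ℕ) (e r : ONote) : ONote

namespace ONote

open Ordinal

/-- The code of a notation. -/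
def code : ONote → ℕ
  | zero => 0
  | oadd a e r => oa a e.code r.code

theorem code_injective : Function.Injective code := by
  intro s
  induction s with
  | zero =>
    rintro (_ | ⟨a, e, r⟩) h
    exacts [rfl, (oa_ne_zero _ _ _ h.symm).elim]
  | oadd a e r ihe ihr =>
    rintro (_ | ⟨a', e', r'⟩) h
    · exact (oa_ne_zero _ _ _ h).elim
    · obtain ⟨rfl, he, hr⟩ := oa_inj.1 h
      rw [ihe he, ihr hr]

/-- The successor in `oa` makes the codes of `e` and `r` strictly smaller, so the notation is found
by strong induction. -/
theorem exists_code_eq (t : ℕ) (h : IsOrd t) : ∃ s : ONote, s.code = t := by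
  induction t using Nat.strong_induction_on with
  | _ t ih =>
    rcases isOrd_iff.1 h with rfl | ⟨a, e, r, rfl, he, hr, -⟩
    · exact ⟨zero, rfl⟩
    · have h1 : pr e r ≤ pr a (pr e r) := le_add_right
        ((Nat.le_add_left _ _).trans (Nat.le_mul_self _))
      have h2 : e ≤ pr e r := Nat.le_add_left _ _
      have h3 : r ≤ pr e r := le_add_right ((Nat.le_add_left _ _).trans (Nat.le_mul_self _))
      obtain ⟨e, rfl⟩ := ih e (Nat.lt_succ_of_le (h2.trans h1)) he
      obtain ⟨r, rfl⟩ := ih r (Nat.lt_succ_of_le (h3.trans h1)) hr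
      exact ⟨oadd a e r, rfl⟩

/-- The least ordinal of the notations `[a, e, r]` is `ω ^ base a`. -/
noncomputable def base : ℕ → Ordinal.{0}
  | 0 => 0
  | a + 1 => ε_ (a : Ordinal)

/-- The ordinal denoted by a notation. -/
noncomputable def eval : ONote → Ordinal.{0}
  | zero => 0
  | oadd a e r => ω ^ (base a + e.eval) + r.eval

/-- Normal forms. -/
def Normal : ONote → Prop
  | zero => True
  | oadd a e r => e.Normal ∧ r.Normal ∧
      (e = zero ∨ ∃ a' e' r', e = oadd a' e' r' ∧ a' ≤ a) ∧
      (r = zero ∨ ∃ a' e' r', r = oadd a' e' r' ∧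
        (a' < a ∨ (a' = a ∧ (e' = e ∨ OrdLt e'.code e.code))))

theorem normal_of_isOrd (s : ONote) (h : IsOrd s.code) : s.Normal := by
  have hz : ∀ {t : ONote}, t.code = 0 → t = zero := fun {t} h => code_injective h
  have hc : ∀ {t : ONote} {a e r}, t.code = oa a e r → ∃ e' r', t = oadd a e' r' ∧ e'.code = e ∧
      r'.code = r := by
    rintro (_ | ⟨a', e', r'⟩) a e r h
    · exact (oa_ne_zero _ _ _ h.symm).elim
    · obtain ⟨rfl, he, hr⟩ := oa_inj.1 h
      exact ⟨e', r', rfl, he, hr⟩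
  induction s with
  | zero => trivial
  | oadd a e r ihe ihr =>
    rcases isOrd_iff.1 h with h | ⟨a', e', r', h, he, hr, h1, h2⟩
    · exact (oa_ne_zero _ _ _ h).elim
    · obtain ⟨rfl, rfl, rfl⟩ := oa_inj.1 h
      refine ⟨ihe he, ihr hr, h1.imp hz ?_, h2.imp hz ?_⟩
      · rintro ⟨a', e', r', h, ha⟩
        obtain ⟨e₁, r₁, rfl, rfl, rfl⟩ := hc h
        exact ⟨_, _, _, rfl, ha⟩
      · rintro ⟨a', e', r', h, ha⟩
        obtain ⟨e₁, r₁, rfl, rfl, rfl⟩ := hc h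
        exact ⟨_, _, _, rfl, ha.imp_right (And.imp_right (Or.imp_left fun h => code_injective h))⟩

theorem base_strictMono : StrictMono base := by
  refine strictMono_nat_of_lt_succ fun a => ?_
  cases a with
  | zero => exact epsilon_pos _
  | succ a =>
    refine veblen_lt_veblen_iff_right.2 ?_
    exact_mod_cast Nat.lt_succ_self a

theorem opow_base_succ (a : ℕ) : ω ^ base (a + 1) = base (a + 1) := omega0_opow_epsilon _

/-- The ordinal `base (a + 1)` is an epsilon number, so it is closed under addition and powers of
`ω`. An exponent `base a' + |e|` stays below it, as the normal form condition on `e` gives `|e| <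
base (a' + 1)`. -/
theorem eval_lt_base (s : ONote) (hs : s.Normal) (a : ℕ)
    (h : s = zero ∨ ∃ a' e r, s = oadd a' e r ∧ a' ≤ a) : s.eval < base (a + 1) := by
  induction s generalizing a with
  | zero => exact epsilon_pos _
  | oadd a' e r ihe ihr =>
    obtain ⟨he, hr, h1, h2⟩ := hs
    replace h : a' ≤ a := by
      rcases h with h | ⟨_, _, _, h, ha⟩
      · cases h
      · cases h
        exact ha
    have hp := isPrincipal_add_omega0_opow (base (a + 1))
    rw [opow_base_succ] at hp
    have hle : base (a' + 1) ≤ base (a + 1) := base_strictMono.monotone (by omega)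
    refine hp ?_ (ihr hr a (h2.imp_right ?_))
    · rw [← opow_base_succ a]
      refine (opow_lt_opow_iff_right one_lt_omega0).2 (hp ?_ ((ihe he a' h1).trans_le hle))
      exact base_strictMono (by omega)
    · rintro ⟨a₁, e₁, r₁, rfl, h3⟩
      exact ⟨_, _, _, rfl, by omega⟩

/-- The number of terms of a notation. -/
def size : ONote → ℕ
  | zero => 0
  | oadd _ e r => e.size + r.size + 1

theorem eval_lt_and_eval_lt (N : ℕ) :
    (∀ a e r, (oadd a e r).size ≤ N → (oadd a e r).Normal →
      (oadd a e r).eval < ω ^ (base a + e.eval + 1)) ∧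
    ∀ s t : ONote, s.size + t.size ≤ N → s.Normal → t.Normal → OrdLt s.code t.code →
      s.eval < t.eval := by
  induction N using Nat.strong_induction_on with
  | _ N ih =>
    have key : ∀ a e r, (oadd a e r).size ≤ N → (oadd a e r).Normal →
        (oadd a e r).eval < ω ^ (base a + e.eval + 1) := by
      rintro a e r hN ⟨he, hr, h1, h2⟩
      have hlt : ω ^ (base a + e.eval) < ω ^ (base a + e.eval + 1) :=
        (opow_lt_opow_iff_right one_lt_omega0).2 (lt_add_one _)
      refine isPrincipal_add_omega0_opow _ hlt ?_
      rcases h2 with rfl | ⟨a', e', r', rfl, ha | ⟨rfl, rfl | hlt'⟩⟩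
      · exact opow_pos _ omega0_pos
      -- A tail of smaller index `a'` is below `base (a' + 1) ≤ base a`, and an ordinal is at most
      -- the power of `ω` with that exponent.
      · refine ((eval_lt_base _ hr a' (Or.inr ⟨_, _, _, rfl, le_rfl⟩)).trans_le ?_).trans hlt
        exact (base_strictMono.monotone ha).trans ((right_le_opow _ one_lt_omega0).trans
          (opow_le_opow_right omega0_pos (le_add_right le_rfl)))
      · simp only [size] at hN
        exact (ih (oadd a' e' r').size (by simp only [size]; omega)).1 a' e' r' le_rfl hr
      · simp only [size] at hN
        have h3 := (ih (oadd a' e' r').size (by simp only [size]; omega)).1 a' e' r' le_rfl hr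
        have h4 := (ih (e'.size + e.size) (by omega)).2 e' e le_rfl hr.1 he hlt'
        exact h3.trans ((opow_lt_opow_iff_right one_lt_omega0).2
          (Order.lt_add_one_iff.2 (Order.add_one_le_of_lt ((add_lt_add_iff_left _).2 h4))))
    refine ⟨key, ?_⟩
    rintro (_ | ⟨a, e, r⟩) (_ | ⟨a', e', r'⟩) hN hs ht h
    · rcases ordLt_iff.1 h with ⟨-, _, _, _, h⟩ | ⟨_, _, _, _, _, _, h, -⟩
      · exact (oa_ne_zero _ _ _ h.symm).elim
      · exact (oa_ne_zero _ _ _ h.symm).elim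
    · exact (opow_pos _ omega0_pos).trans_le (le_add_right le_rfl)
    · rcases ordLt_iff.1 h with ⟨h, -⟩ | ⟨_, _, _, _, _, _, -, h, -⟩
      · exact (oa_ne_zero _ _ _ h).elim
      · exact (oa_ne_zero _ _ _ h.symm).elim
    · have hs' := key a e r (by simp only [size] at hN ⊢; omega) hs
      rcases ordLt_iff.1 h with ⟨h, -⟩ | ⟨a₁, e₁, r₁, a₂, e₂, r₂, h, h', h3⟩
      · exact (oa_ne_zero _ _ _ h).elim
      obtain ⟨rfl, rfl, rfl⟩ := oa_inj.1 h
      obtain ⟨rfl, rfl, rfl⟩ := oa_inj.1 h'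
      simp only [size] at hN
      rcases h3 with ha | ⟨rfl, he⟩ | ⟨rfl, he, hr⟩
      · refine (eval_lt_base _ hs a (Or.inr ⟨_, _, _, rfl, le_rfl⟩)).trans_le ?_
        exact (base_strictMono.monotone ha).trans ((right_le_opow _ one_lt_omega0).trans
          ((opow_le_opow_right omega0_pos (le_add_right le_rfl)).trans (le_add_right le_rfl)))
      · have h4 := (ih (e.size + e'.size) (by omega)).2 e e' le_rfl hs.1 ht.1 he
        refine hs'.trans_le ((opow_le_opow_right omega0_pos ?_).trans (le_add_right le_rfl))
        rw [_root_.add_assoc]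
        gcongr
        exact Order.add_one_le_of_lt h4
      · obtain rfl := code_injective he
        have h4 := (ih (r.size + r'.size) (by omega)).2 r r' le_rfl hs.2.1 ht.2.1 hr
        simp only [eval]
        gcongr

end ONote

/-- Transfinite induction along the notations holds for the natural numbers. -/
theorem ordLt_induction (P : ℕ → Prop)
    (hP : ∀ y, IsOrd y → (∀ z, IsOrd z → OrdLt z y → P z) → P y) (y : ℕ) (hy : IsOrd y) : P y := by
  obtain ⟨s, rfl⟩ := ONote.exists_code_eq y hy
  -- Evaluation is monotone on normal forms, so well-foundedness of the ordinals transfers to the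
  -- codes.
  induction h : s.eval using WellFoundedLT.induction generalizing s with
  | ind o ih =>
    subst h
    refine hP _ hy fun z hz hzs => ?_
    obtain ⟨t, rfl⟩ := ONote.exists_code_eq z hz
    exact ih _ ((ONote.eval_lt_and_eval_lt _).2 t s le_rfl (t.normal_of_isOrd hz)
      (s.normal_of_isOrd hy) hzs) t hz rfl

/-! ### The functions of the natural numbers -/

open AckGoodstein

theorem A_eq_ackermann_and (k a : ℕ) : (∀ b, A k a b = ackermann k a b) ∧
    ∀ i u, It k a i u = (fun x => ackermann k a x)^[i] u := by
  have it : ∀ a : ℕ, (∀ b, A k a b = ackermann k a b) →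
      ∀ i u, It k a i u = (fun x => ackermann k a x)^[i] u := by
    intro a h i u
    induction i with
    | zero => exact It_zero k a u
    | succ i ih =>
      rw [Function.iterate_succ_apply', ← ih, ← h]
      exact It_succ k a i u
  suffices H : ∀ b, A k a b = ackermann k a b from ⟨H, it a H⟩
  induction a with
  | zero =>
    intro b
    induction b with
    | zero => rw [ackermann, pow_zero]; exact A_zero_zero k
    | succ b ih =>
      refine (A_zero_succ k b).trans ?_
      rw [ih, ackermann, ackermann, pow_succ]
  | succ a iha =>
    intro b
    induction b with
    | zero =>
      refine (A_succ_zero k a).trans ?_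
      rw [it a iha, ackermann]
    | succ b ih =>
      refine (A_succ_succ k a b).trans ?_
      rw [it a iha, ih, ackermann]

/-- This direction suffices: normal forms exist in the model, and `baseChange_of_isNF` accepts any
normal form. -/
theorem isNF_of_NF {k c a b m n : ℕ} (h : NF k c a b m n) : IsNF k c a b m n := by
  unfold NF at h
  simp only [(A_eq_ackermann_and _ _).1] at h
  exact ⟨h.1, h.2.1, h.2.2.1, h.2.2.2.1, h.2.2.2.2.1, h.2.2.2.2.2⟩

theorem Bc_eq_baseChange (j c : ℕ) : Bc j c = baseChange (j + 2) c := by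
  induction c using Nat.strong_induction_on with
  | _ c ih =>
    have hk : 2 ≤ j + 2 := Nat.le_add_left _ _
    rcases Nat.eq_zero_or_pos c with rfl | hc
    · rw [baseChange_zero]
      exact Bc_zero j
    · obtain ⟨a, b, m, n, h⟩ := exists_NF hk hc
      rw [baseChange_of_isNF hk (isNF_of_NF h), ← ih b (h.lt hk).1, ← ih n (h.lt hk).2,
        ← (A_eq_ackermann_and _ _).1]
      exact Bc_of_NF h

theorem goodstein_eq_of_gsR {l k v : ℕ} (h : GsR l k v) : goodstein l k = v := by
  induction k generalizing v with
  | zero => exact (gsR_zero.1 h).symm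
  | succ k ih =>
    obtain ⟨u, hu, ⟨rfl, rfl⟩ | ⟨h0, hv⟩⟩ := gsR_succ.1 h
    · rw [goodstein, if_pos (ih hu)]
    -- The relation records the base change as `v + 1`, so truncated subtraction of one returns `v`.
    · rw [goodstein, ih hu, if_neg h0, ← Bc_eq_baseChange, hv]
      rfl

theorem exists_goodstein_eq_zero (l : ℕ) : ∃ k, goodstein l k = 0 := by
  obtain ⟨k, hk⟩ := exists_gsR_zero (fun P _ => ordLt_induction P) l
  exact ⟨k, goodstein_eq_of_gsR hk⟩

end PeanoArithmetic

/-! ### Truth and provability combined -/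

theorem mainTheorem1 :
    (∀ ℓ : ℕ, ∃ k : ℕ, AckGoodstein.goodstein ℓ k = 0) ∧
      PeanoArithmetic.PA_TI_epsilon_omega.Proves PeanoArithmetic.goodsteinSentence :=
  ⟨PeanoArithmetic.exists_goodstein_eq_zero, PeanoArithmetic.proves_goodsteinSentence⟩
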